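/- Let $S$ be a connected oriented punctured surface without boundary, obtained by removing finitely many (at least one) points from a closed oriented surface, and let $\lambda$ be an ideal triangulation of $S$ with edges $\lambda_1,\dots,\lambda_n$ and faces $T_1,\dots,T_m$. Let $q\in\mathbb C^*$ and let $N>0$ be the smallest positive integer such that $q^N=(-1)^{N+1}$ (assumed to exist). *Algebra.* The Chekhov–Fock algebra $\mathcal T_\lambda^q$ is generated by $X_1^{\pm1},\dots,X_n^{\pm1}$ with relations $X_iX_j=q^{2\sigma_{ij}}X_jX_i$, where $\sigma_{ij}=a_{ij}-a_{ji}$ and $a_{ij}$ is the number of angular sectors of the faces delimited by $\lambda_i$ and $\lambda_j$ with $\lambda_i$ coming first counterclockwise; put $H=q^{-\sum_{i<j}\sigma_{ij}}X_1\cdots X_n$. The triangle algebra $\mathcal T_{T_j}^q$ of a face is generated by $X_{1}^{\pm1},X_{2}^{\pm1},X_{3}^{\pm1}$, associated to its sides in clockwise order, with $X_kX_{k+1}=q^2X_{k+1}X_k$ (indices mod 3). The algebra $\mathcal T_\lambda^q$ maps to $\bigotimes_j\mathcal T_{T_j}^q$ by sending $X_i$ to the tensor product of the two generators of the sides glued along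 $\lambda_i$ if these belong to distinct faces, and to $q^{-1}YZ$ if these are two sides of the same face, with generators $Y,Z$, the side of $Y$ coming first counterclockwise around their common vertex. A local representation of $\mathcal T_\lambda^q$ is a family of irreducible representations $\rho_j:\mathcal T_{T_j}^q\to\mathrm{End}(V_j)$ ($j=1,\dots,m$), where two families on the same spaces $V_j$ are identified if, for each edge, the images of the generators of the two sides corresponding to it are multiplied by $a$ and $a^{-1}$ respectively, for some $a\in\mathbb C^*$. It determines a representation $\rho:\mathcal T_\lambda^q\to\mathrm{End}(V_1\otimes\cdots\otimes V_m)$, the restriction of $\bigotimes_j\rho_j$. Two local representations are isomorphic if they are represented by families $(\rho_j)$, $(\rho_j')$ with $\rho_j\cong\rho_j'$ for every $j$. *Geometry.* An enhanced homomorphism $(r,\xi)$ consists of a homomorphism $r:\pi_1(S)\to\mathrm{Isom}^+(\mathbb H^3)=\mathrm{PSL}_2(\mathbb C)$ and of a point $\xi_\pi\in\partial_\infty\mathbb H^3=\mathbb{CP}^1$ fixed by $r(\pi)$ for every peripheral subgroup $\pi$ of $\pi_1(S)$, with $\xi_{\gamma\pi\gamma^{-1}}=r(\gamma)\xi_\pi$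 for all $\gamma\in\pi_1(S)$; $A\in \mathrm{Isom}^+(\mathbb H^3)$ conjugates it to $(ArA^{-1},A\xi)$. It realizes $\lambda$ if there is a pleated surface, namely a continuous $r$-equivariant map $\tilde f:\tilde S\to\mathbb H^3$ from the universal cover that sends homeomorphically each lift of an edge of $\lambda$ to a complete geodesic and each lift of a face to an ideal triangle, such that $\xi_\pi$ is the common vertex of the images of the lifted faces ending at the puncture of $\tilde S$ corresponding to $\pi$. Its edge weights are then the exponential shear-bend parameters $x_i=e^{t_i+\mathrm i\theta_i}\in\mathbb C^*$ of $\tilde f$, where, along a lift of $\lambda_i$, $t_i$ is the oriented distance between the orthogonal projections of the opposite vertices of the two adjacent ideal triangles (the geodesic being oriented as boundary of the first triangle) and $\theta_i$ is the external dihedral angle. Its total peripheral load is $h_r=x_1\cdots x_n$. **Statement.** The edge weights $x_1,\dots,x_n$ and the total peripheral load $h_r$ of an enhanced homomorphism realizing $\lambda$ are well defined (independent of $\tilde f$). Say that a local representation $\rho$ and a pair $((r,\xi),h)$, with $(r,\xi)$ an enhanced homomorphism realizing $\lambda$ and $h\in\mathbb C^*$, are associated if $\rho(X_i^N)=x_i\,\mathrm{Id}$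 for every $i$, where the $x_i$ are the edge weights of $(r,\xi)$, and $\rho(H)=h\,\mathrm{Id}$. Then: 1. every local representation $\rho$ of $\mathcal T_\lambda^q$ is associated to some pair $((r,\xi),h)$, and every such pair satisfies $h^N=h_r$; 2. if $\rho$ is associated to $((r,\xi),h)$, then it is associated to $((r',\xi'),h')$ if and only if $(r',\xi')$ is conjugate to $(r,\xi)$ and $h'=h$; 3. if $\rho$ is associated to $((r,\xi),h)$, then another local representation $\rho'$ is associated to $((r,\xi),h)$ if and only if $\rho'$ is isomorphic to $\rho$ as a local representation; 4. conversely, every pair $((r,\xi),h)$, with $(r,\xi)$ an enhanced homomorphism realizing $\lambda$ and $h^N=h_r$, is associated to some local representation of $\mathcal T_\lambda^q$. In other words, isomorphism classes of local representations of $\mathcal T_\lambda^q$ are in one-to-one correspondence with pairs consisting of a conjugacy class of enhanced homomorphisms realizing $\lambda$ and of an $N$-th root of its total peripheral load. -/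

import Mathlib

open scoped TensorProduct LinearAlgebra.Projectivization Matrix MatrixGroups ComplexOrder

universe u

/-! ### Ideal triangulations of punctured surfaces without boundary -/

/-- An ideal triangulation, with `m` faces and `n` edges, of a connected oriented punctured surface
`S` without boundary: `S` is obtained from `m` oriented triangles with their vertices deleted by
gluing their sides in pairs, by orientation-reversing identifications.

The sides of the face `j` are the pairs `(j, 0)`, `(j, 1)`, `(j, 2)`, which occur in this order
*clockwise* around the face; the vertex `k` of a face is the one opposite to its side `k`.
The `i`-th edge `λ_i` is obtained by gluing the two (distinct) sides `side (i, false)` and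
`side (i, true)`, which may belong to the same face. -/
structure IdealTriangulation (m n : ℕ) where
  side : Fin n × Bool ≃ Fin m × Fin 3
  connected : ∀ j k : Fin m, Relation.ReflTransGen
    (fun j' k' => ∃ i b, (side (i, b)).1 = j' ∧ (side (i, !b)).1 = k') j k

namespace IdealTriangulation

variable {m n : ℕ} (T : IdealTriangulation m n)

/-- The edge of the triangulation to which a side of a face corresponds. -/
def edge (s : Fin m × Fin 3) : Fin n := (T.side.symm s).1

/-- The side of a face to which a given side is glued. -/
def opp (s : Fin m × Fin 3) : Fin m × Fin 3 :=
  T.side ((T.side.symm s).1, !(T.side.symm s).2)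

/-! ### Fundamental group and universal cover

Up to homotopy, a path in `S` which goes from face to face is determined by the sequence of sides
that it crosses, modulo the deletion of back-and-forth crossings of the same edge. Crossing the
edge `i` out of the side `side (i, b)` is recorded by the letter `(i, b)`; the letters `(i, b)` and
`(i, !b)` are inverse to each other, so that a homotopy class of paths starting in a given face is
an element of the free group on the edges. -/

/-- The letter recording that a path leaves a face through the side `s`. -/
def letter (s : Fin m × Fin 3) : FreeGroup (Fin n) := FreeGroup.mk [T.side.symm s]

/-- `T.IsPath o j w` : the element `w` of the free group on the edges is the homotopy class of a
path in `S` that goes from the face `o` to the face `j`. -/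
inductive IsPath (o : Fin m) : Fin m → FreeGroup (Fin n) → Prop
  | refl : IsPath o o 1
  | cross (s : Fin m × Fin 3) (w : FreeGroup (Fin n)) :
      IsPath o s.1 w → IsPath o (T.opp s).1 (w * T.letter s)

variable {T}

theorem opp_opp (s : Fin m × Fin 3) : T.opp (T.opp s) = s := by
  simp [opp]

theorem letter_opp (s : Fin m × Fin 3) : T.letter (T.opp s) = (T.letter s)⁻¹ := by
  simp [letter, opp, FreeGroup.inv_mk, FreeGroup.invRev]

theorem IsPath.trans {o j k : Fin m} {v w : FreeGroup (Fin n)} (hv : T.IsPath o j v)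
    (hw : T.IsPath j k w) : T.IsPath o k (v * w) := by
  induction hw with
  | refl => simpa using hv
  | cross s w _ ih => rw [← mul_assoc]; exact IsPath.cross s _ ih

theorem IsPath.symm {o j : Fin m} {w : FreeGroup (Fin n)} (hw : T.IsPath o j w) :
    T.IsPath j o w⁻¹ := by
  induction hw with
  | refl => simpa using IsPath.refl
  | cross s w _ ih =>
    have h := IsPath.cross (T := T) (o := (T.opp s).1) (T.opp s) 1 IsPath.refl
    rw [opp_opp, letter_opp, one_mul] at h
    rw [mul_inv_rev]
    exact h.trans ih

variable (T)

/-- The fundamental group `π₁(S)`, with base point in the face `o`. -/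
def piOne (o : Fin m) : Subgroup (FreeGroup (Fin n)) where
  carrier := {w | T.IsPath o o w}
  one_mem' := IsPath.refl
  mul_mem' hv hw := hv.trans hw
  inv_mem' hw := hw.symm

/-- The faces of the triangulation `λ~` of the universal cover of `S`: these are the pairs
consisting of a face of `S` and of a homotopy class of paths from `o` to this face. -/
def LiftedFace (o : Fin m) : Type := {p : Fin m × FreeGroup (Fin n) // T.IsPath o p.1 p.2}

variable {T} {o : Fin m}

/-- The face of `S` of which a face of the universal cover is a lift. -/
def LiftedFace.face (F : T.LiftedFace o) : Fin m := F.1.1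

/-- The homotopy class of paths corresponding to a face of the universal cover. -/
def LiftedFace.word (F : T.LiftedFace o) : FreeGroup (Fin n) := F.1.2

/-- The face of the universal cover on the other side of the side `k` of `F`. -/
def LiftedFace.neighbor (F : T.LiftedFace o) (k : Fin 3) : T.LiftedFace o :=
  ⟨((T.opp (F.face, k)).1, F.word * T.letter (F.face, k)), IsPath.cross (F.face, k) F.word F.2⟩

/-- The action of the fundamental group on the faces of the universal cover. -/
def LiftedFace.deck (γ : T.piOne o) (F : T.LiftedFace o) : T.LiftedFace o :=
  ⟨(F.face, γ.1 * F.word), IsPath.trans γ.2 F.2⟩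

end IdealTriangulation

/-- A triangle with its vertices deleted, in barycentric coordinates. Its side `k` is the subset
where the coordinate `k` vanishes. -/
def IdealSimplex : Type :=
  {x : Fin 3 → ℝ // (∀ k, 0 ≤ x k) ∧ ∑ k, x k = 1 ∧ ∀ k, x k ≠ 1}

instance : TopologicalSpace IdealSimplex := instTopologicalSpaceSubtype

namespace IdealTriangulation

variable {m n : ℕ} (T : IdealTriangulation m n) (o : Fin m)

/-- The gluing of adjacent faces of the universal cover. In the clockwise orientation, the side `k`
of a face goes from its vertex `k + 1` to its vertex `k + 2`, and the gluing reverses this. -/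
def CoverGlue (P Q : Σ _ : T.LiftedFace o, IdealSimplex) : Prop :=
  ∃ k k' : Fin 3, Q.1 = P.1.neighbor k ∧ k' = (T.opp (P.1.face, k)).2 ∧
    P.2.1 k = 0 ∧ Q.2.1 k' = 0 ∧
    Q.2.1 (k' + 1) = P.2.1 (k + 2) ∧ Q.2.1 (k' + 2) = P.2.1 (k + 1)

/-- The universal cover of `S`, as a topological space. -/
def UniversalCover : Type := Quot (T.CoverGlue o)

instance : TopologicalSpace (T.UniversalCover o) := instTopologicalSpaceQuot

variable {T o}

/-- The inclusion of a (closed) face in the universal cover. -/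
def LiftedFace.incl (F : T.LiftedFace o) (p : IdealSimplex) : T.UniversalCover o :=
  Quot.mk _ ⟨F, p⟩

variable (T)

/-- Going counterclockwise around a puncture: from the angular sector of a face `c.1` at its
vertex `c.2`, to the next sector, reached by crossing the side `c.2 + 2`. -/
def turn (c : Fin m × Fin 3) : Fin m × Fin 3 :=
  ((T.opp (c.1, c.2 + 2)).1, (T.opp (c.1, c.2 + 2)).2 + 2)

/-- The homotopy class of a loop which starts in the angular sector `c` and goes once
counterclockwise around the corresponding puncture. -/
noncomputable def peripheralLoop (c : Fin m × Fin 3) : FreeGroup (Fin n) :=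
  ((List.range (Function.minimalPeriod T.turn c)).map
    (fun j => T.letter ((T.turn^[j] c).1, (T.turn^[j] c).2 + 2))).prod

variable {T}

/-- The peripheral subgroup of `π₁(S)` corresponding to the vertex `k` of the face `F` of the
universal cover. -/
noncomputable def LiftedFace.peripheral (F : T.LiftedFace o) (k : Fin 3) :
    Subgroup (T.piOne o) :=
  (Subgroup.zpowers (F.word * T.peripheralLoop (F.face, k) * F.word⁻¹)).subgroupOf (T.piOne o)

variable (T o)

/-- The set `Π` of peripheral subgroups of `π₁(S)`. -/
def Peripheral : Type :=
  {H : Subgroup (T.piOne o) // ∃ (F : T.LiftedFace o) (k : Fin 3), H = F.peripheral k}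

variable {T o}

/-- The peripheral subgroup at a vertex of the universal cover, as an element of `Π`. -/
noncomputable def LiftedFace.vertexGroup (F : T.LiftedFace o) (k : Fin 3) : T.Peripheral o :=
  ⟨F.peripheral k, F, k, rfl⟩

end IdealTriangulation

/-! ### Hyperbolic 3-space -/

/-- The sphere at infinity `∂_∞ ℍ³ = ℂP¹`. -/
abbrev SphereAtInfinity : Type := ℙ ℂ (Fin 2 → ℂ)

/-- Hyperbolic 3-space, in the hyperboloid model: the Minkowski space is the space of hermitian
2 by 2 matrices with the determinant as quadratic form, and `ℍ³` consists of the positive definite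
matrices of determinant 1. The group `SL₂(ℂ)` acts by `(g, P) ↦ g P g*`, and this identifies
`Isom⁺(ℍ³)` with `PSL₂(ℂ)`. -/
def HyperbolicSpace : Type := {P : Matrix (Fin 2) (Fin 2) ℂ // P.PosDef ∧ P.det = 1}

namespace HyperbolicSpace

noncomputable instance : TopologicalSpace HyperbolicSpace := instTopologicalSpaceSubtype

noncomputable instance : MulAction SL(2, ℂ) HyperbolicSpace where
  smul g P := ⟨(g : Matrix (Fin 2) (Fin 2) ℂ) * P.1 * (g : Matrix (Fin 2) (Fin 2) ℂ)ᴴ, by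
    refine ⟨P.2.1.mul_mul_conjTranspose_same ?_, ?_⟩
    · refine Matrix.vecMul_injective_of_isUnit ?_
      exact (Matrix.isUnit_iff_isUnit_det (g : Matrix (Fin 2) (Fin 2) ℂ)).2 (by simp)
    · simp [P.2.2]⟩
  one_smul P := Subtype.ext (by change _ * _ * _ = _; simp)
  mul_smul g h P := Subtype.ext (by
    change _ * _ * _ = _ * (_ * _ * _) * _
    simp [Matrix.conjTranspose_mul, Matrix.mul_assoc])

theorem coe_smul (g : SL(2, ℂ)) (P : HyperbolicSpace) :
    (g • P).1 = (g : Matrix (Fin 2) (Fin 2) ℂ) * P.1 * (g : Matrix (Fin 2) (Fin 2) ℂ)ᴴ := rfl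

theorem center_smul (g : SL(2, ℂ)) (hg : g ∈ Subgroup.center SL(2, ℂ)) (P : HyperbolicSpace) :
    g • P = P := by
  obtain ⟨r, hr, h⟩ := Matrix.SpecialLinearGroup.mem_center_iff.1 hg
  have hn : r * star r = 1 := by
    have h2 : ‖r‖ = 1 := by
      have := congrArg norm hr
      rw [norm_pow, norm_one] at this
      exact (pow_eq_one_iff_of_nonneg (norm_nonneg _) (by simp)).1 this
    rw [show star r = (starRingEnd ℂ) r from rfl, Complex.mul_conj, Complex.normSq_eq_norm_sq, h2]
    simp
  apply Subtype.ext
  rw [coe_smul, ← h]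
  ext i j
  have : r * P.1 i j * star r = P.1 i j := by
    rw [mul_comm r, mul_assoc, hn, mul_one]
  simpa [Matrix.scalar_apply, Matrix.diagonal_conjTranspose, Matrix.mul_diagonal,
    Matrix.diagonal_mul] using this

/-- The action of `Isom⁺(ℍ³) = PSL₂(ℂ)` on `ℍ³`. -/
noncomputable instance : MulAction PSL(2, ℂ) HyperbolicSpace :=
  MulAction.compHom HyperbolicSpace
    (QuotientGroup.lift (Subgroup.center SL(2, ℂ)) (MulAction.toPermHom SL(2, ℂ) HyperbolicSpace)
      (fun g hg => Equiv.ext (fun P => center_smul g hg P)) :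
      PSL(2, ℂ) →* Equiv.Perm HyperbolicSpace)

/-- A vector on the light ray of the Minkowski space that represents the point `a` of the sphere at
infinity (well defined up to a positive factor). -/
noncomputable def light (a : SphereAtInfinity) : Matrix (Fin 2) (Fin 2) ℂ :=
  Matrix.vecMulVec a.rep (star a.rep)

/-- The Minkowski scalar product, normalized so that `minkowski X X = det X` and
`minkowski P Q = cosh d(P, Q)` for `P` and `Q` in `ℍ³`. -/
noncomputable def minkowski (X Y : Matrix (Fin 2) (Fin 2) ℂ) : ℝ :=
  ((X.trace * Y.trace - (X * Y).trace) / 2).re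

/-- The complete geodesic of `ℍ³` with end points `a` and `b`. -/
def geodesic (a b : SphereAtInfinity) : Set HyperbolicSpace :=
  {P | ∃ s t : ℝ, 0 ≤ s ∧ 0 ≤ t ∧ P.1 = s • light a + t • light b}

/-- The ideal triangle of `ℍ³` with vertices `a 0`, `a 1`, `a 2`. -/
def idealTriangle (a : Fin 3 → SphereAtInfinity) : Set HyperbolicSpace :=
  {P | ∃ c : Fin 3 → ℝ, (∀ k, 0 ≤ c k) ∧ P.1 = ∑ k, c k • light (a k)}

/-- The half-plane of `ℍ³` bounded by the geodesic with end points `a` and `b`, and whose closure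
contains the point `z` of the sphere at infinity. -/
def halfPlane (a b z : SphereAtInfinity) : Set HyperbolicSpace :=
  {P | ∃ s t u : ℝ, 0 ≤ u ∧ P.1 = s • light a + t • light b + u • light z}

/-- `t` is the oriented distance from `w` to `w'` in the geodesic going from `a` to `b`, which
contains both points. For `w = s • light a + u • light b`, the curve
`t ↦ (exp (-t) * s) • light a + (exp t * u) • light b` is the unit speed parametrization of this
geodesic, going towards `b` and starting at `w`. -/
def IsOrientedDist (a b : SphereAtInfinity) (w w' : HyperbolicSpace) (t : ℝ) : Prop :=
  ∃ s u : ℝ, 0 < s ∧ 0 < u ∧ w.1 = s • light a + u • light b ∧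
    w'.1 = (Real.exp (-t) * s) • light a + (Real.exp t * u) • light b

/-- `w` is the orthogonal projection of the point `z` of the sphere at infinity to the geodesic
with end points `a` and `b`: at `w = s • light a + u • light b`, the tangent vector
`u • light b - s • light a` of this geodesic is orthogonal to the geodesic joining `w` to `z`. -/
def IsProjection (a b z : SphereAtInfinity) (w : HyperbolicSpace) : Prop :=
  ∃ s u : ℝ, 0 < s ∧ 0 < u ∧ w.1 = s • light a + u • light b ∧
    minkowski (u • light b - s • light a) (light z) = 0

/-- `g` is the rotation by the angle `φ` around the geodesic oriented from `a` to `b`. If `a = 0`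
and `b = ∞` in `ℂP¹ = ℂ ∪ {∞}`, this is the extension to `ℍ³` of `z ↦ exp (i φ) z`. -/
def IsRotation (a b : SphereAtInfinity) (φ : ℝ) (g : SL(2, ℂ)) : Prop :=
  g • a.rep = Complex.exp (-(φ * Complex.I) / 2) • a.rep ∧
    g • b.rep = Complex.exp (φ * Complex.I / 2) • b.rep

/-- `x = exp (t + i θ)` is the exponential shear-bend parameter along the geodesic separating the
ideal triangles of vertices `a, b, z` and `a, b, z'`, where this geodesic is oriented from `a` to
`b` as part of the boundary of the oriented triangle of vertices `a, b, z`. The number `t` is the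
oriented distance from the projection of `z` to that of `z'`, and `θ` is the external dihedral
angle: the internal dihedral angle `π - θ`, measured around the oriented geodesic, is the angle of
the rotation sending the half-plane containing the second triangle to the half-plane containing
the first one. -/
def IsShearBend (a b z z' : SphereAtInfinity) (x : ℂ) : Prop :=
  ∃ t θ : ℝ,
    (∃ w w' : HyperbolicSpace, IsProjection a b z w ∧ IsProjection a b z' w' ∧
      IsOrientedDist a b w w' t) ∧
    (∃ g : SL(2, ℂ), IsRotation a b (Real.pi - θ) g ∧
      (fun P => g • P) '' halfPlane a b z' = halfPlane a b z) ∧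
    x = Complex.exp (t + θ * Complex.I)

end HyperbolicSpace

/-! ### Pleated surfaces and enhanced homomorphisms -/

namespace IdealTriangulation

variable {m n : ℕ} (T : IdealTriangulation m n) (o : Fin m)

/-- A pleated surface `(f, r)` pleated along the ideal triangulation. The point `vertex F k` is the
vertex of the ideal triangle `f (F)` that corresponds to the vertex `k` of the face `F`. -/
structure PleatedSurface (r : T.piOne o →* PSL(2, ℂ)) where
  toFun : T.UniversalCover o → HyperbolicSpace
  continuous_toFun : Continuous toFun
  vertex : T.LiftedFace o → Fin 3 → SphereAtInfinity
  vertex_injective : ∀ F, Function.Injective (vertex F)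
  isEmbedding : ∀ F : T.LiftedFace o, Topology.IsEmbedding (fun p => toFun (F.incl p))
  range_face : ∀ F : T.LiftedFace o,
    Set.range (fun p => toFun (F.incl p)) = HyperbolicSpace.idealTriangle (vertex F)
  image_side : ∀ (F : T.LiftedFace o) (k : Fin 3),
    (fun p => toFun (F.incl p)) '' {p | p.1 k = 0} =
      HyperbolicSpace.geodesic (vertex F (k + 1)) (vertex F (k + 2))
  equivariant : ∀ (γ : T.piOne o) (F : T.LiftedFace o) (p : IdealSimplex),
    toFun ((F.deck γ).incl p) = r γ • toFun (F.incl p)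

/-- An enhanced homomorphism from `π₁(S)` to `Isom⁺(ℍ³)`. -/
structure EnhancedHom where
  r : T.piOne o →* PSL(2, ℂ)
  ξ : T.Peripheral o → SphereAtInfinity
  fixed : ∀ (π : T.Peripheral o), ∀ γ ∈ π.1, r γ • ξ π = ξ π
  equivariant : ∀ (γ : T.piOne o) (π π' : T.Peripheral o),
    π'.1 = π.1.map (MulAut.conj γ).toMonoidHom → ξ π' = r γ • ξ π

variable {T o}

/-- The system of edge weights `x` consists of the exponential shear-bend parameters of the pleated
surface `f`. As part of the boundary of the oriented face `F`, the side `k` is oriented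
(counterclockwise) from the vertex `k + 2` to the vertex `k + 1`. -/
def PleatedSurface.HasShearBend {r : T.piOne o →* PSL(2, ℂ)} (f : T.PleatedSurface o r)
    (x : Fin n → ℂˣ) : Prop :=
  ∀ (F : T.LiftedFace o) (k : Fin 3),
    HyperbolicSpace.IsShearBend (f.vertex F (k + 2)) (f.vertex F (k + 1)) (f.vertex F k)
      (f.vertex (F.neighbor k) (T.opp (F.face, k)).2) (x (T.edge (F.face, k)))

namespace EnhancedHom

/-- The enhanced homomorphism is the one associated to the pleated surface `f`. -/
def IsAssociated (E : T.EnhancedHom o) (f : T.PleatedSurface o E.r) : Prop :=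
  ∀ (F : T.LiftedFace o) (k : Fin 3), f.vertex F k = E.ξ (F.vertexGroup k)

/-- The enhanced homomorphism realizes the ideal triangulation. -/
def Realizes (E : T.EnhancedHom o) : Prop := ∃ f : T.PleatedSurface o E.r, E.IsAssociated f

/-- The edge weights associated to an enhanced homomorphism realizing the ideal triangulation. -/
def HasWeights (E : T.EnhancedHom o) (x : Fin n → ℂˣ) : Prop :=
  ∃ f : T.PleatedSurface o E.r, E.IsAssociated f ∧ f.HasShearBend x

/-- `c` is the total peripheral load of the enhanced homomorphism. -/
def HasLoad (E : T.EnhancedHom o) (c : ℂˣ) : Prop := ∃ x, E.HasWeights x ∧ c = ∏ i, x i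

/-- Conjugacy of enhanced homomorphisms. -/
def IsConj (E E' : T.EnhancedHom o) : Prop :=
  ∃ A : PSL(2, ℂ), (∀ γ, E'.r γ = A * E.r γ * A⁻¹) ∧ ∀ π, E'.ξ π = A • E.ξ π

end EnhancedHom

end IdealTriangulation

/-! ### The Chekhov-Fock algebra -/

namespace QuantumTorus

/-- The relations defining the algebra generated by `X_i^{±1}` with
`X_i X_j = q^(2 σ i j) X_j X_i`. The free generators `(i, true)` and `(i, false)` respectively
give `X_i` and its inverse. -/
inductive Rel {ι : Type} (q : ℂˣ) (σ : ι → ι → ℤ) :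
    FreeAlgebra ℂ (ι × Bool) → FreeAlgebra ℂ (ι × Bool) → Prop
  | mul_inv (i : ι) : Rel q σ (FreeAlgebra.ι ℂ (i, true) * FreeAlgebra.ι ℂ (i, false)) 1
  | inv_mul (i : ι) : Rel q σ (FreeAlgebra.ι ℂ (i, false) * FreeAlgebra.ι ℂ (i, true)) 1
  | comm (i j : ι) : Rel q σ (FreeAlgebra.ι ℂ (i, true) * FreeAlgebra.ι ℂ (j, true))
      (((q ^ (2 * σ i j) : ℂˣ) : ℂ) • (FreeAlgebra.ι ℂ (j, true) * FreeAlgebra.ι ℂ (i, true)))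

end QuantumTorus

/-- The algebra defined by the generators `X_i^{±1}` and by the relations
`X_i X_j = q^(2 σ i j) X_j X_i`. -/
abbrev QuantumTorus {ι : Type} (q : ℂˣ) (σ : ι → ι → ℤ) : Type :=
  RingQuot (QuantumTorus.Rel q σ)

namespace QuantumTorus

variable {ι : Type} {q : ℂˣ} {σ : ι → ι → ℤ}

/-- The generators `X_i` and their inverses. -/
def gen (q : ℂˣ) (σ : ι → ι → ℤ) (i : ι) (b : Bool) : QuantumTorus q σ :=
  RingQuot.mkAlgHom ℂ (Rel q σ) (FreeAlgebra.ι ℂ (i, b))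

theorem gen_mul_inv (i : ι) : gen q σ i true * gen q σ i false = 1 := by
  have := RingQuot.mkAlgHom_rel ℂ (Rel.mul_inv (q := q) (σ := σ) i)
  simpa [gen] using this

theorem gen_inv_mul (i : ι) : gen q σ i false * gen q σ i true = 1 := by
  have := RingQuot.mkAlgHom_rel ℂ (Rel.inv_mul (q := q) (σ := σ) i)
  simpa [gen] using this

theorem gen_comm (i j : ι) : gen q σ i true * gen q σ j true =
    ((q ^ (2 * σ i j) : ℂˣ) : ℂ) • (gen q σ j true * gen q σ i true) := by
  have := RingQuot.mkAlgHom_rel ℂ (Rel.comm (q := q) (σ := σ) i j)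
  simpa only [gen, map_mul, map_smul] using this

/-- The generator `X_i`, as an invertible element. -/
def X (q : ℂˣ) (σ : ι → ι → ℤ) (i : ι) : (QuantumTorus q σ)ˣ :=
  ⟨gen q σ i true, gen q σ i false, gen_mul_inv i, gen_inv_mul i⟩

theorem X_comm (i j : ι) : (X q σ i : QuantumTorus q σ) * X q σ j =
    ((q ^ (2 * σ i j) : ℂˣ) : ℂ) • ((X q σ j : QuantumTorus q σ) * X q σ i) := gen_comm i j

variable {A : Type*} [Semiring A] [Algebra ℂ A]

/-- The algebra homomorphism sending the generators to given invertible elements. -/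
noncomputable def lift (u : ι → Aˣ) (hu : ∀ i j, (u i : A) * u j =
    ((q ^ (2 * σ i j) : ℂˣ) : ℂ) • ((u j : A) * u i)) : QuantumTorus q σ →ₐ[ℂ] A :=
  RingQuot.liftAlgHom ℂ ⟨FreeAlgebra.lift ℂ
    (fun p => if p.2 then (u p.1 : A) else ((u p.1)⁻¹ : Aˣ)), by
      intro x y h
      induction h with
      | mul_inv i => simp
      | inv_mul i => simp
      | comm i j => simpa using hu i j⟩

theorem lift_X (u : ι → Aˣ) (hu : ∀ i j, (u i : A) * u j =
    ((q ^ (2 * σ i j) : ℂˣ) : ℂ) • ((u j : A) * u i)) (i : ι) :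
    lift u hu (X q σ i : QuantumTorus q σ) = u i := by
  simp [lift, X, gen]

theorem algHom_ext {f g : QuantumTorus q σ →ₐ[ℂ] A}
    (h : ∀ i, f (X q σ i : QuantumTorus q σ) = g (X q σ i : QuantumTorus q σ)) : f = g := by
  have hu : ∀ i, Units.map (f : QuantumTorus q σ →* A) (X q σ i) =
      Units.map (g : QuantumTorus q σ →* A) (X q σ i) := fun i => Units.ext (h i)
  apply RingQuot.ringQuot_ext'
  apply FreeAlgebra.hom_ext
  funext ⟨i, b⟩
  cases b
  · exact congrArg (fun v : Aˣ => ((v⁻¹ : Aˣ) : A)) (hu i)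
  · exact h i

end QuantumTorus

/-- The exponents of the triangle algebra, for the sides of a triangle indexed clockwise:
`X_i X_{i+1} = q^2 X_{i+1} X_i`. -/
def triangleSigma (i j : Fin 3) : ℤ :=
  (if j = i + 1 then 1 else 0) - (if i = j + 1 then 1 else 0)

/-- The triangle algebra. -/
abbrev TriangleAlgebra (q : ℂˣ) : Type := QuantumTorus q triangleSigma

namespace IdealTriangulation

variable {m n : ℕ} (T : IdealTriangulation m n)

/-- The number of angular sectors delimited by the edges `i` and `j` in the faces of the
triangulation, with `i` coming first counterclockwise. -/
def sectors (i j : Fin n) : ℕ :=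
  (Finset.univ.filter
    (fun s : Fin m × Fin 3 => T.edge s = i ∧ T.edge (s.1, s.2 + 1) = j)).card

/-- The exponents `σ_{ij}` of the Chekhov-Fock algebra. -/
def sigma (i j : Fin n) : ℤ := (T.sectors i j : ℤ) - T.sectors j i

/-- The Chekhov-Fock algebra of the ideal triangulation. -/
abbrev ChekhovFock (q : ℂˣ) : Type := QuantumTorus q T.sigma

/-- The principal central element `H` of the Chekhov-Fock algebra. -/
noncomputable def principal (q : ℂˣ) : T.ChekhovFock q :=
  ((q ^ (-∑ p ∈ Finset.univ.filter (fun p : Fin n × Fin n => p.1 < p.2), T.sigma p.1 p.2) :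
      ℂˣ) : ℂ) •
    (List.ofFn (fun i => (QuantumTorus.X q T.sigma i : T.ChekhovFock q))).prod

/-- The tensor product of the triangle algebras of the faces. -/
abbrev FaceAlgebra (m : ℕ) (q : ℂˣ) : Type := ⨂[ℂ] _ : Fin m, TriangleAlgebra q

/-- The element of the tensor product of the triangle algebras which is the generator associated
to a side of a face. -/
noncomputable def sideGen (q : ℂˣ) (s : Fin m × Fin 3) : (FaceAlgebra m q)ˣ :=
  Units.map (PiTensorProduct.singleAlgHom (R := ℂ) (A := fun _ : Fin m => TriangleAlgebra q) s.1 :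
    TriangleAlgebra q →* FaceAlgebra m q) (QuantumTorus.X q triangleSigma s.2)

/-- The exponents of the skew-commutation of the generators associated to sides of faces. -/
def sideSigma (s t : Fin m × Fin 3) : ℤ := if s.1 = t.1 then triangleSigma s.2 t.2 else 0

theorem sideSigma_eq (s t : Fin m × Fin 3) : sideSigma s t =
    (if t = (s.1, s.2 + 1) then 1 else 0) - (if s = (t.1, t.2 + 1) then 1 else 0) := by
  obtain ⟨a, i⟩ := s
  obtain ⟨b, j⟩ := t
  by_cases h : a = b
  · subst h; simp [sideSigma, triangleSigma]
  · have h' : ¬ b = a := fun h' => h h'.symm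
    simp [sideSigma, h, h']

theorem sideGen_comm (q : ℂˣ) (s t : Fin m × Fin 3) :
    (sideGen q s : FaceAlgebra m q) * sideGen q t =
      ((q ^ (2 * sideSigma s t) : ℂˣ) : ℂ) • ((sideGen q t : FaceAlgebra m q) * sideGen q s) := by
  obtain ⟨a, i⟩ := s
  obtain ⟨b, j⟩ := t
  by_cases h : a = b
  · subst h
    simp only [sideGen, Units.coe_map, MonoidHom.coe_coe, sideSigma, if_true]
    rw [← map_mul, ← map_mul, QuantumTorus.X_comm, map_smul]
  · simp only [sideGen, Units.coe_map, MonoidHom.coe_coe, sideSigma, if_neg h, mul_zero, zpow_zero,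
      Units.val_one, one_smul, PiTensorProduct.singleAlgHom_apply, MonoidHom.mulSingle_apply,
      PiTensorProduct.tprod_mul_tprod]
    exact congrArg _ (Pi.mulSingle_commute h _ _).eq

theorem sigma_eq (i j : Fin n) : T.sigma i j =
    ∑ b : Bool, ∑ c : Bool, sideSigma (T.side (i, b)) (T.side (j, c)) := by
  have key : ∀ i j : Fin n, (T.sectors i j : ℤ) = ∑ b : Bool, ∑ c : Bool,
      (if T.side (j, c) = ((T.side (i, b)).1, (T.side (i, b)).2 + 1) then 1 else 0) := by
    intro i j
    rw [sectors, Finset.card_filter]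
    push_cast
    rw [← T.side.sum_comp, Fintype.sum_prod_type, Finset.sum_eq_single i]
    · refine Finset.sum_congr rfl (fun b _ => ?_)
      simp only [edge, Equiv.symm_apply_apply, true_and]
      generalize ((T.side (i, b)).1, (T.side (i, b)).2 + 1) = u
      obtain ⟨⟨k, d⟩, rfl⟩ := T.side.surjective u
      by_cases hk : k = j
      · subst hk; cases d <;> simp
      · have : ¬ j = k := fun h => hk h.symm
        simp [hk, this]
    · intro k _ hk
      simp [edge, hk]
    · simp
  rw [sigma, key, key]
  simp only [sideSigma_eq, Finset.sum_sub_distrib]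
  congr 1
  rw [Finset.sum_comm]

/-- The image of the generator `X_i` in the tensor product of the triangle algebras: the product
of the generators associated to the two sides corresponding to the edge `i`. If they are sides of
distinct faces, the scalar factor is 1. If they are sides of the same face, this is
`q^(-1) X_k X_{k+1} = q X_{k+1} X_k`, where the side `k` comes first counterclockwise around the
common vertex of the sides `k` and `k + 1`. -/
noncomputable def edgeGen (q : ℂˣ) (i : Fin n) : (FaceAlgebra m q)ˣ :=
  Units.map (algebraMap ℂ (FaceAlgebra m q) : ℂ →* FaceAlgebra m q)
      (q ^ (-sideSigma (T.side (i, false)) (T.side (i, true)))) *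
    (sideGen q (T.side (i, false)) * sideGen q (T.side (i, true)))

theorem edgeGen_val (q : ℂˣ) (i : Fin n) : (T.edgeGen q i : FaceAlgebra m q) =
    ((q ^ (-sideSigma (T.side (i, false)) (T.side (i, true))) : ℂˣ) : ℂ) •
      ((sideGen q (T.side (i, false)) : FaceAlgebra m q) * sideGen q (T.side (i, true))) := by
  rw [edgeGen, Units.val_mul, Units.val_mul]
  exact (Algebra.smul_def _ _).symm

theorem edgeGen_comm (q : ℂˣ) (i j : Fin n) :
    (T.edgeGen q i : FaceAlgebra m q) * T.edgeGen q j =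
      ((q ^ (2 * T.sigma i j) : ℂˣ) : ℂ) •
        ((T.edgeGen q j : FaceAlgebra m q) * T.edgeGen q i) := by
  have aux : ∀ {B : Type} [Ring B] [Algebra ℂ B] (a b c d : B) (p r x y z w : ℂ),
      a * c = x • (c * a) → a * d = y • (d * a) → b * c = z • (c * b) → b * d = w • (d * b) →
      (p • (a * b)) * (r • (c * d)) = (x * y * z * w) • ((r • (c * d)) * (p • (a * b))) := by
    intro B _ _ a b c d p r x y z w h1 h2 h3 h4
    have : (a * b) * (c * d) = (x * y * z * w) • ((c * d) * (a * b)) := by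
      calc (a * b) * (c * d) = a * (b * c) * d := by simp only [mul_assoc]
        _ = z • ((a * c) * (b * d)) := by rw [h3]; simp [mul_assoc]
        _ = (z * w) • ((a * c) * (d * b)) := by rw [h4]; simp [mul_smul]
        _ = (z * w * x) • (c * (a * d) * b) := by rw [h1]; simp [mul_smul, mul_assoc]
        _ = (z * w * x * y) • ((c * d) * (a * b)) := by rw [h2]; simp [mul_smul, mul_assoc]
        _ = _ := by congr 1; ring
    rw [smul_mul_smul_comm, smul_mul_smul_comm, this, smul_smul, smul_smul]
    congr 1
    ring
  rw [edgeGen_val, edgeGen_val]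
  refine (aux (B := FaceAlgebra m q) _ _ _ _ _ _ _ _ _ _ (sideGen_comm q _ _) (sideGen_comm q _ _)
    (sideGen_comm q _ _) (sideGen_comm q _ _)).trans ?_
  rw [sigma_eq]
  congr 1
  simp only [← Units.val_mul, ← zpow_add, Fintype.sum_bool]
  congr 2
  ring

/-- The embedding of the Chekhov-Fock algebra in the tensor product of the triangle algebras. -/
noncomputable def embed (q : ℂˣ) : T.ChekhovFock q →ₐ[ℂ] FaceAlgebra m q :=
  QuantumTorus.lift (T.edgeGen q) (T.edgeGen_comm q)

end IdealTriangulation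

/-! ### Local representations -/

section

variable {m n : ℕ} {q : ℂˣ} {V : Fin m → Type u} [∀ j, AddCommGroup (V j)] [∀ j, Module ℂ (V j)]

/-- The tensor product of representations of the triangle algebras of the faces. -/
noncomputable def tensorRep (ρ : ∀ j, TriangleAlgebra q →ₐ[ℂ] Module.End ℂ (V j)) :
    IdealTriangulation.FaceAlgebra m q →ₐ[ℂ] Module.End ℂ (⨂[ℂ] j, V j) :=
  PiTensorProduct.liftAlgHom
    ((PiTensorProduct.mapMultilinear ℂ V V).compLinearMap (fun j => (ρ j).toLinearMap))
    (by
      change PiTensorProduct.map (fun j => ρ j 1) = 1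
      simp only [map_one]
      exact PiTensorProduct.map_one)
    (fun x y => by
      change PiTensorProduct.map (fun j => ρ j (x j * y j)) = _
      simp only [map_mul]
      exact PiTensorProduct.map_mul _ _)

/-- A representation of an algebra is irreducible if its space is nonzero and has no invariant
linear subspace besides 0 and the whole space. -/
def IsIrreducibleRep {A : Type} [Ring A] [Algebra ℂ A] {W : Type u} [AddCommGroup W] [Module ℂ W]
    (ρ : A →ₐ[ℂ] Module.End ℂ W) : Prop :=
  Nontrivial W ∧ ∀ U : Submodule ℂ W, (∀ a, ∀ w ∈ U, ρ a w ∈ U) → U = ⊥ ∨ U = ⊤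

variable (q V) in
/-- Families consisting of an irreducible representation of the triangle algebra on `V j` for every
face `j`. -/
def IrrepFamily : Type u :=
  {ρ : ∀ j, TriangleAlgebra q →ₐ[ℂ] Module.End ℂ (V j) // ∀ j, IsIrreducibleRep (ρ j)}

namespace IrrepFamily

/-- The image of the generator associated to a side of a face. -/
def side (ρ : IrrepFamily q V) (s : Fin m × Fin 3) : Module.End ℂ (V s.1) :=
  ρ.1 s.1 (QuantumTorus.X q triangleSigma s.2 : TriangleAlgebra q)

variable (T : IdealTriangulation m n)

/-- Two families of irreducible representations are equivalent if, for every edge, they differ by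
the multiplication by mutually inverse scalars on the two sides that correspond to this edge. -/
def Equivalent (ρ ρ' : IrrepFamily q V) : Prop :=
  ∀ i : Fin n, ∃ a : ℂˣ,
    ρ'.side (T.side (i, false)) = (a : ℂ) • ρ.side (T.side (i, false)) ∧
    ρ'.side (T.side (i, true)) = ((a⁻¹ : ℂˣ) : ℂ) • ρ.side (T.side (i, true))

variable (q V) in
/-- The equivalence relation defining local representations. -/
def setoid : Setoid (IrrepFamily q V) where
  r := Equivalent T
  iseqv :=
    { refl := fun ρ i => ⟨1, by simp, by simp⟩
      symm := fun {ρ ρ'} h i => by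
        obtain ⟨a, h1, h2⟩ := h i
        refine ⟨a⁻¹, ?_, ?_⟩
        · rw [h1, smul_smul]; simp
        · rw [h2, smul_smul]; simp
      trans := fun {ρ ρ' ρ''} h h' i => by
        obtain ⟨a, h1, h2⟩ := h i
        obtain ⟨b, h3, h4⟩ := h' i
        refine ⟨b * a, ?_, ?_⟩
        · rw [h3, h1, smul_smul, Units.val_mul]
        · rw [h4, h2, smul_smul, mul_inv, Units.val_mul] }

/-- The representation of the Chekhov-Fock algebra obtained by restriction of the tensor product of
the representations of the triangle algebras. -/
noncomputable def induced (ρ : IrrepFamily q V) :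
    T.ChekhovFock q →ₐ[ℂ] Module.End ℂ (⨂[ℂ] j, V j) :=
  (tensorRep ρ.1).comp (T.embed q)

theorem tensorRep_sideGen (ρ : IrrepFamily q V) (s : Fin m × Fin 3) :
    tensorRep ρ.1 (IdealTriangulation.sideGen q s : IdealTriangulation.FaceAlgebra m q) =
      PiTensorProduct.map (Function.update (fun j => (1 : Module.End ℂ (V j))) s.1 (ρ.side s)) := by
  have : ∀ x : TriangleAlgebra q, (fun j => ρ.1 j (Pi.mulSingle (M := fun _ => TriangleAlgebra q)
      s.1 x j)) = Function.update (fun j => (1 : Module.End ℂ (V j))) s.1 (ρ.1 s.1 x) := by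
    intro x
    funext j
    by_cases h : j = s.1
    · subst h; simp
    · simp [h]
  simp only [tensorRep, IdealTriangulation.sideGen, Units.coe_map, MonoidHom.coe_coe,
    PiTensorProduct.singleAlgHom_apply, MonoidHom.mulSingle_apply,
    PiTensorProduct.liftAlgHom_apply, PiTensorProduct.lift.tprod]
  exact congrArg PiTensorProduct.map (this _)

theorem induced_eq_of_equivalent (ρ ρ' : IrrepFamily q V) (h : Equivalent T ρ ρ') :
    ρ.induced T = ρ'.induced T := by
  refine QuantumTorus.algHom_ext (fun i => ?_)
  obtain ⟨a, h1, h2⟩ := h i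
  simp only [induced, AlgHom.comp_apply, IdealTriangulation.embed, QuantumTorus.lift_X,
    IdealTriangulation.edgeGen_val, map_smul, map_mul, tensorRep_sideGen, h1, h2,
    PiTensorProduct.map_update_smul, smul_mul_smul_comm]
  simp

end IrrepFamily

variable (T : IdealTriangulation m n)

variable (q V) in
/-- Local representations of the Chekhov-Fock algebra on the tensor product of the `V j`. -/
def LocalRep : Type u := Quotient (IrrepFamily.setoid q V T)

namespace LocalRep

variable {T}

/-- The representation of the Chekhov-Fock algebra defined by a local representation. -/
noncomputable def toAlgHom (ρ : LocalRep q V T) :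
    T.ChekhovFock q →ₐ[ℂ] Module.End ℂ (⨂[ℂ] j, V j) :=
  Quotient.lift (IrrepFamily.induced T) (IrrepFamily.induced_eq_of_equivalent T) ρ

/-- Isomorphism of local representations. -/
def IsIso {V' : Fin m → Type u} [∀ j, AddCommGroup (V' j)] [∀ j, Module ℂ (V' j)]
    (ρ : LocalRep q V T) (ρ' : LocalRep q V' T) : Prop :=
  ∃ (φ : IrrepFamily q V) (φ' : IrrepFamily q V'),
    ρ = Quotient.mk _ φ ∧ ρ' = Quotient.mk _ φ' ∧
    ∀ j, ∃ L : V' j ≃ₗ[ℂ] V j, ∀ X : TriangleAlgebra q,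
      φ'.1 j X = L.symm.toLinearMap ∘ₗ φ.1 j X ∘ₗ L.toLinearMap

/-- The local representation `ρ` is associated to the enhanced homomorphism `E`, realizing the
ideal triangulation, and to the number `h`: the exponential shear-bend parameters `x i` of `E` are
the edge weights of `ρ`, defined by `ρ (X_i ^ N) = x i • Id`, and `h` is the central load of `ρ`,
defined by `ρ H = h • Id`. -/
def IsClassifiedBy {o : Fin m} (N : ℕ) (ρ : LocalRep q V T) (E : T.EnhancedHom o) (h : ℂˣ) :
    Prop :=
  (∃ x : Fin n → ℂˣ, E.HasWeights x ∧
    ∀ i, ρ.toAlgHom ((QuantumTorus.X q T.sigma i : T.ChekhovFock q) ^ N) = (x i : ℂ) • 1) ∧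
  ρ.toAlgHom (T.principal q) = (h : ℂ) • 1

end LocalRep

end

/-! ### Powers of Weyl-ordered products -/

/-! Both sides of the correspondence are parametrized by edge weights `x : Fin n → ℂˣ`. The
algebraic side carries in addition a number `h` with `h ^ N = ∏ i, x i`, and the theorem follows by
comparing parameters.

Algebra. Since `q ^ 2` is a primitive `N`-th root of unity, the `N`-th powers of the generators of a
triangle algebra and its element `q⁻¹ X₀ X₁ X₂` are central. By Schur's lemma they act on an
irreducible representation by scalars `y k` and `h`, with `h ^ N = y 0 * y 1 * y 2`. These scalars
are the only invariants, because the eigenvectors of `X₀` identify the representation with a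
clock-and-shift model on functions on `ZMod N` (`HasTriangleInvariants.exists_equiv`). In a local
representation, `X_i ^ N` acts by the product of the `y` of the two sides glued along the edge `i`,
and the principal element acts by a universal constant times the product of the `h` of the faces.
Two families with the same such products become isomorphic face by face after a rescaling by inverse
scalars along the edges: `N`-th roots first match the `y`, and the discrepancy left on the faces
consists of `N`-th roots of unity of product 1. As the triangulation is connected, this discrepancy
comes from roots of unity placed on the edges (`exists_faceProd_eq`, `exists_sideScalar`).

Geometry. `PSL(2, ℂ)` acts simply transitively on triples of distinct points of the sphere at
infinity, and if three vertices of two adjacent ideal triangles are put at `0`, `∞`, `1`, then the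
fourth one is `-y`, where `y` is the shear-bend parameter (`isShearBend_std`). The weights thus
determine a developing map triangle by triangle, up to an isometry; its monodromy and its vertices
form the enhanced homomorphism `developed`. Conversely, an enhanced homomorphism with weights `x` is
conjugate to `developed x` (`HasWeights.isConj_developed`).

Two points need care. The points `ξ` are indexed by peripheral subgroups and not by vertices of the
universal cover, so that vertices with the same peripheral subgroup must be shown to coincide; this
is an argument on reduced words (`exists_turnLift_eq`). Moreover a pleated surface is an actual
continuous map: the parametrizations of adjacent ideal triangles must agree along their common side,
which is achieved by stretching the sides (`stretchSides`). -/

theorem isPrimitiveRoot_sq_of_isLeast {q : ℂˣ} {N : ℕ}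
    (hq : IsLeast {M : ℕ | 0 < M ∧ (q : ℂ) ^ M = (-1) ^ (M + 1)} N) :
    IsPrimitiveRoot ((q : ℂ) ^ 2) N := by
  obtain ⟨⟨hN, h⟩, hmin⟩ := hq
  have h1 : ((q : ℂ) ^ 2) ^ N = 1 := by
    rw [← pow_mul, mul_comm, pow_mul, h, ← pow_mul, mul_comm, pow_mul]; simp
  have hd : orderOf ((q : ℂ) ^ 2) ∣ N := orderOf_dvd_of_pow_eq_one h1
  have hdpos : 0 < orderOf ((q : ℂ) ^ 2) := Nat.pos_of_dvd_of_pos hd hN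
  have hpr := IsPrimitiveRoot.orderOf ((q : ℂ) ^ 2)
  suffices N = orderOf ((q : ℂ) ^ 2) by rw [this]; exact hpr
  generalize orderOf ((q : ℂ) ^ 2) = d at *
  refine le_antisymm (hmin ⟨hdpos, ?_⟩) (Nat.le_of_dvd hN hd)
  have h2 : ((q : ℂ) ^ d) ^ 2 = ((-1) ^ (d + 1)) ^ 2 := by
    rw [← pow_mul, mul_comm, pow_mul, hpr.pow_eq_one, ← pow_mul, mul_comm, pow_mul]; simp
  -- The sign minus is impossible: `q ^ d = (-1) ^ d` would give `q ^ N = (-1) ^ N` for the multiple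
  -- `N` of `d`.
  rcases sq_eq_sq_iff_eq_or_eq_neg.1 h2 with h3 | h3
  · exact h3
  · exfalso
    obtain ⟨e, rfl⟩ := hd
    rw [pow_mul, h3, pow_succ, mul_neg_one, neg_neg, ← pow_mul, pow_succ] at h
    have : ((-1 : ℂ) ^ (d * e)) ≠ 0 := pow_ne_zero _ (by norm_num)
    have h4 : (1 : ℂ) = -1 := mul_left_cancel₀ this (by simpa using h)
    norm_num at h4

/-- The sign in the condition on `q` matters here: `N * (N + 1)` is even, whereas `q ^ (2 * N) = 1`
alone would leave a sign. The scalars appearing in `N`-th powers of Weyl-ordered products are powers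
of this number. -/
theorem pow_mul_self_of_isLeast {q : ℂˣ} {N : ℕ}
    (hq : IsLeast {M : ℕ | 0 < M ∧ (q : ℂ) ^ M = (-1) ^ (M + 1)} N) : q ^ (N * N) = 1 := by
  apply Units.ext
  rw [Units.val_pow_eq_pow_val, pow_mul, hq.1.2, ← pow_mul, mul_comm,
    (Nat.even_mul_succ_self N).neg_one_pow, Units.val_one]

section Weyl

variable {A : Type*} [Ring A] [Algebra ℂ A]

/-- Moving all the factors `a` to the left costs `e ^ (2 * (0 + 1 + ... + (k - 1)))`, that is `e ^
(k * k - k)`, and the scalars themselves contribute `e ^ k`. -/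
theorem smul_mul_pow_of_mul_eq_sq_smul {a b : A} {e : ℂ} (h : b * a = e ^ 2 • (a * b)) (k : ℕ) :
    (e • (a * b)) ^ k = e ^ (k * k) • (a ^ k * b ^ k) := by
  have hb : ∀ k : ℕ, b ^ k * a = e ^ (2 * k) • (a * b ^ k) := by
    intro k
    induction k with
    | zero => simp
    | succ k ih =>
      rw [pow_succ, mul_assoc, h, mul_smul_comm, ← mul_assoc, ih, smul_mul_assoc, smul_smul,
        mul_assoc, ← pow_add]
      congr 2
      ring
  induction k with
  | zero => simp
  | succ k ih =>
    rw [pow_succ, ih, smul_mul_smul_comm, mul_assoc, ← mul_assoc (b ^ k), hb, smul_mul_assoc,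
      mul_smul_comm, smul_smul, pow_succ a, pow_succ b]
    simp only [mul_assoc]
    congr 1
    ring

theorem sum_filter_lt_succ {n : ℕ} (σ : Fin (n + 1) → Fin (n + 1) → ℤ) :
    ∑ p ∈ Finset.univ.filter (fun p : Fin (n + 1) × Fin (n + 1) => p.1 < p.2), σ p.1 p.2 =
      ∑ j : Fin n, σ 0 j.succ +
        ∑ p ∈ Finset.univ.filter (fun p : Fin n × Fin n => p.1 < p.2), σ p.1.succ p.2.succ := by
  simp only [Finset.sum_filter, Fintype.sum_prod_type, Fin.sum_univ_succ, Fin.succ_lt_succ_iff,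
    Fin.succ_pos, if_true, if_false, zero_add, not_lt_zero]

/-- At a root of unity, the power of a Weyl-ordered product is the product of the powers. -/
theorem weyl_prod_pow {q : ℂˣ} {N : ℕ} (hq : q ^ (N * N) = 1) : ∀ {n : ℕ} (σ : Fin n → Fin n → ℤ)
    (u : Fin n → A), (∀ i j, u i * u j = ((q ^ (2 * σ i j) : ℂˣ) : ℂ) • (u j * u i)) →
    (((q ^ (-∑ p ∈ Finset.univ.filter (fun p : Fin n × Fin n => p.1 < p.2), σ p.1 p.2) :
      ℂˣ) : ℂ) • (List.ofFn u).prod) ^ N = (List.ofFn (fun i => u i ^ N)).prod := by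
  intro n
  induction n with
  | zero => intro σ u _; simp
  | succ n ih =>
    intro σ u hu
    specialize ih (fun i j => σ i.succ j.succ) (fun i => u i.succ) (fun i j => hu _ _)
    rw [sum_filter_lt_succ, List.ofFn_succ, List.ofFn_succ, List.prod_cons, List.prod_cons, ← ih,
      neg_add, zpow_add, Units.val_mul, mul_smul, ← mul_smul_comm]
    set Z := ((q ^ (-∑ p ∈ Finset.univ.filter (fun p : Fin n × Fin n => p.1 < p.2),
      σ p.1.succ p.2.succ) : ℂˣ) : ℂ) • (List.ofFn fun i : Fin n => u i.succ).prod with hZ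
    have comm : ∀ {k : ℕ} (v : Fin k → A) (s : Fin k → ℤ),
        (∀ j, v j * u 0 = ((q ^ (-(2 * s j)) : ℂˣ) : ℂ) • (u 0 * v j)) →
        (List.ofFn v).prod * u 0 =
          ((q ^ (-(2 * ∑ j, s j)) : ℂˣ) : ℂ) • (u 0 * (List.ofFn v).prod) := by
      intro k
      induction k with
      | zero => intro v s _; simp
      | succ k ihk =>
        intro v s hv
        rw [List.ofFn_succ, List.prod_cons, mul_assoc, ihk _ (fun j => s j.succ) (fun j => hv _),
          mul_smul_comm, ← mul_assoc, hv, smul_mul_assoc, smul_smul, mul_assoc, ← Units.val_mul,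
          ← zpow_add, Fin.sum_univ_succ]
        congr 3
        ring
    have hc := comm (fun j => u j.succ) (fun j => σ 0 j.succ) (fun j => by
      rw [hu 0 j.succ, smul_smul, ← Units.val_mul, ← zpow_add]
      simp)
    -- The scalar `q ^ (-∑ j, σ 0 j.succ)` that remains in front of `u 0 * Z` is a square root of
    -- their commutation factor, as required by `smul_mul_pow_of_mul_eq_sq_smul`.
    have hZu : Z * u 0 = ((q ^ (-∑ j : Fin n, σ 0 j.succ) : ℂˣ) : ℂ) ^ 2 • (u 0 * Z) := by
      rw [hZ, smul_mul_assoc, hc, mul_smul_comm, smul_smul, smul_smul, mul_comm]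
      congr 2
      rw [← Units.val_pow_eq_pow_val, ← zpow_natCast, ← zpow_mul]
      congr 2
      push_cast
      ring
    rw [smul_mul_pow_of_mul_eq_sq_smul hZu, ← Units.val_pow_eq_pow_val, ← zpow_natCast,
      ← zpow_mul, mul_comm, zpow_mul, zpow_natCast, hq]
    simp

end Weyl

/-! ### Schur's lemma in countable dimension -/

/-- A polynomial in `z` splits into factors `z - r`, none of which is singular when the spectrum is
empty. -/
theorem isUnit_aeval_of_spectrum_eq_empty {A : Type*} [Ring A] [Algebra ℂ A] {z : A}
    (hz : spectrum ℂ z = ∅) {p : Polynomial ℂ} (hp : p ≠ 0) : IsUnit (Polynomial.aeval z p) := by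
  rw [(IsAlgClosed.splits p).eq_prod_roots, map_mul, Polynomial.aeval_C]
  refine ((IsUnit.mk0 _ (Polynomial.leadingCoeff_ne_zero.2 hp)).map (algebraMap ℂ _)).mul ?_
  by_contra h
  obtain ⟨k, hk, -⟩ := spectrum.exists_mem_of_not_isUnit_aeval_prod h
  simp [hz] at hk

/-- Applying the product of the `c - z` to a linear relation between the vectors `(c - z)⁻¹ w` gives
`p(z) w = 0` for a polynomial `p`. A nonzero `p` would make `p(z)` invertible, so `p = 0`; and the
value of `p` at `c` is a nonzero multiple of the coefficient of index `c`. -/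
theorem linearIndependent_resolvent {W : Type u} [AddCommGroup W] [Module ℂ W]
    {z : Module.End ℂ W} (hz : spectrum ℂ z = ∅) {w : W} (hw : w ≠ 0) :
    LinearIndependent ℂ (fun c : ℂ => resolvent z c w) := by
  classical
  have hu : ∀ c : ℂ, (algebraMap ℂ (Module.End ℂ W) c - z) * resolvent z c = 1 := fun c =>
    Ring.mul_inverse_cancel _ (spectrum.notMem_iff.1 (by simp [hz]))
  have hcomm : ∀ c : ℂ, Polynomial.aeval z (Polynomial.C c - Polynomial.X) * resolvent z c = 1 := by
    intro c; simpa using hu c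
  rw [linearIndependent_iff']
  intro s m hm i hi
  set p : Polynomial ℂ := ∑ j ∈ s, Polynomial.C (m j) *
    ∏ k ∈ s.erase j, (Polynomial.C k - Polynomial.X) with hp
  have hpw : Polynomial.aeval z p w = 0 := by
    have h0 := congrArg (Polynomial.aeval z (∏ k ∈ s, (Polynomial.C k - Polynomial.X))) hm
    rw [map_zero, map_sum] at h0
    rw [← h0, hp, map_sum, LinearMap.sum_apply]
    refine Finset.sum_congr rfl fun j hj => ?_
    rw [← Finset.prod_erase_mul _ _ hj, map_smul, ← Module.End.mul_apply,
      map_mul (Polynomial.aeval z) (Finset.prod _ _), mul_assoc, hcomm, mul_one, map_mul,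
      Polynomial.aeval_C]
    simp
  have hp0 : p = 0 := by
    by_contra hne
    obtain ⟨v, hv⟩ := isUnit_aeval_of_spectrum_eq_empty hz hne
    apply hw
    rw [← hv] at hpw
    have h2 := congrArg (v⁻¹ : (Module.End ℂ W)ˣ).1 hpw
    rwa [← Module.End.mul_apply, Units.inv_mul, Module.End.one_apply, map_zero] at h2
  have h := congrArg (Polynomial.eval i) hp0
  rw [hp, Polynomial.eval_finsetSum, Finset.sum_eq_single i] at h
  · simp only [Polynomial.eval_mul, Polynomial.eval_C, Polynomial.eval_prod, Polynomial.eval_sub,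
      Polynomial.eval_X, Polynomial.eval_zero] at h
    exact (mul_eq_zero.1 h).resolve_right (Finset.prod_ne_zero_iff.2 fun k hk =>
      sub_ne_zero.2 (Finset.ne_of_mem_erase hk))
  · intro j _ hj
    rw [Polynomial.eval_mul, Polynomial.eval_prod,
      Finset.prod_eq_zero (Finset.mem_erase.2 ⟨hj.symm, hi⟩) (by simp), mul_zero]
  · exact fun h => absurd hi h

/-- Finite dimension is not assumed, and a cardinality argument replaces it: with an empty spectrum,
the resolvents would provide uncountably many independent vectors in a space of countable dimension.
-/
theorem spectrum_nonempty_of_countable_span {W : Type u} [AddCommGroup W] [Module ℂ W]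
    [Nontrivial W] (z : Module.End ℂ W) {s : Set W} (hs : s.Countable)
    (hspan : Submodule.span ℂ s = ⊤) : (spectrum ℂ z).Nonempty := by
  by_contra h
  rw [Set.not_nonempty_iff_eq_empty] at h
  obtain ⟨w, hw⟩ := exists_ne (0 : W)
  have h1 := (linearIndependent_resolvent h hw).cardinal_lift_le_rank
  have h2 : Module.rank ℂ W ≤ Cardinal.aleph0 := by
    rw [← rank_top, ← hspan]
    exact (rank_span_le s).trans hs.le_aleph0
  have h3 := h1.trans (Cardinal.lift_le.2 h2)
  rw [Cardinal.lift_aleph0, Cardinal.mk_complex, Cardinal.lift_continuum] at h3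
  exact absurd h3 (not_le.2 Cardinal.aleph0_lt_continuum)

/-- Schur's lemma for irreducible representations of algebras of countable dimension. -/
theorem IsIrreducibleRep.exists_eq_smul_one {A : Type} [Ring A] [Algebra ℂ A] {W : Type u}
    [AddCommGroup W] [Module ℂ W] {ρ : A →ₐ[ℂ] Module.End ℂ W} (hρ : IsIrreducibleRep ρ)
    {S : Set A} (hS : S.Countable) (hspan : Submodule.span ℂ S = ⊤) {z : Module.End ℂ W}
    (hz : ∀ a, z * ρ a = ρ a * z) : ∃ c : ℂ, z = c • 1 := by
  have := hρ.1
  obtain ⟨w, hw⟩ := exists_ne (0 : W)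
  -- By irreducibility the nonzero vector `w` is cyclic, so `W` is spanned by the image of the
  -- countable set `S`.
  set f : A →ₗ[ℂ] W := (LinearMap.applyₗ w).comp ρ.toLinearMap with hf
  have hfa : ∀ a, f a = ρ a w := fun a => rfl
  have hrange : LinearMap.range f = ⊤ := by
    refine (hρ.2 (LinearMap.range f) ?_).resolve_left ?_
    · rintro a _ ⟨b, rfl⟩
      exact ⟨a * b, by simp [hfa]⟩
    · intro h
      apply hw
      have : f 1 ∈ LinearMap.range f := ⟨1, rfl⟩
      rw [h, Submodule.mem_bot, hfa] at this
      simpa using this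
  obtain ⟨c, hc⟩ := spectrum_nonempty_of_countable_span z (hS.image f)
    (by rw [Submodule.span_image, hspan, Submodule.map_top, hrange])
  refine ⟨c, ?_⟩
  -- The kernel and the range of `c - z` are invariant, so that `c - z` is zero or bijective; it is
  -- not bijective because `c` lies in the spectrum.
  set y := algebraMap ℂ (Module.End ℂ W) c - z with hy
  have hya : ∀ a, y * ρ a = ρ a * y := fun a => by
    rw [hy, sub_mul, mul_sub, hz, Algebra.commutes]
  have hyv : ∀ a v, y (ρ a v) = ρ a (y v) := fun a v => LinearMap.congr_fun (hya a) v
  have hk := hρ.2 (LinearMap.ker y) (fun a v hv => by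
    rw [LinearMap.mem_ker, hyv, LinearMap.mem_ker.1 hv, map_zero])
  have hr := hρ.2 (LinearMap.range y) (by
    rintro a _ ⟨v, rfl⟩
    exact ⟨ρ a v, hyv a v⟩)
  have hy0 : y = 0 := by
    rcases hk with hk | hk
    · rcases hr with hr | hr
      · exact LinearMap.range_eq_bot.1 hr
      · exact absurd ((Module.End.isUnit_iff y).2
          ⟨LinearMap.ker_eq_bot.1 hk, LinearMap.range_eq_top.1 hr⟩) hc
    · exact LinearMap.ker_eq_top.1 hk
  rw [hy, sub_eq_zero] at hy0
  rw [← hy0, Algebra.algebraMap_eq_smul_one]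

/-! ### Generation, intertwiners and rescaling in quantum tori -/

namespace QuantumTorus

section

variable {ι : Type} {q : ℂˣ} {σ : ι → ι → ℤ}

theorem exists_countable_span [Countable ι] :
    ∃ S : Set (QuantumTorus q σ), S.Countable ∧ Submodule.span ℂ S = ⊤ := by
  refine ⟨Set.range fun w => (RingQuot.mkAlgHom ℂ (Rel q σ)).toLinearMap
    (FreeAlgebra.basisFreeMonoid ℂ (ι × Bool) w), ?_, ?_⟩
  · have : Countable (FreeMonoid (ι × Bool)) := inferInstanceAs (Countable (List (ι × Bool)))
    exact Set.countable_range _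
  · rw [Set.range_comp', Submodule.span_image, Module.Basis.span_eq, Submodule.map_top,
      LinearMap.range_eq_top]
    exact RingQuot.mkAlgHom_surjective ℂ (Rel q σ)

theorem induction {motive : QuantumTorus q σ → Prop}
    (algebraMap : ∀ c, motive (algebraMap ℂ _ c))
    (add : ∀ a b, motive a → motive b → motive (a + b))
    (mul : ∀ a b, motive a → motive b → motive (a * b))
    (gen : ∀ i, motive (X q σ i : QuantumTorus q σ))
    (inv : ∀ i, motive (((X q σ i)⁻¹ : (QuantumTorus q σ)ˣ) : QuantumTorus q σ))
    (a : QuantumTorus q σ) : motive a := by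
  obtain ⟨b, rfl⟩ := RingQuot.mkAlgHom_surjective ℂ (Rel q σ) a
  induction b using FreeAlgebra.induction with
  | grade0 c => rw [AlgHom.commutes]; exact algebraMap c
  | grade1 p =>
    obtain ⟨i, b⟩ := p
    cases b
    · exact inv i
    · exact gen i
  | mul a b ha hb => rw [map_mul]; exact mul _ _ ha hb
  | add a b ha hb => rw [map_add]; exact add _ _ ha hb

/-- A linear map that intertwines the generators intertwines the representations. -/
theorem intertwines {W W' : Type*} [AddCommGroup W] [Module ℂ W] [AddCommGroup W'] [Module ℂ W']
    {ρ : QuantumTorus q σ →ₐ[ℂ] Module.End ℂ W} {ρ' : QuantumTorus q σ →ₐ[ℂ] Module.End ℂ W'}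
    (f : W →ₗ[ℂ] W') (hf : ∀ i w, f (ρ (X q σ i : QuantumTorus q σ) w) =
      ρ' (X q σ i : QuantumTorus q σ) (f w)) (a : QuantumTorus q σ) (w : W) :
    f (ρ a w) = ρ' a (f w) := by
  induction a using induction generalizing w with
  | algebraMap c => simp [AlgHom.commutes, Module.algebraMap_end_apply]
  | add a b ha hb => simp [ha, hb]
  | mul a b ha hb => simp [ha, hb]
  | gen i => exact hf i w
  | inv i =>
    have h1 : ∀ {U : Type _} [AddCommGroup U] [Module ℂ U]
      (ρ : QuantumTorus q σ →ₐ[ℂ] Module.End ℂ U) (u : U),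
        ρ (X q σ i : QuantumTorus q σ) (ρ ((X q σ i)⁻¹ : (QuantumTorus q σ)ˣ).1 u) = u := by
      intro U _ _ ρ u
      rw [← Module.End.mul_apply, ← map_mul, Units.mul_inv, map_one, Module.End.one_apply]
    have h2 : ∀ (u : W'),
        ρ' ((X q σ i)⁻¹ : (QuantumTorus q σ)ˣ).1 (ρ' (X q σ i : QuantumTorus q σ) u) = u := by
      intro u
      rw [← Module.End.mul_apply, ← map_mul, Units.inv_mul, map_one, Module.End.one_apply]
    -- The relation for `X_i` is applied to the vector `X_i⁻¹ w`, and `X_i` is then cancelled on the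
    -- target.
    have h := hf i (ρ ((X q σ i)⁻¹ : (QuantumTorus q σ)ˣ).1 w)
    rw [h1] at h
    rw [h, h2]

/-- The automorphism multiplying each generator by a scalar. -/
noncomputable def scale (c : ι → ℂˣ) : QuantumTorus q σ →ₐ[ℂ] QuantumTorus q σ :=
  lift (fun i => Units.map (algebraMap ℂ (QuantumTorus q σ) : ℂ →* QuantumTorus q σ) (c i) *
    X q σ i) (fun i j => by
      simp only [Units.val_mul, Units.coe_map, MonoidHom.coe_coe, ← Algebra.smul_def,
        smul_mul_smul_comm]
      rw [X_comm, smul_comm, mul_comm (c i : ℂ)])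

theorem scale_X (c : ι → ℂˣ) (i : ι) : scale c (X q σ i : QuantumTorus q σ) =
    (c i : ℂ) • (X q σ i : QuantumTorus q σ) := by
  rw [scale, lift_X, Units.val_mul, Algebra.smul_def]; rfl

theorem scale_surjective (c : ι → ℂˣ) :
    Function.Surjective (scale c : QuantumTorus q σ →ₐ[ℂ] QuantumTorus q σ) := by
  have h : (scale c).comp (scale c⁻¹) = AlgHom.id ℂ (QuantumTorus q σ) :=
    algHom_ext fun i => by simp [scale_X, smul_smul]
  exact fun a => ⟨scale c⁻¹ a, AlgHom.congr_fun h a⟩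

end

end QuantumTorus

theorem IsIrreducibleRep.comp {A B : Type} [Ring A] [Algebra ℂ A] [Ring B] [Algebra ℂ B]
    {W : Type u} [AddCommGroup W] [Module ℂ W] {ρ : A →ₐ[ℂ] Module.End ℂ W}
    (hρ : IsIrreducibleRep ρ) {f : B →ₐ[ℂ] A} (hf : Function.Surjective f) :
    IsIrreducibleRep (ρ.comp f) :=
  ⟨hρ.1, fun U hU => hρ.2 U fun a w hw => by
    obtain ⟨b, rfl⟩ := hf a
    exact hU b w hw⟩

/-! ### Irreducible representations of the triangle algebra -/

namespace TriangleAlgebra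

open QuantumTorus

theorem X_zero_mul_X_one (q : ℂˣ) : (X q triangleSigma 0 : TriangleAlgebra q) * X q triangleSigma 1 =
    (q : ℂ) ^ 2 • ((X q triangleSigma 1 : TriangleAlgebra q) * X q triangleSigma 0) :=
  (X_comm 0 1).trans (by rw [← Units.val_pow_eq_pow_val]; rfl)

theorem X_one_mul_X_two (q : ℂˣ) : (X q triangleSigma 1 : TriangleAlgebra q) * X q triangleSigma 2 =
    (q : ℂ) ^ 2 • ((X q triangleSigma 2 : TriangleAlgebra q) * X q triangleSigma 1) :=
  (X_comm 1 2).trans (by rw [← Units.val_pow_eq_pow_val]; rfl)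

theorem X_two_mul_X_zero (q : ℂˣ) : (X q triangleSigma 2 : TriangleAlgebra q) * X q triangleSigma 0 =
    (q : ℂ) ^ 2 • ((X q triangleSigma 0 : TriangleAlgebra q) * X q triangleSigma 2) :=
  (X_comm 2 0).trans (by rw [← Units.val_pow_eq_pow_val]; rfl)

end TriangleAlgebra

namespace QuantumTorus

variable {ι : Type} {q : ℂˣ} {σ : ι → ι → ℤ}

theorem X_pow_mul_X (i j : ι) (k : ℕ) : (X q σ i : QuantumTorus q σ) ^ k * X q σ j =
    (((q ^ (2 * σ i j)) ^ k : ℂˣ) : ℂ) • ((X q σ j : QuantumTorus q σ) * (X q σ i) ^ k) := by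
  induction k with
  | zero => simp
  | succ k ih =>
    rw [pow_succ, mul_assoc, X_comm, mul_smul_comm, ← mul_assoc, ih, smul_mul_assoc, smul_smul,
      mul_assoc, ← Units.val_mul, pow_succ (q ^ (2 * σ i j)), mul_comm ((q ^ (2 * σ i j)) ^ k)]

theorem X_pow_comm {N : ℕ} (hq : IsPrimitiveRoot ((q : ℂ) ^ 2) N) (i j : ι) :
    (X q σ i : QuantumTorus q σ) ^ N * X q σ j = (X q σ j : QuantumTorus q σ) * (X q σ i) ^ N := by
  have h : (q ^ (2 * σ i j)) ^ N = 1 := by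
    have h1 : (q ^ 2) ^ N = 1 := Units.ext (by simpa using hq.pow_eq_one)
    rw [zpow_mul, ← zpow_natCast, zpow_comm, zpow_natCast, zpow_ofNat, h1, one_zpow]
  rw [X_pow_mul_X, h, Units.val_one, one_smul]

/-- Schur's lemma: an element commuting with the generators acts by a scalar in an irreducible
representation. -/
theorem exists_eq_smul_one [Countable ι] {W : Type u} [AddCommGroup W] [Module ℂ W]
    {ρ : QuantumTorus q σ →ₐ[ℂ] Module.End ℂ W} (hρ : IsIrreducibleRep ρ)
    (a : (QuantumTorus q σ)ˣ) (ha : ∀ i, (a : QuantumTorus q σ) * X q σ i = X q σ i * a) :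
    ∃ c : ℂˣ, ρ a = (c : ℂ) • 1 := by
  obtain ⟨S, hS, hspan⟩ := exists_countable_span (q := q) (σ := σ)
  obtain ⟨c, hc⟩ := hρ.exists_eq_smul_one hS hspan (z := ρ a) (fun b => LinearMap.ext fun w => by
    refine intertwines (ρ a) (fun i w => ?_) b w
    rw [← Module.End.mul_apply, ← map_mul, ha, map_mul, Module.End.mul_apply])
  have := hρ.1
  refine ⟨Units.mk0 c ?_, hc⟩
  rintro rfl
  rw [zero_smul] at hc
  have h := congrArg ρ a.mul_inv
  rw [map_mul, hc, zero_mul, map_one] at h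
  exact zero_ne_one h

end QuantumTorus

/-- The scalars `y k` by which the `N`-th powers of the generators of the triangle algebra act, and
the scalar `h` by which the principal central element `q⁻¹ X₀ X₁ X₂` acts. -/
def HasTriangleInvariants {q : ℂˣ} {W : Type u} [AddCommGroup W] [Module ℂ W] (N : ℕ)
    (ρ : TriangleAlgebra q →ₐ[ℂ] Module.End ℂ W) (y : Fin 3 → ℂˣ) (h : ℂˣ) : Prop :=
  (∀ k, ρ (QuantumTorus.X q triangleSigma k : TriangleAlgebra q) ^ N = (y k : ℂ) • 1) ∧
    ρ (QuantumTorus.X q triangleSigma 0 : TriangleAlgebra q) *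
      ρ (QuantumTorus.X q triangleSigma 1 : TriangleAlgebra q) *
      ρ (QuantumTorus.X q triangleSigma 2 : TriangleAlgebra q) = ((q * h : ℂˣ) : ℂ) • 1

theorem smul_one_injective {W : Type u} [AddCommGroup W] [Module ℂ W] [Nontrivial W] {c d : ℂˣ}
    (h : (c : ℂ) • (1 : Module.End ℂ W) = (d : ℂ) • 1) : c = d :=
  Units.ext (smul_left_injective ℂ one_ne_zero h)

section Invariants

variable {q : ℂˣ} {N : ℕ} {W : Type u} [AddCommGroup W] [Module ℂ W]
  {ρ : TriangleAlgebra q →ₐ[ℂ] Module.End ℂ W}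

open QuantumTorus TriangleAlgebra

/-- `N`-th powers are central because `(q ^ 2) ^ N = 1`. The product `X₀ X₁ X₂` is central because
each generator picks up the factor `q ^ 2` when it passes one of the two others and `q ^ (-2)` when
it passes the remaining one. Schur's lemma then gives the scalars. -/
theorem IsIrreducibleRep.exists_hasTriangleInvariants (hq : IsPrimitiveRoot ((q : ℂ) ^ 2) N)
    (hρ : IsIrreducibleRep ρ) : ∃ y h, HasTriangleInvariants N ρ y h := by
  have h1 : ∀ k, ∃ c : ℂˣ, ρ (X q triangleSigma k : TriangleAlgebra q) ^ N = (c : ℂ) • 1 := by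
    intro k
    obtain ⟨c, hc⟩ := QuantumTorus.exists_eq_smul_one hρ (X q triangleSigma k ^ N)
      (fun i => by rw [Units.val_pow_eq_pow_val]; exact X_pow_comm hq k i)
    exact ⟨c, by rw [← map_pow, ← Units.val_pow_eq_pow_val, hc]⟩
  choose y hy using h1
  have h01 := X_zero_mul_X_one q
  have h12 := X_one_mul_X_two q
  have h20 := X_two_mul_X_zero q
  obtain ⟨c, hc⟩ := QuantumTorus.exists_eq_smul_one hρ
    (X q triangleSigma 0 * X q triangleSigma 1 * X q triangleSigma 2) (fun i => by
      simp only [Units.val_mul]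
      generalize hx0 : (X q triangleSigma 0 : TriangleAlgebra q) = x0 at *
      generalize hx1 : (X q triangleSigma 1 : TriangleAlgebra q) = x1 at *
      generalize hx2 : (X q triangleSigma 2 : TriangleAlgebra q) = x2 at *
      fin_cases i
      · simp only [Fin.zero_eta, hx0]
        calc x0 * x1 * x2 * x0 = x0 * x1 * (x2 * x0) := mul_assoc _ _ _
          _ = (q : ℂ) ^ 2 • (x0 * ((x1 * x0) * x2)) := by
            rw [h20]; simp only [mul_smul_comm, mul_assoc]
          _ = x0 * (x0 * x1 * x2) := by rw [h01]; simp only [mul_smul_comm, smul_mul_assoc]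
      · simp only [Fin.mk_one, hx1]
        calc x0 * x1 * x2 * x1 = (q : ℂ) ^ 2 • (x1 * x0 * (x2 * x1)) := by
              rw [h01]; simp only [smul_mul_assoc, mul_assoc]
          _ = x1 * x0 * (x1 * x2) := by rw [h12, mul_smul_comm]
          _ = x1 * (x0 * x1 * x2) := by simp only [mul_assoc]
      · simp only [Fin.reduceFinMk, hx2]
        calc x0 * x1 * x2 * x2 = x0 * (x1 * x2) * x2 := by simp only [mul_assoc]
          _ = (q : ℂ) ^ 2 • (x0 * x2) * x1 * x2 := by
            rw [h12]; simp only [mul_smul_comm, smul_mul_assoc, mul_assoc]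
          _ = x2 * (x0 * x1 * x2) := by rw [← h20]; simp only [mul_assoc])
  refine ⟨y, q⁻¹ * c, hy, ?_⟩
  rw [← map_mul, ← map_mul, ← Units.val_mul, ← Units.val_mul, hc, mul_inv_cancel_left]

theorem triangle_weyl_pow (hqN : q ^ (N * N) = 1) {A : Type*} [Ring A] [Algebra ℂ A] (u : Fin 3 → A)
    (hu : ∀ i j, u i * u j = ((q ^ (2 * triangleSigma i j) : ℂˣ) : ℂ) • (u j * u i)) :
    (((q⁻¹ : ℂˣ) : ℂ) • (u 0 * u 1 * u 2)) ^ N = u 0 ^ N * u 1 ^ N * u 2 ^ N := by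
  have h := weyl_prod_pow hqN triangleSigma u hu
  -- The pairs `(0, 1)`, `(0, 2)`, `(1, 2)` contribute `1 - 1 + 1`, so that the Weyl normalization
  -- of `X₀ X₁ X₂` is `q⁻¹`.
  have hs : ∑ p ∈ Finset.univ.filter (fun p : Fin 3 × Fin 3 => p.1 < p.2),
      triangleSigma p.1 p.2 = 1 := by decide
  rw [hs, zpow_neg_one] at h
  simpa [List.ofFn_succ, mul_assoc] using h

theorem HasTriangleInvariants.pow_eq [Nontrivial W] (hqN : q ^ (N * N) = 1) {y : Fin 3 → ℂˣ}
    {h : ℂˣ} (hρ : HasTriangleInvariants N ρ y h) : h ^ N = ∏ k, y k := by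
  have h1 := triangle_weyl_pow hqN (fun k => ρ (X q triangleSigma k : TriangleAlgebra q))
    (fun i j => by rw [← map_mul, X_comm, map_smul, map_mul])
  simp only [hρ.1, hρ.2, smul_smul, ← Units.val_mul, inv_mul_cancel_left] at h1
  rw [smul_pow, one_pow] at h1
  simp only [smul_mul_smul_comm, mul_one, ← Units.val_mul, ← Units.val_pow_eq_pow_val] at h1
  rw [smul_one_injective h1, Fin.prod_univ_three]

theorem HasTriangleInvariants.scale {y : Fin 3 → ℂˣ} {h : ℂˣ} (hρ : HasTriangleInvariants N ρ y h)
    (c : Fin 3 → ℂˣ) : HasTriangleInvariants N (ρ.comp (QuantumTorus.scale c))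
      (fun k => c k ^ N * y k) ((∏ k, c k) * h) := by
  constructor
  · intro k
    rw [AlgHom.comp_apply, scale_X, map_smul, smul_pow, hρ.1, smul_smul]
    simp
  · simp only [AlgHom.comp_apply, scale_X, map_smul, smul_mul_smul_comm, hρ.2, smul_smul,
      Fin.prod_univ_three, Units.val_mul]
    congr 1
    ring

/-- Representations of the triangle algebra are determined by two skew-commuting units and a
scalar. -/
theorem TriangleAlgebra.exists_algHom {A : Type*} [Ring A] [Algebra ℂ A] (a b : Aˣ)
    (hab : (a : A) * b = (q : ℂ) ^ 2 • ((b : A) * a)) (c : ℂˣ) :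
    ∃ ρ : TriangleAlgebra q →ₐ[ℂ] A, ρ (X q triangleSigma 0 : TriangleAlgebra q) = a ∧
      ρ (X q triangleSigma 1 : TriangleAlgebra q) = b ∧
      ρ (X q triangleSigma 0 : TriangleAlgebra q) * ρ (X q triangleSigma 1 : TriangleAlgebra q) *
        ρ (X q triangleSigma 2 : TriangleAlgebra q) = (c : ℂ) • 1 := by
  set κ : ℂˣ →* Aˣ := Units.map (algebraMap ℂ A : ℂ →* A) with hκ
  have hκv : ∀ d x, (κ d : A) * x = (d : ℂ) • x := fun d x => (Algebra.smul_def _ _).symm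
  have hκc : ∀ d (x : Aˣ), κ d * x = x * κ d := fun d x => Units.ext (Algebra.commutes _ _)
  set t := κ (q ^ 2) with ht
  have htc : ∀ x, t * x = x * t := hκc _
  have hab' : a * b = t * (b * a) := Units.ext (by
    rw [Units.val_mul, hab, Units.val_mul, hκv]; simp)
  -- The image of `X₂` is forced by the prescribed product `a * b * x = c`; its commutation with `a`
  -- and `b` follows from that of `a` with `b`.
  set x := κ c * (b⁻¹ * a⁻¹) with hx
  set v : Fin 3 → Aˣ := ![a, b, x] with hv
  have h1 : b⁻¹ * a = t * (a * b⁻¹) := by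
    have h := congrArg (fun z => b⁻¹ * z * b⁻¹) hab'
    simp only [← mul_assoc t] at h
    rwa [htc b, mul_assoc b, inv_mul_cancel_left, ← mul_assoc, mul_inv_cancel_right, mul_assoc] at h
  have h2 : b * a⁻¹ = t * (a⁻¹ * b) := by
    have h := congrArg (fun z => a⁻¹ * z * a⁻¹) hab'
    simp only [inv_mul_cancel_left] at h
    rwa [← mul_assoc t, ← mul_assoc, mul_inv_cancel_right, ← mul_assoc, ← htc, mul_assoc] at h
  have hbx : b * x = t * (x * b) := by
    rw [hx, ← mul_assoc, ← hκc, mul_assoc, mul_inv_cancel_left, mul_assoc (κ c), mul_assoc b⁻¹,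
      ← mul_assoc, htc, mul_assoc, ← mul_assoc t, htc b⁻¹, mul_assoc b⁻¹, ← h2,
      inv_mul_cancel_left]
  have hxa : x * a = t * (a * x) := by
    rw [hx, mul_assoc, mul_assoc b⁻¹, inv_mul_cancel, mul_one, ← mul_assoc a, ← hκc,
      mul_assoc (κ c), ← mul_assoc t, htc, mul_assoc (κ c), ← mul_assoc a, ← mul_assoc t, ← h1,
      mul_inv_cancel_right]
  have hκt : ∀ k : ℤ, κ (q ^ (2 * k)) = t ^ k := fun k => by
    rw [ht, ← map_zpow, zpow_mul, zpow_ofNat]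
  have hdiag : ∀ i, v i * v i = t ^ triangleSigma i i * (v i * v i) := fun i => by
    rw [(by decide : ∀ i, triangleSigma i i = 0) i, zpow_zero, one_mul]
  have hfwd : ∀ i, v i * v (i + 1) = t * (v (i + 1) * v i) →
      v i * v (i + 1) = t ^ triangleSigma i (i + 1) * (v (i + 1) * v i) := fun i h => by
    rw [(by decide : ∀ i, triangleSigma i (i + 1) = 1) i, zpow_one, h]
  have hrev : ∀ i, v i * v (i + 1) = t * (v (i + 1) * v i) →
      v (i + 1) * v i = t ^ triangleSigma (i + 1) i * (v i * v (i + 1)) := fun i h => by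
    rw [(by decide : ∀ i, triangleSigma (i + 1) i = -1) i, zpow_neg_one, h,
      inv_mul_cancel_left]
  have hcomm : ∀ i j, v i * v j = t ^ triangleSigma i j * (v j * v i) := by
    intro i j
    fin_cases i <;> fin_cases j
    · exact hdiag 0
    · exact hfwd 0 hab'
    · exact hrev 2 hxa
    · exact hrev 0 hab'
    · exact hdiag 1
    · exact hfwd 1 hbx
    · exact hfwd 2 hxa
    · exact hrev 1 hbx
    · exact hdiag 2
  refine ⟨lift v fun i j => ?_, lift_X _ _ _, lift_X _ _ _, ?_⟩
  · rw [← hκv, hκt, ← Units.val_mul, ← Units.val_mul, ← Units.val_mul, hcomm]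
  · rw [lift_X, lift_X, lift_X, ← hκv, mul_one, ← Units.val_mul, ← Units.val_mul]
    congr 1
    change a * b * (κ c * (b⁻¹ * a⁻¹)) = κ c
    rw [← mul_assoc, ← hκc, mul_assoc, ← mul_inv_rev, mul_inv_cancel, mul_one]

end Invariants

/-! ### The clock-and-shift model -/

section Cyclic

variable {q : ℂˣ} {N : ℕ}

open QuantumTorus TriangleAlgebra

/-- The space of the standard irreducible representation of the triangle algebra. -/
abbrev CyclicSpace (N : ℕ) : Type u := ULift.{u} (ZMod N) → ℂ

/-- A standard representation is one where `X₀` is diagonal and `X₁` is a multiple of a cyclic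
shift. -/
def IsCyclicRep (ζ : AddChar (ZMod N) ℂ) (ρ : TriangleAlgebra q →ₐ[ℂ] Module.End ℂ (CyclicSpace.{u} N))
    (a b : ℂˣ) : Prop :=
  (∀ f i, ρ (X q triangleSigma 0 : TriangleAlgebra q) f i = a * ζ i.down * f i) ∧
  (∀ f i, ρ (X q triangleSigma 1 : TriangleAlgebra q) f i = b * f (i - 1))

/-- The additive character of `ℤ/N` sending `1` to `q ^ 2`. -/
noncomputable def sqChar [NeZero N] (hq : IsPrimitiveRoot ((q : ℂ) ^ 2) N) : AddChar (ZMod N) ℂ :=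
  AddChar.zmodChar N hq.pow_eq_one

theorem sqChar_one [NeZero N] (hq : IsPrimitiveRoot ((q : ℂ) ^ 2) N) :
    sqChar hq 1 = (q : ℂ) ^ 2 := by
  have := AddChar.zmodChar_apply' hq.pow_eq_one 1
  simpa [sqChar] using this

/-- This is the primitivity of `q ^ 2`, by which the eigenvalues of `X₀` in a standard
representation are distinct. -/
theorem sqChar_injective [NeZero N] (hq : IsPrimitiveRoot ((q : ℂ) ^ 2) N) :
    Function.Injective (sqChar hq) := by
  intro i j h
  simp only [sqChar, AddChar.zmodChar_apply] at h
  exact ZMod.val_injective N (hq.pow_inj (ZMod.val_lt i) (ZMod.val_lt j) h)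

theorem sqChar_ne_zero [NeZero N] (hq : IsPrimitiveRoot ((q : ℂ) ^ 2) N) (i : ZMod N) :
    sqChar hq i ≠ 0 := by
  simp [sqChar, AddChar.zmodChar_apply]

/-- As the eigenvalues of `X₀` are distinct, polynomials in `X₀` extract a basis vector from any
nonzero element of an invariant subspace. Powers of `X₁` carry this vector to multiples of all the
others. -/
theorem IsCyclicRep.isIrreducibleRep [NeZero N] (hq : IsPrimitiveRoot ((q : ℂ) ^ 2) N) {a b : ℂˣ}
    {ρ : TriangleAlgebra q →ₐ[ℂ] Module.End ℂ (CyclicSpace.{u} N)}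
    (hρ : IsCyclicRep (sqChar hq) ρ a b) : IsIrreducibleRep ρ := by
  classical
  refine ⟨inferInstance, fun U hU => or_iff_not_imp_left.2 fun hne => ?_⟩
  obtain ⟨f, hfU, hf⟩ := Submodule.exists_mem_ne_zero_of_ne_bot hne
  obtain ⟨j, hj⟩ := Function.ne_iff.1 hf
  have hmul : ∀ c : ℂ, ∀ g ∈ U, (fun i : ULift.{u} (ZMod N) => (a * sqChar hq i.down - c) * g i) ∈ U := by
    intro c g hg
    convert U.sub_mem (hU (X q triangleSigma 0 : TriangleAlgebra q) g hg) (U.smul_mem c hg) using 1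
    funext i
    rw [Pi.sub_apply, hρ.1, Pi.smul_apply, smul_eq_mul, sub_mul]
  -- This is the value on `f` of a polynomial in `X₀` that vanishes at the eigenvalues indexed by
  -- `s`. When `s` is the complement of `j`, only the coordinate `j` survives.
  have hprod : ∀ s : Finset (ULift.{u} (ZMod N)), (fun i : ULift.{u} (ZMod N) =>
      (∏ k ∈ s, (a * sqChar hq i.down - a * sqChar hq k.down)) * f i) ∈ U := by
    intro s
    induction s using Finset.induction_on with
    | empty => simpa using hfU
    | insert k s hk ih =>
      convert hmul (a * sqChar hq k.down) _ ih using 2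
      rw [Finset.prod_insert hk, mul_assoc]
  have hsingle : Pi.single j (1 : ℂ) ∈ U := by
    set c := (∏ k ∈ Finset.univ.erase j, (a * sqChar hq j.down - a * sqChar hq k.down)) * f j
      with hc
    have hc0 : c ≠ 0 := by
      refine mul_ne_zero (Finset.prod_ne_zero_iff.2 fun k hk => ?_) hj
      rw [← mul_sub]
      refine mul_ne_zero a.ne_zero (sub_ne_zero.2 fun h => ?_)
      exact Finset.ne_of_mem_erase hk (ULift.down_injective (sqChar_injective hq h)).symm
    convert U.smul_mem c⁻¹ (hprod (Finset.univ.erase j)) using 1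
    funext i
    by_cases h : i = j
    · subst h
      rw [Pi.single_eq_same, Pi.smul_apply, smul_eq_mul, ← hc, inv_mul_cancel₀ hc0]
    · have h0 : ∏ k ∈ Finset.univ.erase j, (a * sqChar hq i.down - a * sqChar hq k.down) = 0 :=
        Finset.prod_eq_zero (Finset.mem_erase.2 ⟨h, Finset.mem_univ i⟩) (sub_self _)
      rw [Pi.single_eq_of_ne h, Pi.smul_apply, h0, zero_mul, smul_zero]
  have hall : ∀ k : ℕ, Pi.single (ULift.up (j.down + k)) (1 : ℂ) ∈ U := by
    intro k
    induction k with
    | zero => simpa using hsingle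
    | succ k ih =>
      convert U.smul_mem (b⁻¹ : ℂˣ).1 (hU (X q triangleSigma 1 : TriangleAlgebra q) _ ih) using 1
      funext i
      have h : i = ULift.up (j.down + ((k + 1 : ℕ) : ZMod N)) ↔ i - 1 = ULift.up (j.down + k) := by
        rw [sub_eq_iff_eq_add, Nat.cast_succ, ← add_assoc]; rfl
      rw [Pi.smul_apply, hρ.2, smul_eq_mul, Units.inv_mul_cancel_left]
      simp only [Pi.single_apply, h]
  rw [eq_top_iff]
  intro g _
  rw [← Finset.univ_sum_single g]
  refine U.sum_mem fun i _ => ?_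
  convert U.smul_mem (g i) (hall (i.down - j.down).val) using 1
  rw [← Pi.single_smul, smul_eq_mul, mul_one]
  congr 1
  apply ULift.down_injective
  simp

theorem exists_isCyclicRep [NeZero N] (hq : IsPrimitiveRoot ((q : ℂ) ^ 2) N) (a b c : ℂˣ) :
    ∃ ρ : TriangleAlgebra q →ₐ[ℂ] Module.End ℂ (CyclicSpace.{u} N),
      IsCyclicRep (sqChar hq) ρ a b ∧
      ρ (X q triangleSigma 0 : TriangleAlgebra q) * ρ (X q triangleSigma 1 : TriangleAlgebra q) *
        ρ (X q triangleSigma 2 : TriangleAlgebra q) = (c : ℂ) • 1 := by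
  set g : CyclicSpace.{u} N := fun i => a * sqChar hq i.down with hg
  have hg0 : ∀ i, g i ≠ 0 := fun i => mul_ne_zero a.ne_zero (sqChar_ne_zero hq _)
  set A : (Module.End ℂ (CyclicSpace.{u} N))ˣ := ⟨LinearMap.mulLeft ℂ g, LinearMap.mulLeft ℂ g⁻¹,
    by exact LinearMap.ext fun f => funext fun i => by simp [hg0], by exact LinearMap.ext fun f => funext fun i => by simp [hg0]⟩ with hA
  set B : (Module.End ℂ (CyclicSpace.{u} N))ˣ :=
    ⟨(b : ℂ) • LinearMap.funLeft ℂ ℂ (fun i => i - 1),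
      (b⁻¹ : ℂˣ).1 • LinearMap.funLeft ℂ ℂ (fun i => i + 1),
    by exact LinearMap.ext fun f => funext fun i => by simp [LinearMap.funLeft_apply],
    by exact LinearMap.ext fun f => funext fun i => by simp [LinearMap.funLeft_apply]⟩ with hB
  have hA' : ∀ f i, A.1 f i = a * sqChar hq i.down * f i := fun f i => rfl
  have hB' : ∀ f i, B.1 f i = b * f (i - 1) := fun f i => rfl
  obtain ⟨ρ, h0, h1, h2⟩ := exists_algHom (q := q) A B (by
    refine LinearMap.ext fun f => funext fun i => ?_
    rw [Module.End.mul_apply, hA', hB', LinearMap.smul_apply, Pi.smul_apply, Module.End.mul_apply,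
      hB', hA', ULift.sub_down, ULift.one_down, smul_eq_mul]
    have : sqChar hq i.down = q ^ 2 * sqChar hq (i.down - 1) := by
      rw [← sqChar_one hq, ← AddChar.map_add_eq_mul, add_sub_cancel]
    rw [this]
    ring) c
  exact ⟨ρ, ⟨fun f i => by rw [h0, hA'], fun f i => by rw [h1, hB']⟩, h2⟩

/-- The `N`-th powers of `X₀` and `X₁` are computed directly. That of `X₂` needs no computation: it
is determined by the relation `h ^ N = ∏ k, y k`, which holds in any representation with invariants.
-/
theorem IsCyclicRep.hasTriangleInvariants [NeZero N] (hq : IsPrimitiveRoot ((q : ℂ) ^ 2) N)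
    (hqN : q ^ (N * N) = 1) {a b h : ℂˣ}
    {ρ : TriangleAlgebra q →ₐ[ℂ] Module.End ℂ (CyclicSpace.{u} N)}
    (hρ : IsCyclicRep (sqChar hq) ρ a b)
    (hc : ρ (X q triangleSigma 0 : TriangleAlgebra q) *
      ρ (X q triangleSigma 1 : TriangleAlgebra q) *
      ρ (X q triangleSigma 2 : TriangleAlgebra q) = ((q * h : ℂˣ) : ℂ) • 1) {y : Fin 3 → ℂˣ}
    (hy0 : y 0 = a ^ N) (hy1 : y 1 = b ^ N) (hy : h ^ N = ∏ k, y k) :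
    HasTriangleInvariants N ρ y h := by
  obtain ⟨y', h', hyh⟩ := (hρ.isIrreducibleRep hq).exists_hasTriangleInvariants hq
  have hh : h' = h := mul_left_cancel (smul_one_injective (hyh.2.symm.trans hc))
  have hpow := hyh.pow_eq hqN
  have e0 : ∀ (k : ℕ) f i, (ρ (X q triangleSigma 0 : TriangleAlgebra q) ^ k) f i =
      (a * sqChar hq i.down) ^ k * f i := by
    intro k f i
    induction k with
    | zero => simp
    | succ k ih => rw [pow_succ', Module.End.mul_apply, hρ.1, ih]; ring
  have e1 : ∀ (k : ℕ) f i, (ρ (X q triangleSigma 1 : TriangleAlgebra q) ^ k) f i =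
      (b : ℂ) ^ k * f (i - k) := by
    intro k f i
    induction k generalizing i with
    | zero => simp
    | succ k ih =>
      rw [pow_succ', Module.End.mul_apply, hρ.2, ih, Nat.cast_succ, sub_sub, add_comm (1 : ULift _)]
      ring
  have h0 : y' 0 = y 0 := by
    rw [hy0]
    refine smul_one_injective ((hyh.1 0).symm.trans ?_)
    refine LinearMap.ext fun f => funext fun i => ?_
    rw [e0, mul_pow, ← AddChar.map_nsmul_eq_pow]
    simp
  have h1 : y' 1 = y 1 := by
    rw [hy1]
    refine smul_one_injective ((hyh.1 1).symm.trans ?_)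
    refine LinearMap.ext fun f => funext fun i => ?_
    rw [e1, show (N : ULift.{u} (ZMod N)) = 0 from ULift.down_injective (by simp)]
    simp
  have h2 : y' 2 = y 2 := by
    rw [hh, hy, Fin.prod_univ_three, Fin.prod_univ_three, h0, h1] at hpow
    exact (mul_left_cancel hpow).symm
  rw [hh] at hyh
  convert hyh using 1
  funext k
  fin_cases k
  · exact h0.symm
  · exact h1.symm
  · exact h2.symm

theorem exists_units_pow_eq [NeZero N] (y : ℂˣ) : ∃ a : ℂˣ, a ^ N = y := by
  obtain ⟨a, ha⟩ := IsAlgClosed.exists_pow_nat_eq (y : ℂ) (Nat.pos_of_ne_zero (NeZero.ne N))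
  refine ⟨Units.mk0 a ?_, Units.ext ha⟩
  rintro rfl
  rw [zero_pow (NeZero.ne N)] at ha
  exact y.ne_zero ha.symm

theorem exists_irreducible_hasTriangleInvariants [NeZero N] (hq : IsPrimitiveRoot ((q : ℂ) ^ 2) N)
    (hqN : q ^ (N * N) = 1) {y : Fin 3 → ℂˣ} {h : ℂˣ} (hy : h ^ N = ∏ k, y k) :
    ∃ ρ : TriangleAlgebra q →ₐ[ℂ] Module.End ℂ (CyclicSpace.{u} N),
      IsIrreducibleRep ρ ∧ HasTriangleInvariants N ρ y h := by
  obtain ⟨a, ha⟩ := exists_units_pow_eq (N := N) (y 0)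
  obtain ⟨b, hb⟩ := exists_units_pow_eq (N := N) (y 1)
  obtain ⟨ρ, hρ, hc⟩ := exists_isCyclicRep hq a b (q * h)
  exact ⟨ρ, hρ.isIrreducibleRep hq, hρ.hasTriangleInvariants hq hqN hc ha.symm hb.symm hy⟩

end Cyclic

/-- The linear factors of `p` are applied one after the other to a nonzero vector. The first factor
that kills the vector obtained so far exhibits an eigenvector, and finite dimension plays no role.
-/
theorem exists_eigenvector_of_aeval_eq_zero {W : Type*} [AddCommGroup W] [Module ℂ W] [Nontrivial W]
    {A : Module.End ℂ W} {p : Polynomial ℂ} (hp : p ≠ 0) (hA : Polynomial.aeval A p = 0) :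
    ∃ (μ : ℂ) (v : W), v ≠ 0 ∧ A v = μ • v := by
  obtain ⟨w, hw⟩ := exists_ne (0 : W)
  have key : ∀ s : Multiset ℂ,
      Polynomial.aeval A (s.map fun r => Polynomial.X - Polynomial.C r).prod w = 0 →
      ∃ (μ : ℂ) (v : W), v ≠ 0 ∧ A v = μ • v := by
    intro s
    induction s using Multiset.induction_on with
    | empty => intro h; exact absurd (by simpa using h) hw
    | cons r s ih =>
      intro h
      rw [Multiset.map_cons, Multiset.prod_cons, map_mul, Module.End.mul_apply] at h
      by_cases h0 : Polynomial.aeval A (s.map fun r => Polynomial.X - Polynomial.C r).prod w = 0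
      · exact ih h0
      · refine ⟨r, _, h0, ?_⟩
        rw [map_sub, Polynomial.aeval_X, Polynomial.aeval_C, LinearMap.sub_apply,
          Module.algebraMap_end_apply] at h
        exact sub_eq_zero.1 h
  refine key p.roots ?_
  have h := LinearMap.congr_fun hA w
  rw [(IsAlgClosed.splits p).eq_prod_roots, map_mul, Polynomial.aeval_C, Module.End.mul_apply,
    Module.algebraMap_end_apply] at h
  exact (smul_eq_zero.1 h).resolve_left (Polynomial.leadingCoeff_ne_zero.2 hp)

/-! ### Uniqueness of the irreducible representation with given invariants -/

section CyclicUnique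

variable {q : ℂˣ} {N : ℕ} {W : Type u} [AddCommGroup W] [Module ℂ W]
  {ρ : TriangleAlgebra q →ₐ[ℂ] Module.End ℂ W} {y : Fin 3 → ℂˣ} {h : ℂˣ}

open QuantumTorus TriangleAlgebra

/-- Some eigenvalue `μ` of `X₀` exists and satisfies `μ ^ N = y 0`. Each application of the
invertible operator `X₁` multiplies the eigenvalue by `q ^ 2`, a primitive `N`-th root of unity, so
every `N`-th root of `y 0` is reached, in particular `a`. -/
theorem HasTriangleInvariants.exists_eigenvector [NeZero N] [Nontrivial W]
    (hq : IsPrimitiveRoot ((q : ℂ) ^ 2) N) (hρ : HasTriangleInvariants N ρ y h) {a : ℂˣ}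
    (ha : y 0 = a ^ N) :
    ∃ v : W, v ≠ 0 ∧ ρ (X q triangleSigma 0 : TriangleAlgebra q) v = (a : ℂ) • v := by
  have h01 := congrArg ρ (X_zero_mul_X_one q)
  have hunit := (X q triangleSigma 1).isUnit.map ρ
  have hA := hρ.1 0
  rw [map_mul, map_smul, map_mul] at h01
  generalize ρ (X q triangleSigma 0 : TriangleAlgebra q) = A at *
  generalize ρ (X q triangleSigma 1 : TriangleAlgebra q) = B at *
  have hB : Function.Injective B := ((Module.End.isUnit_iff B).1 hunit).1
  obtain ⟨μ, v, hv, hμ⟩ := exists_eigenvector_of_aeval_eq_zero (A := A)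
    (Polynomial.monic_X_pow_sub_C (y 0 : ℂ) (NeZero.ne N)).ne_zero (by
      rw [map_sub, map_pow, Polynomial.aeval_X, Polynomial.aeval_C, hA,
        Algebra.algebraMap_eq_smul_one, sub_self])
  have hpow : ∀ k : ℕ, (A ^ k) v = μ ^ k • v := fun k => by
    induction k with
    | zero => simp
    | succ k ih => rw [pow_succ, Module.End.mul_apply, hμ, map_smul, ih, smul_smul, pow_succ']
  have hμN : μ ^ N = (a : ℂ) ^ N := by
    have h1 := hpow N
    rw [hA, ha, LinearMap.smul_apply, Module.End.one_apply, Units.val_pow_eq_pow_val] at h1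
    exact (smul_left_injective ℂ hv h1).symm
  have hμ0 : μ ≠ 0 := by
    rintro rfl
    rw [zero_pow (NeZero.ne N)] at hμN
    exact pow_ne_zero N a.ne_zero hμN.symm
  obtain ⟨k, -, hk⟩ := hq.eq_pow_of_pow_eq_one (ξ := a / μ) (by
    rw [div_pow, hμN, div_self (pow_ne_zero N a.ne_zero)])
  have hstep : ∀ k : ℕ, A ((B ^ k) v) = (((q : ℂ) ^ 2) ^ k * μ) • (B ^ k) v := fun k => by
    induction k with
    | zero => simp [hμ]
    | succ k ih =>
      rw [pow_succ', Module.End.mul_apply, ← Module.End.mul_apply A, h01, LinearMap.smul_apply,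
        Module.End.mul_apply, ih, map_smul, smul_smul]
      congr 1
      ring
  refine ⟨(B ^ k) v, ?_, ?_⟩
  · rw [Module.End.pow_apply]
    exact fun h0 => hv ((hB.iterate k) (h0.trans (by rw [← Module.End.pow_apply, map_zero])))
  · rw [hstep, hk, div_mul_cancel₀ _ hμ0]

/-- An irreducible representation of the triangle algebra is isomorphic to the standard one with
the same invariants. -/
theorem HasTriangleInvariants.exists_equiv_cyclic [NeZero N] (hq : IsPrimitiveRoot ((q : ℂ) ^ 2) N)
    (hirr : IsIrreducibleRep ρ) (hρ : HasTriangleInvariants N ρ y h)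
    {a b : ℂˣ} (ha : y 0 = a ^ N) (hb : y 1 = b ^ N)
    {ρ' : TriangleAlgebra q →ₐ[ℂ] Module.End ℂ (CyclicSpace.{u} N)}
    (hcyc : IsCyclicRep (sqChar hq) ρ' a b)
    (hc : ρ' (X q triangleSigma 0 : TriangleAlgebra q) *
      ρ' (X q triangleSigma 1 : TriangleAlgebra q) *
      ρ' (X q triangleSigma 2 : TriangleAlgebra q) = ((q * h : ℂˣ) : ℂ) • 1) :
    ∃ L : CyclicSpace.{u} N ≃ₗ[ℂ] W, ∀ x w, L (ρ' x w) = ρ x (L w) := by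
  have := hirr.1
  obtain ⟨v, hv, hav⟩ := hρ.exists_eigenvector hq ha
  have h01 := congrArg ρ (X_zero_mul_X_one q)
  have hunit0 := (X q triangleSigma 0).isUnit.map ρ
  have hunit1 := (X q triangleSigma 1).isUnit.map ρ
  have hB := hρ.1 1
  have hC := hρ.2
  rw [map_mul, map_smul, map_mul] at h01
  set A := ρ (X q triangleSigma 0 : TriangleAlgebra q) with hAdef
  set B := ρ (X q triangleSigma 1 : TriangleAlgebra q) with hBdef
  -- Dividing `X₁` by `b` gives an operator with `D ^ N = 1`, so that `(D ^ k) v` depends only on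
  -- `k` modulo `N` and the family `e` below is indexed by `ZMod N`.
  set D : Module.End ℂ W := ((b⁻¹ : ℂˣ) : ℂ) • B with hD
  have hDN : D ^ N = 1 := by
    rw [hD, smul_pow, hB, smul_smul, hb, ← Units.val_pow_eq_pow_val, ← Units.val_mul]
    simp
  have hBD : B = (b : ℂ) • D := by rw [hD, smul_smul, Units.mul_inv, one_smul]
  have hA : ∀ k : ℕ, A ((D ^ k) v) = (a * ((q : ℂ) ^ 2) ^ k) • (D ^ k) v := fun k => by
    induction k with
    | zero => simp [hav]
    | succ k ih =>
      have hAD : A * D = (q : ℂ) ^ 2 • (D * A) := by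
        rw [hD, mul_smul_comm, h01, smul_mul_assoc, smul_comm]
      rw [pow_succ', Module.End.mul_apply, ← Module.End.mul_apply A, hAD, LinearMap.smul_apply,
        Module.End.mul_apply, ih, map_smul, smul_smul]
      congr 1
      ring
  set e : ULift.{u} (ZMod N) → W := fun i => (D ^ i.down.val) v with he
  have heA : ∀ i, A (e i) = (a * sqChar hq i.down) • e i := fun i => hA _
  have heD : ∀ i, D (e i) = e (i + 1) := fun i => by
    rw [he]
    simp only
    rw [← Module.End.mul_apply, ← pow_succ', pow_eq_pow_mod (i.down.val + 1) hDN,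
      ULift.add_down, ULift.one_down, ZMod.val_add, ZMod.val_one_eq_one_mod, Nat.add_mod_mod]
  set f := Fintype.linearCombination ℂ e with hf
  have hf0 : ∀ g, f (ρ' (X q triangleSigma 0 : TriangleAlgebra q) g) = A (f g) := fun g => by
    simp only [hf, Fintype.linearCombination_apply, map_sum, map_smul, heA, hcyc.1, smul_smul]
    exact Finset.sum_congr rfl fun i _ => by rw [mul_comm (g i)]
  have hf1 : ∀ g, f (ρ' (X q triangleSigma 1 : TriangleAlgebra q) g) = B (f g) := fun g => by
    simp only [hf, Fintype.linearCombination_apply, map_sum, map_smul, hBD, LinearMap.smul_apply,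
      heD, hcyc.2, smul_smul]
    rw [← Equiv.sum_comp (Equiv.addRight (1 : ULift.{u} (ZMod N)))]
    exact Finset.sum_congr rfl fun i _ => by simp [mul_comm]
  -- `X₀ X₁ X₂` acts by the same scalar on both sides, and `X₀` and `X₁` can be cancelled.
  have hf2 : ∀ g, f (ρ' (X q triangleSigma 2 : TriangleAlgebra q) g) =
      ρ (X q triangleSigma 2 : TriangleAlgebra q) (f g) := fun g => by
    apply ((Module.End.isUnit_iff B).1 hunit1).1
    apply ((Module.End.isUnit_iff A).1 hunit0).1
    rw [← hf1, ← hf0]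
    have h1 := LinearMap.congr_fun hC (f g)
    have h2 := LinearMap.congr_fun hc g
    simp only [Module.End.mul_apply, LinearMap.smul_apply, Module.End.one_apply] at h1 h2
    rw [h1, h2, map_smul]
  have hfX : ∀ x g, f (ρ' x g) = ρ x (f g) := intertwines f (fun i g => by
    fin_cases i
    · exact hf0 g
    · exact hf1 g
    · exact hf2 g)
  -- A nonzero intertwiner between two irreducible representations is bijective, so no dimension
  -- count is needed.
  have hne : f ≠ 0 := by
    intro h0
    apply hv
    have h1 := LinearMap.congr_fun h0 (Pi.single 0 1)
    rw [hf, Fintype.linearCombination_apply_single, one_smul, LinearMap.zero_apply] at h1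
    simpa [he] using h1
  have hker : LinearMap.ker f = ⊥ := by
    refine ((hcyc.isIrreducibleRep hq).2 (LinearMap.ker f) fun x g hg => ?_).resolve_right
      fun h0 => hne (LinearMap.ker_eq_top.1 h0)
    rw [LinearMap.mem_ker, hfX, LinearMap.mem_ker.1 hg, map_zero]
  have hrange : LinearMap.range f = ⊤ := by
    refine (hirr.2 (LinearMap.range f) ?_).resolve_left fun h0 => hne (LinearMap.range_eq_bot.1 h0)
    rintro x _ ⟨g, rfl⟩
    exact ⟨ρ' x g, hfX x g⟩
  exact ⟨LinearEquiv.ofBijective f ⟨LinearMap.ker_eq_bot.1 hker, LinearMap.range_eq_top.1 hrange⟩,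
    hfX⟩

/-- Irreducible representations of the triangle algebra with the same invariants are isomorphic. -/
theorem HasTriangleInvariants.exists_equiv [NeZero N] (hq : IsPrimitiveRoot ((q : ℂ) ^ 2) N)
    (hirr : IsIrreducibleRep ρ) (hρ : HasTriangleInvariants N ρ y h)
    {W' : Type u} [AddCommGroup W'] [Module ℂ W'] {ρ' : TriangleAlgebra q →ₐ[ℂ] Module.End ℂ W'}
    (hirr' : IsIrreducibleRep ρ') (hρ' : HasTriangleInvariants N ρ' y h) :
    ∃ L : W' ≃ₗ[ℂ] W, ∀ x, ρ' x = L.symm.toLinearMap ∘ₗ ρ x ∘ₗ L.toLinearMap := by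
  obtain ⟨a, ha⟩ := exists_units_pow_eq (N := N) (y 0)
  obtain ⟨b, hb⟩ := exists_units_pow_eq (N := N) (y 1)
  obtain ⟨τ, hτ, hc⟩ := exists_isCyclicRep.{u} hq a b (q * h)
  obtain ⟨L, hL⟩ := hρ.exists_equiv_cyclic hq hirr ha.symm hb.symm hτ hc
  obtain ⟨L', hL'⟩ := hρ'.exists_equiv_cyclic hq hirr' ha.symm hb.symm hτ hc
  refine ⟨L'.symm.trans L, fun x => LinearMap.ext fun w => ?_⟩
  obtain ⟨g, rfl⟩ := L'.surjective w
  simp [← hL, ← hL']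

end CyclicUnique

/-! ### Invariants of local representations -/

section LocalInvariants

variable {m n N : ℕ} {q : ℂˣ} {V : Fin m → Type u} [∀ j, AddCommGroup (V j)] [∀ j, Module ℂ (V j)]

namespace IrrepFamily

/-- The invariants of a family of irreducible representations of the triangle algebras. -/
def HasInvariants (N : ℕ) (φ : IrrepFamily q V) (y : Fin m × Fin 3 → ℂˣ) (h : Fin m → ℂˣ) : Prop :=
  ∀ j, HasTriangleInvariants N (φ.1 j) (fun k => y (j, k)) (h j)

theorem exists_hasInvariants (hq : IsPrimitiveRoot ((q : ℂ) ^ 2) N) (φ : IrrepFamily q V) :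
    ∃ y h, HasInvariants N φ y h := by
  choose y h H using fun j => (φ.2 j).exists_hasTriangleInvariants hq
  exact ⟨fun s => y s.1 s.2, h, H⟩

theorem nontrivial_tensor (φ : IrrepFamily q V) : Nontrivial (⨂[ℂ] j, V j) := by
  have : ∀ j, Nontrivial (V j) := fun j => (φ.2 j).1
  have b := fun j => Module.Basis.ofVectorSpace ℂ (V j)
  have : ∀ j, Nonempty (Module.Basis.ofVectorSpaceIndex ℂ (V j)) := fun j =>
    (Module.Basis.ofVectorSpace ℂ (V j)).index_nonempty
  exact (Basis.piTensorProduct fun j => Module.Basis.ofVectorSpace ℂ (V j)).repr.toEquiv.nontrivial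

theorem tensorRep_sideGen_pow (φ : IrrepFamily q V) {y : Fin m × Fin 3 → ℂˣ} {h : Fin m → ℂˣ}
    (H : HasInvariants N φ y h) (s : Fin m × Fin 3) :
    tensorRep φ.1 (IdealTriangulation.sideGen q s : IdealTriangulation.FaceAlgebra m q) ^ N =
      (y s : ℂ) • 1 := by
  rw [tensorRep_sideGen, ← PiTensorProduct.map_pow]
  have : Function.update (fun j => (1 : Module.End ℂ (V j))) s.1 (φ.side s) ^ N =
      Function.update (fun j => (1 : Module.End ℂ (V j))) s.1 ((y s : ℂ) • 1) := by
    funext j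
    rw [Pi.pow_apply]
    by_cases hj : j = s.1
    · subst hj
      rw [Function.update_self, Function.update_self]
      exact (H s.1).1 s.2
    · rw [Function.update_of_ne hj, Function.update_of_ne hj, one_pow]
  rw [this, PiTensorProduct.map_update_smul, Function.update_eq_self]
  exact congrArg _ PiTensorProduct.map_one

variable (T : IdealTriangulation m n)

/-- The factor `q ^ (-sideSigma s t)` in `edgeGen` is the Weyl normalization of the product of the
two side generators. Taking the `N`-th power therefore introduces no extra scalar, whether or not
the two sides belong to the same face. -/
theorem induced_X_pow (hqN : q ^ (N * N) = 1) (φ : IrrepFamily q V) {y : Fin m × Fin 3 → ℂˣ}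
    {h : Fin m → ℂˣ} (H : HasInvariants N φ y h) (i : Fin n) :
    φ.induced T ((QuantumTorus.X q T.sigma i : T.ChekhovFock q) ^ N) =
      ((y (T.side (i, false)) * y (T.side (i, true)) : ℂˣ) : ℂ) • 1 := by
  set s := T.side (i, false)
  set t := T.side (i, true)
  have hc : tensorRep φ.1 (IdealTriangulation.sideGen q t : IdealTriangulation.FaceAlgebra m q) *
      tensorRep φ.1 (IdealTriangulation.sideGen q s : IdealTriangulation.FaceAlgebra m q) =
      ((q ^ (-IdealTriangulation.sideSigma s t) : ℂˣ) : ℂ) ^ 2 •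
      (tensorRep φ.1 (IdealTriangulation.sideGen q s : IdealTriangulation.FaceAlgebra m q) *
      tensorRep φ.1 (IdealTriangulation.sideGen q t : IdealTriangulation.FaceAlgebra m q)) := by
    have he : ((q ^ (-IdealTriangulation.sideSigma s t) : ℂˣ) : ℂ) ^ 2 *
        ((q ^ (2 * IdealTriangulation.sideSigma s t) : ℂˣ) : ℂ) = 1 := by
      rw [← Units.val_pow_eq_pow_val, ← Units.val_mul, ← zpow_natCast, ← zpow_mul, ← zpow_add]
      simp [mul_comm]
    rw [← map_mul, ← map_mul, IdealTriangulation.sideGen_comm q s t, map_smul, smul_smul, he,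
      one_smul]
  rw [map_pow, induced, AlgHom.comp_apply, IdealTriangulation.embed, QuantumTorus.lift_X,
    IdealTriangulation.edgeGen_val, map_smul, map_mul, smul_mul_pow_of_mul_eq_sq_smul hc,
    tensorRep_sideGen_pow φ H, tensorRep_sideGen_pow φ H, smul_mul_smul_comm, mul_one,
    ← Units.val_pow_eq_pow_val, ← zpow_natCast, ← zpow_mul, mul_comm, zpow_mul, zpow_natCast, hqN,
    one_zpow, Units.val_one, one_smul, Units.val_mul]

theorem tensorRep_face (φ : IrrepFamily q V) {y : Fin m × Fin 3 → ℂˣ} {h : Fin m → ℂˣ}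
    (H : HasInvariants N φ y h) (j : Fin m) :
    tensorRep φ.1 (IdealTriangulation.sideGen q (j, 0) : IdealTriangulation.FaceAlgebra m q) *
    tensorRep φ.1 (IdealTriangulation.sideGen q (j, 1) : IdealTriangulation.FaceAlgebra m q) *
    tensorRep φ.1 (IdealTriangulation.sideGen q (j, 2) : IdealTriangulation.FaceAlgebra m q) =
      ((q * h j : ℂˣ) : ℂ) • 1 := by
  have hmul : ∀ a b : Module.End ℂ (V j),
      PiTensorProduct.map (Function.update (fun j => (1 : Module.End ℂ (V j))) j a) *
        PiTensorProduct.map (Function.update (fun j => (1 : Module.End ℂ (V j))) j b) =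
      PiTensorProduct.map (Function.update (fun j => (1 : Module.End ℂ (V j))) j (a * b)) := by
    intro a b
    rw [← PiTensorProduct.map_mul]
    congr 1
    funext k
    by_cases hk : k = j
    · subst hk; simp
    · simp [Function.update_of_ne hk]
  rw [tensorRep_sideGen, tensorRep_sideGen, tensorRep_sideGen, hmul, hmul]
  have h1 : φ.side (j, 0) * φ.side (j, 1) * φ.side (j, 2) = ((q * h j : ℂˣ) : ℂ) • 1 := (H j).2
  rw [h1, PiTensorProduct.map_update_smul, Function.update_eq_self]
  exact congrArg _ PiTensorProduct.map_one

end IrrepFamily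

namespace IdealTriangulation

variable (T : IdealTriangulation m n) (q)

/-- Only the existence of the reordering scalar is needed, never its value. -/
theorem exists_smul_prod_of_perm {ι B : Type*} [Ring B] [Algebra ℂ B] {g : ι → B} {p : ι → ι → ℂˣ}
    (hg : ∀ s t, g s * g t = (p s t : ℂ) • (g t * g s)) {l l' : List ι} (hl : l.Perm l') :
    ∃ c : ℂˣ, (l.map g).prod = (c : ℂ) • (l'.map g).prod := by
  induction hl with
  | nil => exact ⟨1, by simp⟩
  | cons s _ ih =>
    obtain ⟨c, hc⟩ := ih
    exact ⟨c, by rw [List.map_cons, List.prod_cons, hc, mul_smul_comm, List.map_cons,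
      List.prod_cons]⟩
  | swap s t l =>
    refine ⟨p t s, ?_⟩
    simp only [List.map_cons, List.prod_cons, ← mul_assoc]
    rw [hg, smul_mul_assoc]
  | trans _ _ ih ih' =>
    obtain ⟨c, hc⟩ := ih
    obtain ⟨d, hd⟩ := ih'
    exact ⟨c * d, by rw [hc, hd, smul_smul, Units.val_mul]⟩

theorem exists_smul_prod_flatMap {ι κ B : Type*} [Ring B] [Algebra ℂ B] {f : ι → B} {g : κ → B}
    {a b : ι → κ} {p : ι → ℂˣ} (hf : ∀ i, f i = (p i : ℂ) • (g (a i) * g (b i))) (l : List ι) :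
    ∃ c : ℂˣ, (l.map f).prod = (c : ℂ) • ((l.flatMap fun i => [a i, b i]).map g).prod := by
  induction l with
  | nil => exact ⟨1, by simp⟩
  | cons i l ih =>
    obtain ⟨c, hc⟩ := ih
    refine ⟨p i * c, ?_⟩
    rw [List.map_cons, List.prod_cons, hc, hf, smul_mul_smul_comm, Units.val_mul]
    simp [mul_assoc]

/-- Both lists contain each side once, grouped by edges in the first one and by faces in the second
one. This regrouping turns a product over edges into a product of the central elements of the faces.
-/
theorem sides_perm : ((List.finRange n).flatMap fun i => [T.side (i, false), T.side (i, true)]).Perm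
    ((List.finRange m).flatMap fun j => [(j, 0), (j, 1), (j, 2)]) := by
  refine (List.perm_ext_iff_of_nodup ?_ ?_).2 fun s => ?_
  · rw [List.nodup_flatMap]
    refine ⟨fun i _ => by simp, (List.nodup_finRange n).imp fun {i k} hik => ?_⟩
    simp [Function.onFun, List.disjoint_left, hik]
  · rw [List.nodup_flatMap]
    refine ⟨fun i _ => by simp, (List.nodup_finRange m).imp fun {i k} hik => ?_⟩
    simp [Function.onFun, List.disjoint_left, hik]
  · obtain ⟨⟨i, b⟩, rfl⟩ := T.side.surjective s
    generalize hs : T.side (i, b) = s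
    obtain ⟨j, k⟩ := s
    simp only [List.mem_flatMap, List.mem_finRange, true_and]
    refine iff_of_true ⟨i, ?_⟩ ⟨j, ?_⟩
    · cases b <;> simp [← hs]
    · fin_cases k <;> simp

/-- Up to a scalar depending only on the triangulation, the principal central element acts by the
product of the scalars associated to the faces. -/
theorem exists_induced_principal : ∃ κ : ℂˣ, ∀ {N : ℕ} {V : Fin m → Type u}
    [∀ j, AddCommGroup (V j)] [∀ j, Module ℂ (V j)] (φ : IrrepFamily q V)
    {y : Fin m × Fin 3 → ℂˣ} {h : Fin m → ℂˣ}, φ.HasInvariants N y h →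
    φ.induced T (T.principal q) = ((κ * ∏ j, h j : ℂˣ) : ℂ) • 1 := by
  -- The reordering takes place in the tensor product of the triangle algebras, before any
  -- representation is chosen. The same `κ` thus serves for all families and all spaces, and it
  -- cancels when two local representations are compared.
  obtain ⟨c, hc⟩ := exists_smul_prod_flatMap (B := FaceAlgebra m q)
    (f := fun i => (T.edgeGen q i : FaceAlgebra m q))
    (g := fun s => (sideGen q s : FaceAlgebra m q)) (a := fun i => T.side (i, false))
    (b := fun i => T.side (i, true)) (T.edgeGen_val q) (List.finRange n)
  obtain ⟨d, hd⟩ := exists_smul_prod_of_perm (B := FaceAlgebra m q)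
    (sideGen_comm (m := m) q) T.sides_perm
  refine ⟨q ^ (-∑ p ∈ Finset.univ.filter (fun p : Fin n × Fin n => p.1 < p.2),
    T.sigma p.1 p.2) * c * d * q ^ m, fun {N V} _ _ φ y h H => ?_⟩
  have h1 : ∀ l : List (Fin m), tensorRep φ.1 ((l.flatMap fun j => [(j, 0), (j, 1), (j, 2)]).map
      fun s => (sideGen q s : FaceAlgebra m q)).prod =
      (((l.map fun j => q * h j).prod : ℂˣ) : ℂ) • 1 := by
    intro l
    induction l with
    | nil => simp
    | cons j l ih =>
      have hj := φ.tensorRep_face H j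
      rw [← map_mul, ← map_mul] at hj
      have hl : ((j :: l).map fun j => q * h j).prod = q * h j * (l.map fun j => q * h j).prod :=
        rfl
      rw [List.flatMap_cons, List.map_append, List.prod_append, map_mul, ih, hl, Units.val_mul]
      have h0 : ([(j, (0 : Fin 3)), (j, 1), (j, 2)].map
          fun s => (sideGen q s : FaceAlgebra m q)).prod =
          (sideGen q (j, 0) : FaceAlgebra m q) * sideGen q (j, 1) * sideGen q (j, 2) := by
        simp [mul_assoc]
      rw [h0, hj, smul_mul_smul_comm, mul_one]
  have h2 : T.embed q (T.principal q) = ((q ^ (-∑ p ∈ Finset.univ.filter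
      (fun p : Fin n × Fin n => p.1 < p.2), T.sigma p.1 p.2) : ℂˣ) : ℂ) •
      ((List.finRange n).map fun i => (T.edgeGen q i : FaceAlgebra m q)).prod := by
    rw [principal, map_smul, map_list_prod, List.map_ofFn, List.ofFn_eq_map]
    simp only [Function.comp_def, embed, QuantumTorus.lift_X]
  have h3 : ((List.finRange m).map fun j => q * h j).prod = q ^ m * ∏ j, h j := by
    rw [← List.ofFn_eq_map, List.prod_ofFn, Finset.prod_mul_distrib]
    simp
  rw [IrrepFamily.induced, AlgHom.comp_apply, h2, hc, hd, map_smul, map_smul, map_smul, h1, h3,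
    smul_smul, smul_smul, smul_smul]
  simp only [Units.val_mul, mul_assoc]

end IdealTriangulation

/-- The principal element is itself Weyl-ordered, so `weyl_prod_pow` computes its `N`-th power in
the Chekhov-Fock algebra. -/
theorem induced_principal_pow (T : IdealTriangulation m n) (hqN : q ^ (N * N) = 1)
    (φ : IrrepFamily q V) {x : Fin n → ℂˣ} {h : ℂˣ}
    (hx : ∀ i, φ.induced T ((QuantumTorus.X q T.sigma i : T.ChekhovFock q) ^ N) = (x i : ℂ) • 1)
    (hh : φ.induced T (T.principal q) = (h : ℂ) • 1) : h ^ N = ∏ i, x i := by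
  have := φ.nontrivial_tensor
  have h1 := weyl_prod_pow hqN T.sigma
    (fun i => (QuantumTorus.X q T.sigma i : T.ChekhovFock q)) (fun i j => QuantumTorus.X_comm i j)
  have h2 := congrArg (φ.induced T) h1
  have h3 : φ.induced T (T.principal q) ^ N = φ.induced T (T.principal q ^ N) :=
    (map_pow _ _ _).symm
  rw [hh, IdealTriangulation.principal, h2, map_list_prod, List.map_ofFn] at h3
  simp only [Function.comp_def, hx] at h3
  apply smul_one_injective (W := ⨂[ℂ] j, V j)
  rw [Units.val_pow_eq_pow_val, ← one_pow N, ← smul_pow, one_pow, h3]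
  simp only [← Algebra.algebraMap_eq_smul_one]
  rw [← List.prod_ofFn, ← Units.coeHom_apply, map_list_prod, map_list_prod, List.map_ofFn,
    List.map_ofFn]
  rfl

end LocalInvariants

/-! ### Modification of the scalars associated to the sides -/

section SideScalar

namespace IdealTriangulation

variable {m n : ℕ} (T : IdealTriangulation m n) {G : Type*} [CommGroup G]

/-- A family of scalars associated to the edges, placed on the first side of each edge, together
with the inverse scalars on the second side. -/
def sideScalar (e : Fin n → G) (s : Fin m × Fin 3) : G :=
  if (T.side.symm s).2 then (e (T.side.symm s).1)⁻¹ else e (T.side.symm s).1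

@[simp] theorem sideScalar_false (e : Fin n → G) (i : Fin n) :
    T.sideScalar e (T.side (i, false)) = e i := by simp [sideScalar]

@[simp] theorem sideScalar_true (e : Fin n → G) (i : Fin n) :
    T.sideScalar e (T.side (i, true)) = (e i)⁻¹ := by simp [sideScalar]

/-- The product of the scalars on the sides of each face. -/
def faceProd : (Fin n → G) →* (Fin m → G) where
  toFun e j := ∏ k, T.sideScalar e (j, k)
  map_one' := by funext j; simp [sideScalar]
  map_mul' e e' := by
    funext j
    rw [Pi.mul_apply, ← Finset.prod_mul_distrib]
    refine Finset.prod_congr rfl fun k _ => ?_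
    unfold sideScalar
    split_ifs <;> simp [mul_comm]

theorem faceProd_apply (e : Fin n → G) (j : Fin m) :
    T.faceProd e j = ∏ k, T.sideScalar e (j, k) := rfl

/-- `faceProd` is the boundary map, in multiplicative notation, of the dual graph whose vertices are
the faces. The two contributions cancel for an edge glued from two sides of the same face. -/
theorem faceProd_mulSingle (i : Fin n) (g : G) : T.faceProd (Pi.mulSingle i g) =
    Pi.mulSingle (T.side (i, false)).1 g * (Pi.mulSingle (T.side (i, true)).1 g)⁻¹ := by
  classical
  funext j
  have h1 : T.faceProd (Pi.mulSingle i g) j =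
      ∏ s : Fin m × Fin 3, if s.1 = j then T.sideScalar (Pi.mulSingle i g) s else 1 := by
    rw [Fintype.prod_prod_type, Finset.prod_eq_single j]
    · simp [faceProd_apply]
    · intro k _ hk; simp [hk]
    · simp
  rw [h1, ← T.side.prod_comp, Fintype.prod_prod_type, Finset.prod_eq_single i]
  · simp only [Fintype.prod_bool, sideScalar_true, sideScalar_false, Pi.mulSingle_eq_same,
      Pi.mul_apply, Pi.inv_apply, Pi.mulSingle_apply, eq_comm (a := j)]
    rw [mul_comm]
    congr 1
    split_ifs <;> simp
  · intro k _ hk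
    simp [Pi.mulSingle_eq_of_ne hk]
  · simp

/-- The image of the boundary map contains the element equal to `g` at one face and to `g⁻¹` at
another when the faces are adjacent, hence for any two faces by connectedness. Such elements
generate the functions of total product 1. -/
theorem exists_faceProd_eq (f : Fin m → G) (hf : ∏ j, f j = 1) : ∃ e, T.faceProd e = f := by
  classical
  change f ∈ T.faceProd.range
  have h1 : ∀ (i : Fin n) (b : Bool) (g : G), (Pi.mulSingle (T.side (i, b)).1 g *
      (Pi.mulSingle (T.side (i, !b)).1 g)⁻¹ : Fin m → G) ∈ T.faceProd.range := by
    intro i b g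
    cases b
    · exact ⟨_, T.faceProd_mulSingle i g⟩
    · have h := inv_mem (MonoidHom.mem_range.2 ⟨_, T.faceProd_mulSingle i g⟩)
      convert h using 1
      simp
  have h2 : ∀ (j k : Fin m) (g : G),
      (Pi.mulSingle j g * (Pi.mulSingle k g)⁻¹ : Fin m → G) ∈ T.faceProd.range := by
    intro j k g
    induction T.connected j k with
    | refl => simp
    | tail _ h ih =>
      obtain ⟨i, b, rfl, rfl⟩ := h
      convert mul_mem ih (h1 i b g) using 1
      simp
  rcases m with - | m
  · rw [Subsingleton.elim f 1]; exact one_mem _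
  -- The face `0` is the reference; the factors concentrated there multiply to the inverse of `∏ j,
  -- f j`, which is 1.
  have h3 : f = ∏ j, (Pi.mulSingle j (f j) * (Pi.mulSingle 0 (f j))⁻¹ : Fin (m + 1) → G) := by
    rw [Finset.prod_mul_distrib, Finset.univ_prod_mulSingle, Finset.prod_inv_distrib]
    have : ∏ j, (Pi.mulSingle 0 (f j) : Fin (m + 1) → G) = Pi.mulSingle 0 (∏ j, f j) :=
      (map_prod (MonoidHom.mulSingle (fun _ : Fin (m + 1) => G) 0) f Finset.univ).symm
    rw [this, hf]
    simp
  rw [h3]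
  exact prod_mem fun j _ => h2 j 0 (f j)

/-- Scalars on the sides and on the faces with the same products along the edges, and with the same
total product, differ by a modification of the scalars on the sides. -/
theorem exists_sideScalar {N : ℕ} [NeZero N] {y y' : Fin m × Fin 3 → ℂˣ} {h h' : Fin m → ℂˣ}
    (hy : ∀ i, y (T.side (i, false)) * y (T.side (i, true)) =
      y' (T.side (i, false)) * y' (T.side (i, true)))
    (hh : ∏ j, h j = ∏ j, h' j) (hyh : ∀ j, h j ^ N = ∏ k, y (j, k))
    (hyh' : ∀ j, h' j ^ N = ∏ k, y' (j, k)) :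
    ∃ e : Fin n → ℂˣ, (∀ s, T.sideScalar e s ^ N * y s = y' s) ∧
      ∀ j, T.faceProd e j * h j = h' j := by
  -- An `N`-th root of the ratio of `y'` to `y` on the first side of each edge. It also corrects the
  -- second side, because the products along the edge agree.
  choose e he using fun i => exists_units_pow_eq (N := N)
    (y' (T.side (i, false)) * (y (T.side (i, false)))⁻¹)
  have he' : ∀ s, T.sideScalar e s ^ N * y s = y' s := by
    intro s
    obtain ⟨⟨i, b⟩, rfl⟩ := T.side.surjective s
    cases b
    · rw [sideScalar_false, he, inv_mul_cancel_right]
    · rw [sideScalar_true, inv_pow, he, mul_inv_rev, inv_inv, mul_right_comm, hy,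
        mul_right_comm, mul_inv_cancel, one_mul]
  have hprod : ∀ e : Fin n → ℂˣ, ∏ j, T.faceProd e j = 1 := by
    intro e
    simp only [faceProd_apply]
    rw [← Fintype.prod_prod_type (f := fun s => T.sideScalar e s), ← T.side.prod_comp,
      Fintype.prod_prod_type]
    simp
  -- What remains to be corrected on the faces is valued in the `N`-th roots of unity, since both
  -- numbers have `N`-th power `∏ k, y' (j, k)`.
  set f : Fin m → ℂˣ := fun j => h' j * (T.faceProd e j * h j)⁻¹ with hf
  have hfN : ∀ j, f j ∈ rootsOfUnity N ℂ := by
    intro j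
    have : (T.faceProd e j * h j) ^ N = h' j ^ N := by
      rw [mul_pow, hyh, hyh', faceProd_apply, ← Finset.prod_pow, ← Finset.prod_mul_distrib]
      exact Finset.prod_congr rfl fun k _ => he' _
    rw [mem_rootsOfUnity, hf, mul_pow, inv_pow, this, mul_inv_cancel]
  -- Solving in the group of `N`-th roots of unity, and not in `ℂˣ`, keeps the `N`-th powers on the
  -- sides unchanged.
  obtain ⟨r, hr⟩ := T.exists_faceProd_eq (G := rootsOfUnity N ℂ) (fun j => ⟨f j, hfN j⟩) (by
    apply Subtype.ext
    rw [Subgroup.val_finsetProd, Subgroup.coe_one]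
    simp only [hf]
    rw [Finset.prod_mul_distrib, Finset.prod_inv_distrib, Finset.prod_mul_distrib, hprod, one_mul,
      hh, mul_inv_cancel])
  have hs : ∀ s, T.sideScalar (fun i => (r i : ℂˣ)) s = ((T.sideScalar r s : rootsOfUnity N ℂ) : ℂˣ) := by
    intro s
    unfold sideScalar
    split_ifs <;> simp
  have hmul : ∀ s, T.sideScalar (e * fun i => (r i : ℂˣ)) s =
      T.sideScalar e s * ((T.sideScalar r s : rootsOfUnity N ℂ) : ℂˣ) := by
    intro s
    rw [← hs]
    unfold sideScalar
    split_ifs <;> simp [mul_comm]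
  refine ⟨e * fun i => (r i : ℂˣ), fun s => ?_, fun j => ?_⟩
  · rw [hmul, mul_pow, (mem_rootsOfUnity _ _).1 (T.sideScalar r s).2, mul_one, he']
  · have h1 : T.faceProd (fun i => (r i : ℂˣ)) j = f j := by
      have h2 := congrArg Subtype.val (congrFun hr j)
      rw [faceProd_apply, Subgroup.val_finsetProd] at h2
      refine Eq.trans ?_ h2
      rw [faceProd_apply]
      exact Finset.prod_congr rfl fun k _ => hs _
    rw [map_mul, Pi.mul_apply, h1, hf]
    simp only
    rw [mul_comm, mul_comm (T.faceProd e j), mul_inv_rev]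
    simp [mul_assoc]

end IdealTriangulation

end SideScalar

/-! ### Classification of local representations by their scalars -/

section LocalClassification

variable {m n N : ℕ} {q : ℂˣ} {V V' : Fin m → Type u} [∀ j, AddCommGroup (V j)]
  [∀ j, Module ℂ (V j)] [∀ j, AddCommGroup (V' j)] [∀ j, Module ℂ (V' j)]

namespace IrrepFamily

variable (T : IdealTriangulation m n)

/-- The family obtained by multiplying the generators associated to the sides by scalars. -/
noncomputable def twist (φ : IrrepFamily q V) (e : Fin n → ℂˣ) : IrrepFamily q V :=
  ⟨fun j => (φ.1 j).comp (QuantumTorus.scale fun k => T.sideScalar e (j, k)),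
    fun j => (φ.2 j).comp (QuantumTorus.scale_surjective _)⟩

theorem equivalent_twist (φ : IrrepFamily q V) (e : Fin n → ℂˣ) :
    Equivalent T φ (φ.twist T e) := by
  have h : ∀ s, (φ.twist T e).side s = ((T.sideScalar e s : ℂˣ) : ℂ) • φ.side s := by
    intro s
    change φ.1 s.1 (QuantumTorus.scale _ _) = _
    rw [QuantumTorus.scale_X, map_smul]
    rfl
  intro i
  exact ⟨e i, by rw [h, IdealTriangulation.sideScalar_false],
    by rw [h, IdealTriangulation.sideScalar_true]⟩

theorem HasInvariants.twist {φ : IrrepFamily q V} {y : Fin m × Fin 3 → ℂˣ} {h : Fin m → ℂˣ}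
    (H : φ.HasInvariants N y h) (e : Fin n → ℂˣ) : (φ.twist T e).HasInvariants N
      (fun s => T.sideScalar e s ^ N * y s) (fun j => T.faceProd e j * h j) :=
  fun j => (H j).scale _

theorem HasInvariants.pow_eq (hqN : q ^ (N * N) = 1) {φ : IrrepFamily q V}
    {y : Fin m × Fin 3 → ℂˣ} {h : Fin m → ℂˣ} (H : φ.HasInvariants N y h) (j : Fin m) :
    h j ^ N = ∏ k, y (j, k) := by
  have := (φ.2 j).1
  exact (H j).pow_eq hqN

theorem HasInvariants.of_conj {φ : IrrepFamily q V} {φ' : IrrepFamily q V'}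
    {y : Fin m × Fin 3 → ℂˣ} {h : Fin m → ℂˣ} (H : φ.HasInvariants N y h)
    (hL : ∀ j, ∃ L : V' j ≃ₗ[ℂ] V j, ∀ X : TriangleAlgebra q,
      φ'.1 j X = L.symm.toLinearMap ∘ₗ φ.1 j X ∘ₗ L.toLinearMap) : φ'.HasInvariants N y h := by
  intro j
  obtain ⟨L, hL⟩ := hL j
  have h1 : ∀ X (c : ℂ), φ.1 j X = c • 1 → φ'.1 j X = c • 1 := by
    intro X c hc
    rw [hL, hc]
    ext v
    simp
  refine ⟨fun k => ?_, ?_⟩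
  · rw [← map_pow]
    exact h1 _ _ (by rw [map_pow]; exact (H j).1 k)
  · rw [← map_mul, ← map_mul]
    exact h1 _ _ (by rw [map_mul, map_mul]; exact (H j).2)

end IrrepFamily

namespace LocalRep

variable {T : IdealTriangulation m n}

/-- The scalars by which the `N`-th powers of the generators and the principal central element of
the Chekhov-Fock algebra act in a local representation. -/
def HasScalars (N : ℕ) (ρ : LocalRep q V T) (x : Fin n → ℂˣ) (h : ℂˣ) : Prop :=
  (∀ i, ρ.toAlgHom ((QuantumTorus.X q T.sigma i : T.ChekhovFock q) ^ N) = (x i : ℂ) • 1) ∧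
    ρ.toAlgHom (T.principal q) = (h : ℂ) • 1

theorem nontrivial_tensor (ρ : LocalRep q V T) : Nontrivial (⨂[ℂ] j, V j) := by
  obtain ⟨φ, rfl⟩ := Quotient.exists_rep ρ
  exact φ.nontrivial_tensor

theorem exists_hasScalars (hq : IsPrimitiveRoot ((q : ℂ) ^ 2) N) (hqN : q ^ (N * N) = 1)
    (ρ : LocalRep q V T) : ∃ x h, HasScalars N ρ x h := by
  obtain ⟨φ, rfl⟩ := Quotient.exists_rep ρ
  obtain ⟨y, h, H⟩ := φ.exists_hasInvariants hq
  obtain ⟨κ, hκ⟩ := T.exists_induced_principal q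
  exact ⟨_, _, fun i => φ.induced_X_pow T hqN H i, hκ φ H⟩

theorem HasScalars.unique {ρ : LocalRep q V T} {x x' : Fin n → ℂˣ} {h h' : ℂˣ}
    (H : HasScalars N ρ x h) (H' : HasScalars N ρ x' h') : x = x' ∧ h = h' := by
  have := ρ.nontrivial_tensor
  exact ⟨funext fun i => smul_one_injective ((H.1 i).symm.trans (H'.1 i)),
    smul_one_injective (H.2.symm.trans H'.2)⟩

theorem HasScalars.pow_eq (hqN : q ^ (N * N) = 1) {ρ : LocalRep q V T} {x : Fin n → ℂˣ} {h : ℂˣ}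
    (H : HasScalars N ρ x h) : h ^ N = ∏ i, x i := by
  obtain ⟨φ, rfl⟩ := Quotient.exists_rep ρ
  exact induced_principal_pow T hqN φ H.1 H.2

/-- The scalars of a local representation can be computed from any representing family, hence from
the families realizing the isomorphism, which have the same invariants on each face. -/
theorem HasScalars.of_isIso (hq : IsPrimitiveRoot ((q : ℂ) ^ 2) N) (hqN : q ^ (N * N) = 1)
    {ρ : LocalRep q V T} {ρ' : LocalRep q V' T} {x : Fin n → ℂˣ} {h : ℂˣ} (H : HasScalars N ρ x h)
    (hiso : ρ.IsIso ρ') : HasScalars N ρ' x h := by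
  obtain ⟨φ, φ', rfl, rfl, hL⟩ := hiso
  obtain ⟨y, k, Hφ⟩ := φ.exists_hasInvariants hq
  have Hφ' := Hφ.of_conj hL
  obtain ⟨κ, hκ⟩ := T.exists_induced_principal q
  obtain ⟨rfl, rfl⟩ := H.unique ⟨fun i => φ.induced_X_pow T hqN Hφ i, hκ φ Hφ⟩
  exact ⟨fun i => φ'.induced_X_pow T hqN Hφ' i, hκ φ' Hφ'⟩

/-- Equality of the scalars says that the invariants of two representing families have the same
products along the edges and the same total product over the faces. A twist, which stays in the same
local representation, then makes the invariants equal on each face. -/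
theorem HasScalars.isIso [NeZero N] (hq : IsPrimitiveRoot ((q : ℂ) ^ 2) N) (hqN : q ^ (N * N) = 1)
    {ρ : LocalRep q V T} {ρ' : LocalRep q V' T} {x : Fin n → ℂˣ} {h : ℂˣ} (H : HasScalars N ρ x h)
    (H' : HasScalars N ρ' x h) : ρ.IsIso ρ' := by
  obtain ⟨φ, rfl⟩ := Quotient.exists_rep ρ
  obtain ⟨φ', rfl⟩ := Quotient.exists_rep ρ'
  obtain ⟨y, k, Hφ⟩ := φ.exists_hasInvariants hq
  obtain ⟨y', k', Hφ'⟩ := φ'.exists_hasInvariants hq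
  obtain ⟨κ, hκ⟩ := T.exists_induced_principal q
  obtain ⟨hx, hh⟩ := H.unique ⟨fun i => φ.induced_X_pow T hqN Hφ i, hκ φ Hφ⟩
  obtain ⟨hx', hh'⟩ := H'.unique ⟨fun i => φ'.induced_X_pow T hqN Hφ' i, hκ φ' Hφ'⟩
  obtain ⟨e, he, he'⟩ := T.exists_sideScalar
    (fun i => (congrFun hx i).symm.trans (congrFun hx' i))
    (mul_left_cancel (hh.symm.trans hh')) (Hφ.pow_eq hqN) (Hφ'.pow_eq hqN)
  have Ht := Hφ.twist T e
  simp only [he, he'] at Ht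
  exact ⟨φ.twist T e, φ', Quotient.sound (φ.equivalent_twist T e), rfl, fun j =>
    (Ht j).exists_equiv hq ((φ.twist T e).2 j) (φ'.2 j) (Hφ' j)⟩

theorem exists_of_pow_eq [NeZero N] (hq : IsPrimitiveRoot ((q : ℂ) ^ 2) N) (hqN : q ^ (N * N) = 1)
    (o : Fin m) {x : Fin n → ℂˣ} {h : ℂˣ} (hx : h ^ N = ∏ i, x i) :
    ∃ ρ : LocalRep q (fun _ : Fin m => CyclicSpace.{u} N) T, HasScalars N ρ x h := by
  -- Any splitting of `x i` between the two sides of the edge would do; here the second side carries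
  -- it all.
  set y : Fin m × Fin 3 → ℂˣ := fun s =>
    if (T.side.symm s).2 then x (T.side.symm s).1 else 1 with hy
  have hyx : ∀ i, y (T.side (i, false)) * y (T.side (i, true)) = x i := fun i => by simp [hy]
  obtain ⟨κ, hκ⟩ := T.exists_induced_principal.{u} q
  have main : ∀ k : Fin m → ℂˣ, (∀ j, k j ^ N = ∏ l, y (j, l)) →
      ∃ ρ : LocalRep q (fun _ : Fin m => CyclicSpace.{u} N) T, HasScalars N ρ x (κ * ∏ j, k j) := by
    intro k hk
    choose φ hφ Hφ using fun j => exists_irreducible_hasTriangleInvariants.{u} hq hqN (hk j)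
    refine ⟨Quotient.mk _ ⟨φ, hφ⟩, fun i => ?_, hκ (y := y) (h := k) ⟨φ, hφ⟩ Hφ⟩
    rw [← hyx i]
    exact IrrepFamily.induced_X_pow T hqN ⟨φ, hφ⟩ (y := y) (h := k) Hφ i
  choose k hk using fun j => exists_units_pow_eq (N := N) (∏ l, y (j, l))
  obtain ⟨ρ, hρ⟩ := main k hk
  have h1 := hρ.pow_eq hqN
  -- Arbitrary roots `k` give a load with the right `N`-th power, so the error `c` is an `N`-th root
  -- of unity. It is absorbed in the single face `o`.
  set c := h * (κ * ∏ j, k j)⁻¹ with hc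
  have hcN : c ^ N = 1 := by rw [hc, mul_pow, inv_pow, hx, h1, mul_inv_cancel]
  obtain ⟨ρ', hρ'⟩ := main (Pi.mulSingle o c * k) (fun j => by
    rw [Pi.mul_apply, mul_pow, hk]
    by_cases hj : j = o
    · subst hj; rw [Pi.mulSingle_eq_same, hcN, one_mul]
    · rw [Pi.mulSingle_eq_of_ne hj, one_pow, one_mul])
  refine ⟨ρ', ?_⟩
  convert hρ' using 1
  simp only [Pi.mul_apply, Finset.prod_mul_distrib, Finset.prod_pi_mulSingle', Finset.mem_univ,
    if_true]
  rw [mul_left_comm, hc, inv_mul_cancel_right]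

end LocalRep

end LocalClassification

/-! ### Peripheral subgroups -/

namespace FreeGroup

variable {α : Type*}

theorem IsReduced.eq_of_mk_eq {A B : List (α × Bool)} (hA : IsReduced A) (hB : IsReduced B)
    (h : mk A = mk B) : A = B := by
  classical
  rw [← hA.reduce_eq, ← hB.reduce_eq]
  exact reduce.sound h

theorem IsReduced.concat_or {A : List (α × Bool)} (hA : IsReduced A) (x : α × Bool) :
    IsReduced (A ++ [x]) ∨ ∃ B, A = B ++ [(x.1, !x.2)] := by
  rcases List.eq_nil_or_concat A with rfl | ⟨B, z, rfl⟩
  · exact Or.inl IsReduced.singleton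
  · by_cases h : z.1 = x.1 → z.2 = x.2
    · left
      unfold IsReduced at *
      rw [List.isChain_append]
      refine ⟨hA, List.isChain_singleton x, ?_⟩
      simpa using h
    · right
      push Not at h
      obtain ⟨h1, h2⟩ := h
      refine ⟨B, ?_⟩
      rw [List.concat_eq_append, ← h1]
      congr 2
      exact Prod.ext rfl (by revert h2; cases z.2 <;> cases x.2 <;> simp)

theorem mk_concat_inv (B : List (α × Bool)) (x : α × Bool) :
    mk (B ++ [(x.1, !x.2)]) * mk [x] = mk B := by
  rw [← mul_mk, mul_assoc]
  have : mk [(x.1, !x.2)] = (mk [x])⁻¹ := by simp [inv_mk, invRev]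
  rw [this, inv_mul_cancel, mul_one]

/-- Each letter of `A` cancels at most one letter at the end, so at least `L.length - A.length`
initial letters of `L` survive the reduction. -/
theorem exists_isReduced_prefix {L : List (α × Bool)} (hL : IsReduced L) (A : List (α × Bool)) :
    ∃ D, IsReduced D ∧ mk D = mk (L ++ A) ∧ L.take (L.length - A.length) <+: D := by
  induction A using List.reverseRecOn with
  | nil => exact ⟨L, hL, by simp, by simp⟩
  | append_singleton A x ih =>
    obtain ⟨D, hD, hmk, hpre⟩ := ih
    rcases hD.concat_or x with h | ⟨B, rfl⟩
    · refine ⟨D ++ [x], h, ?_, ?_⟩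
      · rw [← mul_mk, hmk, mul_mk, List.append_assoc]
      · refine ((List.take_prefix_take_left (by simp; omega)).trans hpre).trans (List.prefix_append _ _)
    · refine ⟨B, hD.infix ⟨[], _, rfl⟩, ?_, ?_⟩
      · rw [← List.append_assoc, ← mul_mk (L₁ := L ++ A), ← hmk, mk_concat_inv]
      · rcases List.prefix_concat_iff.1 (by simpa using hpre) with h | h
        · have hB : B <+: L.take (L.length - A.length) := h ▸ List.prefix_append B _
          have hlen := congrArg List.length h
          simp only [List.length_take, List.length_append, List.length_singleton] at hlen
          refine List.prefix_of_prefix_length_le (List.take_prefix_take_left (by simp; omega)) hB ?_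
          simp only [List.length_take, List.length_append, List.length_singleton]
          omega
        · exact (List.take_prefix_take_left (by simp; omega)).trans h

end FreeGroup

namespace IdealTriangulation

variable {m n : ℕ} (T : IdealTriangulation m n) {o : Fin m}

theorem letter_eq_mk (s : Fin m × Fin 3) : T.letter s = FreeGroup.mk [T.side.symm s] := rfl

theorem opp_injective : Function.Injective T.opp :=
  Function.LeftInverse.injective (g := T.opp) opp_opp

theorem turn_injective : Function.Injective T.turn := by
  rintro ⟨j, k⟩ ⟨j', k'⟩ h
  have h1 : T.opp (j, k + 2) = T.opp (j', k' + 2) := by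
    have h2 := Prod.ext_iff.1 h
    exact Prod.ext h2.1 (add_right_cancel h2.2)
  have h3 := Prod.ext_iff.1 (T.opp_injective h1)
  exact Prod.ext h3.1 (add_right_cancel h3.2)

/-- The side through which one leaves an angular sector when turning around a puncture. -/
def exitSide (c : Fin m × Fin 3) : Fin m × Fin 3 := (c.1, c.2 + 2)

theorem exitSide_injective : Function.Injective (exitSide (m := m)) := by
  rintro ⟨j, k⟩ ⟨j', k'⟩ h
  have h3 := Prod.ext_iff.1 h
  exact Prod.ext h3.1 (add_right_cancel h3.2)

/-- Turning counterclockwise shifts by one from the side of entry to the side of exit, whereas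
turning clockwise shifts by two, as in `opp_exitSide`. This difference will tell the two directions
apart. -/
theorem exitSide_turn (c : Fin m × Fin 3) : exitSide (T.turn c) =
    ((T.opp (exitSide c)).1, (T.opp (exitSide c)).2 + 1) := by
  have : ∀ k : Fin 3, k + 2 + 2 = k + 1 := by decide
  simp only [exitSide, turn, this]

theorem opp_exitSide (c : Fin m × Fin 3) : T.opp (exitSide c) =
    ((exitSide (T.turn c)).1, (exitSide (T.turn c)).2 + 2) := by
  have : ∀ k : Fin 3, k + 1 + 2 = k := by decide
  rw [exitSide_turn, this]

/-- The letters recorded when turning `j` times around a puncture. -/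
def turnLetters (c : Fin m × Fin 3) (j : ℕ) : List (Fin n × Bool) :=
  (List.range j).map fun i => T.side.symm (exitSide (T.turn^[i] c))

/-- The homotopy class of the path that turns `j` times around a puncture. -/
def turnPath (c : Fin m × Fin 3) (j : ℕ) : FreeGroup (Fin n) := FreeGroup.mk (T.turnLetters c j)

theorem turnPath_zero (c : Fin m × Fin 3) : T.turnPath c 0 = 1 := rfl

theorem turnPath_succ (c : Fin m × Fin 3) (j : ℕ) :
    T.turnPath c (j + 1) = T.turnPath c j * T.letter (exitSide (T.turn^[j] c)) := by
  rw [turnPath, turnLetters, List.range_succ, List.map_append, ← FreeGroup.mul_mk]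
  rfl

theorem turnPath_add (c : Fin m × Fin 3) (i j : ℕ) :
    T.turnPath c (i + j) = T.turnPath c i * T.turnPath (T.turn^[i] c) j := by
  induction j with
  | zero => rw [add_zero, turnPath_zero, mul_one]
  | succ j ih =>
    rw [← add_assoc, turnPath_succ, ih, turnPath_succ, mul_assoc, ← Function.iterate_add_apply,
      add_comm j i]

theorem peripheralLoop_eq (c : Fin m × Fin 3) :
    T.peripheralLoop c = T.turnPath c (Function.minimalPeriod T.turn c) := by
  rw [peripheralLoop]
  induction Function.minimalPeriod T.turn c with
  | zero => rfl
  | succ j ih => rw [List.range_succ, List.map_append, List.prod_append, ih, turnPath_succ]; simp; rfl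

theorem turn_iterate_minimalPeriod (c : Fin m × Fin 3) :
    T.turn^[Function.minimalPeriod T.turn c] c = c := Function.iterate_minimalPeriod

theorem minimalPeriod_turn_pos (c : Fin m × Fin 3) : 0 < Function.minimalPeriod T.turn c :=
  Function.minimalPeriod_pos_of_mem_periodicPts (T.turn_injective.mem_periodicPts c)

/-- Both members are the path making one more turn than a full period, split after its first letter
or before its last one. -/
theorem peripheralLoop_turn (c : Fin m × Fin 3) : T.letter (exitSide c) *
    T.peripheralLoop (T.turn c) = T.peripheralLoop c * T.letter (exitSide c) := by
  rw [peripheralLoop_eq, peripheralLoop_eq, Function.minimalPeriod_apply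
    (T.turn_injective.mem_periodicPts c)]
  have h1 := T.turnPath_succ c (Function.minimalPeriod T.turn c)
  rw [turn_iterate_minimalPeriod, add_comm, turnPath_add, turnPath_succ, turnPath_zero,
    one_mul] at h1
  exact h1

theorem peripheralLoop_pow (c : Fin m × Fin 3) (M : ℕ) :
    T.peripheralLoop c ^ M = T.turnPath c (M * Function.minimalPeriod T.turn c) := by
  induction M with
  | zero => rw [pow_zero, zero_mul, turnPath_zero]
  | succ M ih =>
    have : T.turn^[M * Function.minimalPeriod T.turn c] c = c :=
      (Function.isPeriodicPt_minimalPeriod T.turn c).const_mul M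
    rw [pow_succ, ih, add_mul, one_mul, turnPath_add, this, peripheralLoop_eq]

theorem isPath_turnPath (c : Fin m × Fin 3) (j : ℕ) :
    T.IsPath c.1 (T.turn^[j] c).1 (T.turnPath c j) := by
  induction j with
  | zero => exact IsPath.refl
  | succ j ih =>
    rw [turnPath_succ, Function.iterate_succ_apply']
    exact IsPath.cross (exitSide (T.turn^[j] c)) _ ih

variable {T}

theorem LiftedFace.ext {F F' : T.LiftedFace o} (h1 : F.face = F'.face) (h2 : F.word = F'.word) :
    F = F' := Subtype.ext (Prod.ext h1 h2)

theorem LiftedFace.neighbor_neighbor (F : T.LiftedFace o) (k : Fin 3) :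
    (F.neighbor k).neighbor (T.opp (F.face, k)).2 = F := by
  have h : T.opp ((F.neighbor k).face, (T.opp (F.face, k)).2) = (F.face, k) := opp_opp (F.face, k)
  refine LiftedFace.ext ?_ ?_
  · change (T.opp ((F.neighbor k).face, (T.opp (F.face, k)).2)).1 = _
    rw [h]
  · change F.word * T.letter (F.face, k) * T.letter (T.opp (F.face, k)) = _
    rw [letter_opp, mul_inv_cancel_right]

/-- Turning counterclockwise around a vertex of the universal cover, from a face to the next. -/
def turnLift (P : T.LiftedFace o × Fin 3) : T.LiftedFace o × Fin 3 :=
  (P.1.neighbor (P.2 + 2), (T.opp (P.1.face, P.2 + 2)).2 + 2)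

/-- The angular sector of which a face of the universal cover with a vertex is a lift. -/
def corner (P : T.LiftedFace o × Fin 3) : Fin m × Fin 3 := (P.1.face, P.2)

theorem corner_turnLift (P : T.LiftedFace o × Fin 3) : corner (turnLift P) = T.turn (corner P) :=
  rfl

theorem corner_turnLift_iterate (P : T.LiftedFace o × Fin 3) (j : ℕ) :
    corner (turnLift^[j] P) = T.turn^[j] (corner P) := by
  induction j with
  | zero => rfl
  | succ j ih => rw [Function.iterate_succ_apply', Function.iterate_succ_apply', corner_turnLift, ih]

theorem word_turnLift_iterate (P : T.LiftedFace o × Fin 3) (j : ℕ) :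
    (turnLift^[j] P).1.word = P.1.word * T.turnPath (corner P) j := by
  induction j with
  | zero => rw [turnPath_zero, mul_one]; rfl
  | succ j ih =>
    rw [Function.iterate_succ_apply', turnPath_succ, ← mul_assoc, ← ih, ← corner_turnLift_iterate]
    rfl

theorem corner_ext {P P' : T.LiftedFace o × Fin 3} (h1 : corner P = corner P')
    (h2 : P.1.word = P'.1.word) : P = P' :=
  Prod.ext (LiftedFace.ext (Prod.ext_iff.1 h1).1 h2) (Prod.ext_iff.1 h1).2

/-- The peripheral loops at consecutive sectors are conjugate by the letter that is crossed, so a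
peripheral subgroup depends only on the vertex of the universal cover. -/
theorem peripheral_turnLift (P : T.LiftedFace o × Fin 3) :
    (turnLift P).1.peripheral (turnLift P).2 = P.1.peripheral P.2 := by
  have h : (turnLift P).1.word * T.peripheralLoop (corner (turnLift P)) * (turnLift P).1.word⁻¹ =
      P.1.word * T.peripheralLoop (corner P) * P.1.word⁻¹ := by
    change P.1.word * T.letter (exitSide (corner P)) * _ * (P.1.word * T.letter _)⁻¹ = _
    rw [corner_turnLift, mul_assoc P.1.word, peripheralLoop_turn, mul_inv_rev]
    simp only [mul_assoc]
    congr 2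
    exact mul_inv_cancel_left _ _
  unfold LiftedFace.peripheral
  exact congrArg (fun g => (Subgroup.zpowers g).subgroupOf (T.piOne o)) h

theorem vertexGroup_eq {F F' : T.LiftedFace o} {k k' : Fin 3}
    (h : F.peripheral k = F'.peripheral k') : F.vertexGroup k = F'.vertexGroup k' :=
  Subtype.ext h

/-- The first end point of the side of a face is the second one for the adjacent face. -/
theorem vertexGroup_neighbor_add_two (F : T.LiftedFace o) (k : Fin 3) :
    (F.neighbor k).vertexGroup ((T.opp (F.face, k)).2 + 2) = F.vertexGroup (k + 1) := by
  have h3 : k + 1 + 2 = k := by revert k; decide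
  have h := peripheral_turnLift (F, k + 1)
  refine vertexGroup_eq ?_
  simpa only [turnLift, h3] using h

theorem vertexGroup_neighbor_add_one (F : T.LiftedFace o) (k : Fin 3) :
    (F.neighbor k).vertexGroup ((T.opp (F.face, k)).2 + 1) = F.vertexGroup (k + 2) := by
  have h := vertexGroup_neighbor_add_two (F.neighbor k) (T.opp (F.face, k)).2
  have h1 : T.opp ((F.neighbor k).face, (T.opp (F.face, k)).2) = (F.face, k) := opp_opp (F.face, k)
  rw [LiftedFace.neighbor_neighbor, h1] at h
  exact h.symm

theorem LiftedFace.isPath_loop (F : T.LiftedFace o) (k : Fin 3) :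
    F.word * T.peripheralLoop (F.face, k) * F.word⁻¹ ∈ T.piOne o := by
  have h := T.isPath_turnPath (F.face, k) (Function.minimalPeriod T.turn (F.face, k))
  rw [turn_iterate_minimalPeriod, ← peripheralLoop_eq] at h
  exact (IsPath.trans F.2 h).trans (IsPath.symm F.2)

end IdealTriangulation

/-! ### Reduced words, and the vertex determined by a peripheral subgroup -/

namespace IdealTriangulation

variable {m n : ℕ} (T : IdealTriangulation m n) {o : Fin m}

theorem length_turnLetters (c : Fin m × Fin 3) (j : ℕ) : (T.turnLetters c j).length = j := by
  simp [turnLetters]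

theorem getElem_turnLetters (c : Fin m × Fin 3) (j i : ℕ) (h : i < (T.turnLetters c j).length) :
    (T.turnLetters c j)[i] = T.side.symm (exitSide (T.turn^[i] c)) := by
  simp [turnLetters]

theorem symm_opp (s : Fin m × Fin 3) :
    T.side.symm (T.opp s) = ((T.side.symm s).1, !(T.side.symm s).2) := by
  simp [opp]

theorem exitSide_turn_ne (c : Fin m × Fin 3) : exitSide (T.turn c) ≠ T.opp (exitSide c) := by
  intro h
  have h1 := congrArg Prod.snd h
  rw [exitSide_turn] at h1
  exact absurd h1 ((by decide : ∀ k : Fin 3, k + 1 ≠ k) _)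

/-- The side of exit differs from the side of entry, so a path turning around a puncture never
backtracks. -/
theorem isReduced_turnLetters (c : Fin m × Fin 3) (j : ℕ) :
    FreeGroup.IsReduced (T.turnLetters c j) := by
  unfold FreeGroup.IsReduced
  rw [List.isChain_iff_getElem]
  intro i hi h1
  rw [getElem_turnLetters, getElem_turnLetters] at *
  by_contra h2
  apply T.exitSide_turn_ne (T.turn^[i] c)
  apply T.side.symm.injective
  rw [symm_opp, ← Function.iterate_succ_apply' T.turn]
  refine Prod.ext h1.symm ?_
  revert h2
  generalize (T.side.symm (exitSide (T.turn^[i + 1] c))).2 = a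
  generalize (T.side.symm (exitSide (T.turn^[i] c))).2 = b
  cases a <;> cases b <;> simp

/-- After turning enough around a puncture, a path can be represented by a reduced word that stays
reduced when one keeps turning. -/
theorem exists_turnPath_isReduced (A : List (Fin n × Bool)) (hA : FreeGroup.IsReduced A)
    (c : Fin m × Fin 3) : ∃ (j : ℕ) (B : List (Fin n × Bool)),
      FreeGroup.mk A * T.turnPath c j = FreeGroup.mk B ∧
      ∀ i, FreeGroup.IsReduced (B ++ T.turnLetters (T.turn^[j] c) i) := by
  induction hl : A.length generalizing A c with
  | zero =>
    obtain rfl := List.length_eq_zero_iff.1 hl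
    exact ⟨0, [], by rw [turnPath_zero, mul_one], fun i => T.isReduced_turnLetters _ _⟩
  | succ l ih =>
    -- If the first turning letter does not cancel, then no later one does. Otherwise it shortens
    -- `A`, and the induction on the length continues from the next sector.
    rcases hA.concat_or (T.side.symm (exitSide c)) with h | ⟨B, rfl⟩
    · refine ⟨0, A, by rw [turnPath_zero, mul_one], fun i => ?_⟩
      rcases i with - | i
      · simpa [turnLetters] using hA
      · have h1 : T.turnLetters c (i + 1) = [T.side.symm (exitSide c)] ++
            (T.turnLetters c (i + 1)).tail := by
          rw [turnLetters, List.range_succ_eq_map]; rfl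
        rw [Function.iterate_zero_apply, h1, ← List.append_assoc]
        exact h.append_overlap (h1 ▸ T.isReduced_turnLetters c (i + 1)) (by simp)
    · obtain ⟨j, C, h1, h2⟩ := ih B (hA.infix ⟨[], _, rfl⟩) (T.turn c) (by simpa using hl)
      refine ⟨j + 1, C, ?_, h2⟩
      have h3 : T.turnPath c (j + 1) = T.letter (exitSide c) * T.turnPath (T.turn c) j := by
        rw [add_comm, turnPath_add, turnPath_succ, turnPath_zero, one_mul]; rfl
      rw [h3, ← mul_assoc, ← h1, letter_eq_mk, FreeGroup.mk_concat_inv]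

variable {T}

/-- Peripheral loops have infinite order because their positive powers are nonempty reduced words.
-/
theorem peripheralLoop_pow_ne_one (c : Fin m × Fin 3) {M : ℕ} (hM : 0 < M) :
    T.peripheralLoop c ^ M ≠ 1 := by
  rw [peripheralLoop_pow, turnPath]
  intro h
  have h1 := congrArg List.length
    ((T.isReduced_turnLetters c _).eq_of_mk_eq (B := []) FreeGroup.IsReduced.nil h)
  rw [length_turnLetters] at h1
  exact absurd h1 (mul_pos hM (T.minimalPeriod_turn_pos c)).ne'

/-- Let `g` be the class of `B`, and let `ℓ`, `ℓ'` be the peripheral loops at the two corners. The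
hypothesis `hb` gives `g * ℓ ^ M = (ℓ' ^ b) ^ M * g`. The left side is the reduced word `B` followed
by turns from `P`; for large `M`, the right side begins with a long stretch of turns from `P'`,
counterclockwise if `b > 0` and clockwise if `b < 0`. In the first case `B` itself consists of turns
from `P'` and ends at `P`; the second case contradicts the direction of the turns that follow `B`.
-/
theorem exists_turnLift_eq_of_pow (P P' : T.LiftedFace o × Fin 3) {B : List (Fin n × Bool)}
    (hB : P'.1.word⁻¹ * P.1.word = FreeGroup.mk B)
    (hred : ∀ i, FreeGroup.IsReduced (B ++ T.turnLetters (corner P) i)) {b : ℤ}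
    (hb : P'.1.word⁻¹ * P.1.word * T.peripheralLoop (corner P) * (P'.1.word⁻¹ * P.1.word)⁻¹ =
      T.peripheralLoop (corner P') ^ b) : ∃ i, turnLift^[i] P' = P := by
  set c := corner P with hc
  set c' := corner P' with hc'
  rw [hB] at hb
  have hpos := T.minimalPeriod_turn_pos c
  have hpos' := T.minimalPeriod_turn_pos c'
  set p := Function.minimalPeriod T.turn c with hp
  set p' := Function.minimalPeriod T.turn c' with hp'
  have hpow : ∀ M : ℕ, FreeGroup.mk (B ++ T.turnLetters c (M * p)) =
      (T.peripheralLoop c' ^ b) ^ M * FreeGroup.mk B := by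
    intro M
    rw [← hb, conj_pow, inv_mul_cancel_right, peripheralLoop_pow, turnPath, FreeGroup.mul_mk]
  have hM := hpow (2 * B.length + 2)
  -- At most `B.length` letters cancel on the right, so at least `B.length + 2` initial letters can
  -- be compared: those of `B` and the next two.
  set M := 2 * B.length + 2 with hMdef
  have hMp : M ≤ M * p := Nat.le_mul_of_pos_right _ hpos
  obtain ⟨d, rfl | rfl⟩ := Int.eq_nat_or_neg b
  · have hd : 0 < d := by
      rcases Nat.eq_zero_or_pos d with rfl | h
      · exfalso
        rw [Nat.cast_zero, zpow_zero, mul_inv_eq_one, mul_eq_left] at hb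
        exact peripheralLoop_pow_ne_one c one_pos (by rw [pow_one, hb])
      · exact h
    rw [zpow_natCast, ← pow_mul, peripheralLoop_pow, turnPath, FreeGroup.mul_mk] at hM
    set K := d * M * p' with hK
    have hKM : M ≤ K := by
      rw [hK, mul_right_comm]
      exact Nat.le_mul_of_pos_left _ (mul_pos hd hpos')
    obtain ⟨D, hD, hDmk, hpre⟩ :=
      FreeGroup.exists_isReduced_prefix (T.isReduced_turnLetters c' K) B
    have hDeq := (hred _).eq_of_mk_eq hD (hM.trans hDmk.symm)
    rw [length_turnLetters] at hpre
    have hget : ∀ i, i ≤ B.length → ∀ h : i < (B ++ T.turnLetters c (M * p)).length,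
        (B ++ T.turnLetters c (M * p))[i] = T.side.symm (exitSide (T.turn^[i] c')) := by
      intro i hi h
      have hi' : i < ((T.turnLetters c' K).take (K - B.length)).length := by
        rw [List.length_take, length_turnLetters]; omega
      have h1 := hpre.getElem hi'
      rw [List.getElem_take, getElem_turnLetters] at h1
      rw [h1]
      congr 1
    -- The comparison shows that `B` is a turning path from `P'`; the letter that follows `B`
    -- identifies the corner where it ends.
    have hBeq : B = T.turnLetters c' B.length := by
      refine List.ext_getElem (by rw [length_turnLetters]) fun i h1 h2 => ?_
      rw [getElem_turnLetters, ← hget i h1.le (by rw [List.length_append]; omega),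
        List.getElem_append_left h1]
    refine ⟨B.length, corner_ext ?_ ?_⟩
    · have h1 := hget B.length le_rfl (by rw [List.length_append, length_turnLetters]; omega)
      rw [List.getElem_append_right le_rfl, getElem_turnLetters] at h1
      rw [corner_turnLift_iterate, ← hc', ← hc]
      simpa using (exitSide_injective (T.side.symm.injective h1)).symm
    · rw [word_turnLift_iterate, ← hc', turnPath, ← hBeq, ← hB, mul_inv_cancel_left]
  · exfalso
    have hd : 0 < d := by
      rcases Nat.eq_zero_or_pos d with rfl | h
      · exfalso
        rw [Nat.cast_zero, neg_zero, zpow_zero, mul_inv_eq_one, mul_eq_left] at hb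
        exact peripheralLoop_pow_ne_one c one_pos (by rw [pow_one, hb])
      · exact h
    rw [zpow_neg, zpow_natCast, inv_pow, ← pow_mul, peripheralLoop_pow, turnPath,
      FreeGroup.inv_mk, FreeGroup.mul_mk] at hM
    set K := d * M * p' with hK
    have hKM : M ≤ K := by
      rw [hK, mul_right_comm]
      exact Nat.le_mul_of_pos_left _ (mul_pos hd hpos')
    have hrev : FreeGroup.IsReduced (FreeGroup.invRev (T.turnLetters c' K)) :=
      FreeGroup.isReduced_iff_reduce_eq.2 (by
        rw [FreeGroup.reduce_invRev, (T.isReduced_turnLetters c' K).reduce_eq])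
    obtain ⟨D, hD, hDmk, hpre⟩ := FreeGroup.exists_isReduced_prefix hrev B
    have hDeq := (hred _).eq_of_mk_eq hD (hM.trans hDmk.symm)
    rw [FreeGroup.invRev_length, length_turnLetters] at hpre
    have hget : ∀ i, i ≤ B.length + 1 → ∀ h : i < (B ++ T.turnLetters c (M * p)).length,
        (B ++ T.turnLetters c (M * p))[i] =
          T.side.symm (T.opp (exitSide (T.turn^[K - 1 - i] c'))) := by
      intro i hi h
      have hi' : i < ((FreeGroup.invRev (T.turnLetters c' K)).take (K - B.length)).length := by
        rw [List.length_take, FreeGroup.invRev_length, length_turnLetters]; omega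
      have h1 := hpre.getElem hi'
      rw [List.getElem_take] at h1
      simp only [FreeGroup.invRev, List.getElem_reverse, List.getElem_map, getElem_turnLetters,
        List.length_map, length_turnLetters] at h1
      rw [symm_opp, h1]
      congr 1
    have h0 := hget B.length (by omega) (by rw [List.length_append, length_turnLetters]; omega)
    have h1 := hget (B.length + 1) le_rfl (by rw [List.length_append, length_turnLetters]; omega)
    rw [List.getElem_append_right le_rfl, getElem_turnLetters] at h0
    rw [List.getElem_append_right (by omega), getElem_turnLetters] at h1
    replace h0 := T.side.symm.injective h0
    replace h1 := T.side.symm.injective h1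
    have e1 : B.length + 1 - B.length = 1 := by omega
    have e2 : K - 1 - B.length = (K - 1 - (B.length + 1)) + 1 := by omega
    rw [Nat.sub_self, Function.iterate_zero_apply, e2, Function.iterate_succ_apply'] at h0
    -- The two letters after `B` describe the crossing of one face, both as a counterclockwise turn,
    -- with shift 1, and as a clockwise turn, with shift 2.
    rw [e1, Function.iterate_one, opp_exitSide, exitSide_turn, h0, opp_opp] at h1
    have h2 := congrArg Prod.snd h1
    simp only at h2
    revert h2
    generalize (exitSide (T.turn (T.turn^[K - 1 - (B.length + 1)] c'))).2 = k
    revert k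
    decide

/-- Vertices of the universal cover with the same peripheral subgroup are equal. -/
theorem exists_turnLift_eq {P P' : T.LiftedFace o × Fin 3}
    (h : P.1.peripheral P.2 = P'.1.peripheral P'.2) : ∃ i j, turnLift^[i] P' = turnLift^[j] P := by
  -- Turning around the vertex of `P` first removes the cancellation between the word joining the
  -- two faces and the turns to come, without changing the peripheral subgroup.
  obtain ⟨j, B, hB, hred⟩ := T.exists_turnPath_isReduced (P'.1.word⁻¹ * P.1.word).toWord
    FreeGroup.isReduced_toWord (corner P)
  have hper : (turnLift^[j] P).1.peripheral (turnLift^[j] P).2 = P'.1.peripheral P'.2 := by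
    rw [← h]
    clear hB hred
    induction j with
    | zero => rfl
    | succ j ih => rw [Function.iterate_succ_apply', peripheral_turnLift, ih]
  set Q := turnLift^[j] P with hQ
  have hmem : (⟨_, Q.1.isPath_loop Q.2⟩ : T.piOne o) ∈ P'.1.peripheral P'.2 := by
    rw [← hper, LiftedFace.peripheral, Subgroup.mem_subgroupOf]
    exact Subgroup.mem_zpowers _
  rw [LiftedFace.peripheral, Subgroup.mem_subgroupOf, Subgroup.mem_zpowers_iff] at hmem
  obtain ⟨b, hb⟩ := hmem
  have hQw : P'.1.word⁻¹ * Q.1.word = FreeGroup.mk B := by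
    rw [hQ, word_turnLift_iterate, ← mul_assoc, ← hB, FreeGroup.mk_toWord]
  rw [← corner_turnLift_iterate, ← hQ] at hred
  obtain ⟨i, hi⟩ := exists_turnLift_eq_of_pow Q P' (b := b) hQw hred (by
    rw [conj_zpow] at hb
    simp only at hb
    rw [mul_inv_rev, inv_inv]
    have := congrArg (fun g => P'.1.word⁻¹ * g * P'.1.word) hb
    simp only [mul_assoc, inv_mul_cancel_left, inv_mul_cancel, mul_one] at this
    simp only [mul_assoc]
    exact this.symm)
  exact ⟨i, j, hi⟩

/-- A function on the vertices of the faces of the universal cover that is compatible with the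
adjacency of faces only depends on the peripheral subgroups. -/
theorem eq_of_peripheral_eq {α : Type*} {ν : T.LiftedFace o → Fin 3 → α}
    (hν : ∀ F k, ν (F.neighbor k) ((T.opp (F.face, k)).2 + 2) = ν F (k + 1))
    {F F' : T.LiftedFace o} {k k' : Fin 3} (h : F.peripheral k = F'.peripheral k') :
    ν F k = ν F' k' := by
  have hturn : ∀ (j : ℕ) (P : T.LiftedFace o × Fin 3),
      ν (turnLift^[j] P).1 (turnLift^[j] P).2 = ν P.1 P.2 := by
    intro j P
    induction j with
    | zero => rfl
    | succ j ih =>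
      have h3 : ∀ k : Fin 3, k + 2 + 1 = k := by decide
      rw [Function.iterate_succ_apply', ← ih]
      exact (hν _ _).trans (by rw [h3])
  obtain ⟨i, j, hij⟩ := exists_turnLift_eq (P := (F, k)) (P' := (F', k')) h
  have h1 := hturn j (F, k)
  rw [← hij, hturn i (F', k')] at h1
  exact h1.symm

end IdealTriangulation

/-! ### Equivariance of the geometry of hyperbolic 3-space -/

open Projectivization

namespace HyperbolicSpace

/-- The light-like vector of the Minkowski space defined by a nonzero vector of `ℂ²`. -/
noncomputable def lightVec (w : Fin 2 → ℂ) : Matrix (Fin 2) (Fin 2) ℂ :=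
  Matrix.vecMulVec w (star w)

theorem lightVec_smul (c : ℂ) (w : Fin 2 → ℂ) :
    lightVec (c • w) = (Complex.normSq c) • lightVec w := by
  ext i j
  simp only [lightVec, Matrix.vecMulVec_apply, Pi.smul_apply, Pi.star_apply, smul_eq_mul, star_mul',
    Matrix.smul_apply, Complex.real_smul, ← Complex.mul_conj]
  change _ * (starRingEnd ℂ c * _) = _
  ring

theorem lightVec_mulVec (g : Matrix (Fin 2) (Fin 2) ℂ) (w : Fin 2 → ℂ) :
    lightVec (g *ᵥ w) = g * lightVec w * gᴴ := by
  rw [lightVec, lightVec, Matrix.star_mulVec, Matrix.mul_vecMulVec, Matrix.vecMulVec_mul]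

/-- The loci and relations of the hyperboloid model are insensitive to positive rescalings of the
light vectors, so any representative of a point at infinity may be used in place of `rep`. -/
theorem light_mk (w : Fin 2 → ℂ) (hw : w ≠ 0) :
    ∃ c : ℝ, 0 < c ∧ light (mk ℂ w hw) = c • lightVec w := by
  obtain ⟨a, ha⟩ := exists_smul_eq_mk_rep ℂ w hw
  refine ⟨Complex.normSq a, Complex.normSq_pos.2 a.ne_zero, ?_⟩
  rw [light, ← ha]
  exact lightVec_smul a w

variable {a b z : Fin 2 → ℂ} {ha : a ≠ 0} {hb : b ≠ 0} {hz : z ≠ 0}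

theorem mem_geodesic_mk {P : HyperbolicSpace} : P ∈ geodesic (mk ℂ a ha) (mk ℂ b hb) ↔
    ∃ s t : ℝ, 0 ≤ s ∧ 0 ≤ t ∧ P.1 = s • lightVec a + t • lightVec b := by
  obtain ⟨c, hc, h1⟩ := light_mk a ha
  obtain ⟨d, hd, h2⟩ := light_mk b hb
  simp only [geodesic, Set.mem_ofPred_eq, h1, h2, smul_smul]
  constructor
  · rintro ⟨s, t, hs, ht, h⟩
    exact ⟨s * c, t * d, by positivity, by positivity, h⟩
  · rintro ⟨s, t, hs, ht, h⟩
    refine ⟨s / c, t / d, by positivity, by positivity, ?_⟩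
    rw [div_mul_cancel₀ _ hc.ne', div_mul_cancel₀ _ hd.ne', h]

theorem mem_idealTriangle_mk {v : Fin 3 → Fin 2 → ℂ} {hv : ∀ k, v k ≠ 0} {P : HyperbolicSpace} :
    P ∈ idealTriangle (fun k => mk ℂ (v k) (hv k)) ↔
      ∃ c : Fin 3 → ℝ, (∀ k, 0 ≤ c k) ∧ P.1 = ∑ k, c k • lightVec (v k) := by
  choose d hd h using fun k => light_mk (v k) (hv k)
  simp only [idealTriangle, Set.mem_ofPred_eq, h, smul_smul]
  constructor
  · rintro ⟨c, hc, h'⟩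
    exact ⟨fun k => c k * d k, fun k => mul_nonneg (hc k) (hd k).le, h'⟩
  · rintro ⟨c, hc, h'⟩
    refine ⟨fun k => c k / d k, fun k => div_nonneg (hc k) (hd k).le, ?_⟩
    simp only [div_mul_cancel₀ _ (hd _).ne']
    exact h'

theorem mem_halfPlane_mk {P : HyperbolicSpace} :
    P ∈ halfPlane (mk ℂ a ha) (mk ℂ b hb) (mk ℂ z hz) ↔
      ∃ s t u : ℝ, 0 ≤ u ∧ P.1 = s • lightVec a + t • lightVec b + u • lightVec z := by
  obtain ⟨c, hc, h1⟩ := light_mk a ha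
  obtain ⟨d, hd, h2⟩ := light_mk b hb
  obtain ⟨e, he, h3⟩ := light_mk z hz
  simp only [halfPlane, Set.mem_ofPred_eq, h1, h2, h3, smul_smul]
  constructor
  · rintro ⟨s, t, u, hu, h⟩
    exact ⟨s * c, t * d, u * e, by positivity, h⟩
  · rintro ⟨s, t, u, hu, h⟩
    refine ⟨s / c, t / d, u / e, by positivity, ?_⟩
    rw [div_mul_cancel₀ _ hc.ne', div_mul_cancel₀ _ hd.ne', div_mul_cancel₀ _ he.ne', h]

theorem isOrientedDist_mk {w w' : HyperbolicSpace} {t : ℝ} :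
    IsOrientedDist (mk ℂ a ha) (mk ℂ b hb) w w' t ↔
      ∃ s u : ℝ, 0 < s ∧ 0 < u ∧ w.1 = s • lightVec a + u • lightVec b ∧
        w'.1 = (Real.exp (-t) * s) • lightVec a + (Real.exp t * u) • lightVec b := by
  obtain ⟨c, hc, h1⟩ := light_mk a ha
  obtain ⟨d, hd, h2⟩ := light_mk b hb
  simp only [IsOrientedDist, h1, h2, smul_smul]
  constructor
  · rintro ⟨s, u, hs, hu, h, h'⟩
    exact ⟨s * c, u * d, by positivity, by positivity, h, by simpa only [mul_assoc] using h'⟩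
  · rintro ⟨s, u, hs, hu, h, h'⟩
    refine ⟨s / c, u / d, by positivity, by positivity, ?_, ?_⟩
    · rw [div_mul_cancel₀ _ hc.ne', div_mul_cancel₀ _ hd.ne', h]
    · rw [mul_assoc, mul_assoc, div_mul_cancel₀ _ hc.ne', div_mul_cancel₀ _ hd.ne', h']

theorem minkowski_smul_right (X Y : Matrix (Fin 2) (Fin 2) ℂ) (c : ℝ) :
    minkowski X (c • Y) = c * minkowski X Y := by
  simp only [minkowski, Matrix.trace_smul, Matrix.mul_smul, Complex.real_smul]
  rw [← Complex.re_ofReal_mul]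
  congr 1
  ring

theorem isProjection_mk {w : HyperbolicSpace} :
    IsProjection (mk ℂ a ha) (mk ℂ b hb) (mk ℂ z hz) w ↔
      ∃ s u : ℝ, 0 < s ∧ 0 < u ∧ w.1 = s • lightVec a + u • lightVec b ∧
        minkowski (u • lightVec b - s • lightVec a) (lightVec z) = 0 := by
  obtain ⟨c, hc, h1⟩ := light_mk a ha
  obtain ⟨d, hd, h2⟩ := light_mk b hb
  obtain ⟨e, he, h3⟩ := light_mk z hz
  simp only [IsProjection, h1, h2, h3, smul_smul, minkowski_smul_right, mul_eq_zero, he.ne',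
    false_or]
  constructor
  · rintro ⟨s, u, hs, hu, h, h'⟩
    exact ⟨s * c, u * d, by positivity, by positivity, h, h'⟩
  · rintro ⟨s, u, hs, hu, h, h'⟩
    refine ⟨s / c, u / d, by positivity, by positivity, ?_, ?_⟩
    · rw [div_mul_cancel₀ _ hc.ne', div_mul_cancel₀ _ hd.ne', h]
    · rw [div_mul_cancel₀ _ hc.ne', div_mul_cancel₀ _ hd.ne', h']

theorem isRotation_mk {φ : ℝ} {g : SL(2, ℂ)} :
    IsRotation (mk ℂ a ha) (mk ℂ b hb) φ g ↔
      g.1 *ᵥ a = Complex.exp (-(φ * Complex.I) / 2) • a ∧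
        g.1 *ᵥ b = Complex.exp (φ * Complex.I / 2) • b := by
  have key : ∀ (w : Fin 2 → ℂ) (hw : w ≠ 0) (c : ℂ),
      g • (mk ℂ w hw).rep = c • (mk ℂ w hw).rep ↔ g.1 *ᵥ w = c • w := by
    intro w hw c
    obtain ⟨d, hd⟩ := exists_smul_eq_mk_rep ℂ w hw
    rw [← hd]
    change g.1 *ᵥ (d • w) = _ ↔ _
    rw [Matrix.mulVec_smul, smul_comm c d]
    exact ⟨fun h => smul_left_cancel d h, fun h => congrArg _ h⟩
  rw [IsRotation, key, key]

theorem smul_mk (g : SL(2, ℂ)) (w : Fin 2 → ℂ) (hw : w ≠ 0) :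
    g • (mk ℂ w hw : SphereAtInfinity) = mk ℂ (g.1 *ᵥ w) ((smul_ne_zero_iff_ne g).2 hw) := rfl

/-- The linear isometry of the Minkowski space defined by an element of `SL₂(ℂ)`. -/
noncomputable def isometry (g : SL(2, ℂ)) :
    Matrix (Fin 2) (Fin 2) ℂ →ₗ[ℝ] Matrix (Fin 2) (Fin 2) ℂ where
  toFun X := g.1 * X * g.1ᴴ
  map_add' X Y := by rw [Matrix.mul_add, Matrix.add_mul]
  map_smul' c X := by rw [Matrix.mul_smul, Matrix.smul_mul]; rfl

theorem isometry_injective (g : SL(2, ℂ)) : Function.Injective (isometry g) := by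
  have hu : IsUnit g.1 := (Matrix.isUnit_iff_isUnit_det _).2 (by rw [g.2]; exact isUnit_one)
  intro X Y h
  exact hu.mul_left_cancel (((Matrix.isUnit_conjTranspose _).2 hu).mul_right_cancel h)

theorem lightVec_smul_vec (g : SL(2, ℂ)) (w : Fin 2 → ℂ) :
    lightVec (g.1 *ᵥ w) = isometry g (lightVec w) := lightVec_mulVec g.1 w

theorem coe_smul_eq (g : SL(2, ℂ)) (P : HyperbolicSpace) : (g • P).1 = isometry g P.1 := rfl

/-- `minkowski` is the polarization of the determinant, which `X ↦ g * X * gᴴ` multiplies by `det g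
* star (det g) = 1`. -/
theorem minkowski_isometry (g : SL(2, ℂ)) (X Y : Matrix (Fin 2) (Fin 2) ℂ) :
    minkowski (isometry g X) (isometry g Y) = minkowski X Y := by
  have h1 := g.2
  have h2 := congrArg star h1
  rw [Matrix.det_fin_two] at h1 h2
  simp only [star_sub, star_mul', star_one] at h2
  change minkowski (g.1 * X * g.1ᴴ) (g.1 * Y * g.1ᴴ) = _
  unfold minkowski
  congr 2
  simp only [Matrix.trace_fin_two, Matrix.mul_apply, Fin.sum_univ_two, Matrix.conjTranspose_apply]
  have key : (g.1 0 0 * g.1 1 1 - g.1 0 1 * g.1 1 0) *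
      (star (g.1 0 0) * star (g.1 1 1) - star (g.1 0 1) * star (g.1 1 0)) = 1 := by
    rw [h1, h2, one_mul]
  linear_combination ((X 0 0 + X 1 1) * (Y 0 0 + Y 1 1) - (X 0 0 * Y 0 0 + X 0 1 * Y 1 0 +
    (X 1 0 * Y 0 1 + X 1 1 * Y 1 1))) * key

theorem smul_mem_geodesic (g : SL(2, ℂ)) {a b : SphereAtInfinity} {P : HyperbolicSpace} :
    g • P ∈ geodesic (g • a) (g • b) ↔ P ∈ geodesic a b := by
  induction a using Projectivization.ind with | h a ha
  induction b using Projectivization.ind with | h b hb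
  rw [smul_mk, smul_mk, mem_geodesic_mk, mem_geodesic_mk]
  simp only [lightVec_smul_vec, coe_smul_eq, ← map_smul, ← map_add, (isometry_injective g).eq_iff]

theorem smul_mem_idealTriangle (g : SL(2, ℂ)) {a : Fin 3 → SphereAtInfinity}
    {P : HyperbolicSpace} : g • P ∈ idealTriangle (fun k => g • a k) ↔ P ∈ idealTriangle a := by
  obtain ⟨v, hv, rfl⟩ : ∃ (v : Fin 3 → Fin 2 → ℂ) (hv : ∀ k, v k ≠ 0),
      a = fun k => mk ℂ (v k) (hv k) :=
    ⟨fun k => (a k).rep, fun k => (a k).rep_nonzero, funext fun k => (mk_rep _).symm⟩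
  simp only [smul_mk]
  rw [mem_idealTriangle_mk, mem_idealTriangle_mk]
  simp only [lightVec_smul_vec, coe_smul_eq, ← map_smul, ← map_sum, (isometry_injective g).eq_iff]

theorem smul_mem_halfPlane (g : SL(2, ℂ)) {a b z : SphereAtInfinity} {P : HyperbolicSpace} :
    g • P ∈ halfPlane (g • a) (g • b) (g • z) ↔ P ∈ halfPlane a b z := by
  induction a using Projectivization.ind with | h a ha
  induction b using Projectivization.ind with | h b hb
  induction z using Projectivization.ind with | h z hz
  rw [smul_mk, smul_mk, smul_mk, mem_halfPlane_mk, mem_halfPlane_mk]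
  simp only [lightVec_smul_vec, coe_smul_eq, ← map_smul, ← map_add, (isometry_injective g).eq_iff]

theorem image_halfPlane (g : SL(2, ℂ)) (a b z : SphereAtInfinity) :
    (fun P => g • P) '' halfPlane a b z = halfPlane (g • a) (g • b) (g • z) := by
  ext P
  constructor
  · rintro ⟨Q, hQ, rfl⟩
    exact (smul_mem_halfPlane g).2 hQ
  · intro hP
    refine ⟨g⁻¹ • P, (smul_mem_halfPlane g).1 ?_, smul_inv_smul g P⟩
    rwa [smul_inv_smul]

theorem IsProjection.smul (g : SL(2, ℂ)) {a b z : SphereAtInfinity} {w : HyperbolicSpace}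
    (h : IsProjection a b z w) : IsProjection (g • a) (g • b) (g • z) (g • w) := by
  induction a using Projectivization.ind with | h a ha
  induction b using Projectivization.ind with | h b hb
  induction z using Projectivization.ind with | h z hz
  obtain ⟨s, u, hs, hu, h1, h2⟩ := isProjection_mk.1 h
  rw [smul_mk, smul_mk, smul_mk, isProjection_mk]
  simp only [lightVec_smul_vec, coe_smul_eq, h1, ← map_smul, ← map_add, ← map_sub]
  exact ⟨s, u, hs, hu, by rw [map_add, map_smul, map_smul], (minkowski_isometry g _ _).trans h2⟩

theorem IsOrientedDist.smul (g : SL(2, ℂ)) {a b : SphereAtInfinity} {w w' : HyperbolicSpace}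
    {t : ℝ} (h : IsOrientedDist a b w w' t) :
    IsOrientedDist (g • a) (g • b) (g • w) (g • w') t := by
  induction a using Projectivization.ind with | h a ha
  induction b using Projectivization.ind with | h b hb
  obtain ⟨s, u, hs, hu, h1, h2⟩ := isOrientedDist_mk.1 h
  rw [smul_mk, smul_mk, isOrientedDist_mk]
  simp only [lightVec_smul_vec, coe_smul_eq, h1, h2, ← map_smul, ← map_add]
  exact ⟨s, u, hs, hu, by simp only [map_add, map_smul], by simp only [map_add, map_smul]⟩

theorem IsRotation.conj (g : SL(2, ℂ)) {a b : SphereAtInfinity} {φ : ℝ} {h : SL(2, ℂ)}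
    (hh : IsRotation a b φ h) : IsRotation (g • a) (g • b) φ (g * h * g⁻¹) := by
  induction a using Projectivization.ind with | h a ha
  induction b using Projectivization.ind with | h b hb
  have key : ∀ (w : Fin 2 → ℂ) (c : ℂ), h.1 *ᵥ w = c • w →
      (g * h * g⁻¹).1 *ᵥ (g.1 *ᵥ w) = c • (g.1 *ᵥ w) := by
    intro w c hw
    have : (g * h * g⁻¹).1 * g.1 = g.1 * h.1 := by
      change ((g * h * g⁻¹) * g).1 = (g * h).1
      rw [inv_mul_cancel_right]
    rw [Matrix.mulVec_mulVec, this, ← Matrix.mulVec_mulVec, hw, Matrix.mulVec_smul]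
  obtain ⟨h1, h2⟩ := isRotation_mk.1 hh
  rw [smul_mk, smul_mk, isRotation_mk]
  exact ⟨key _ _ h1, key _ _ h2⟩

theorem IsShearBend.smul (g : SL(2, ℂ)) {a b z z' : SphereAtInfinity} {x : ℂ}
    (h : IsShearBend a b z z' x) : IsShearBend (g • a) (g • b) (g • z) (g • z') x := by
  obtain ⟨t, θ, ⟨w, w', h1, h2, h3⟩, ⟨k, h4, h5⟩, hx⟩ := h
  refine ⟨t, θ, ⟨g • w, g • w', h1.smul g, h2.smul g, h3.smul g⟩, ⟨g * k * g⁻¹, h4.conj g, ?_⟩, hx⟩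
  rw [← image_halfPlane, ← image_halfPlane, ← h5, Set.image_image, Set.image_image]
  simp only [mul_smul, inv_smul_smul]

theorem isShearBend_smul (g : SL(2, ℂ)) {a b z z' : SphereAtInfinity} {x : ℂ} :
    IsShearBend (g • a) (g • b) (g • z) (g • z') x ↔ IsShearBend a b z z' x := by
  refine ⟨fun h => ?_, IsShearBend.smul g⟩
  simpa only [inv_smul_smul] using h.smul g⁻¹

end HyperbolicSpace

/-! ### The shear-bend parameter in the standard position `0`, `∞`, `1`, `-y` -/

open Projectivization

namespace HyperbolicSpace

/-- The origin of hyperbolic 3-space. -/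
noncomputable def origin : HyperbolicSpace := ⟨1, Matrix.PosDef.one, Matrix.det_one⟩

theorem coe_smul_origin (g : SL(2, ℂ)) : (g • origin).1 = g.1 * g.1ᴴ := by
  rw [coe_smul]; exact congrArg (· * _) (mul_one _)

theorem lightVec_pair (p r : ℂ) : lightVec ![p, r] =
    !![p * star p, p * star r; r * star p, r * star r] := by
  ext i j
  fin_cases i <;> fin_cases j <;> simp [lightVec, Matrix.vecMulVec_apply]

theorem add_lightVec_std (s u : ℝ) : s • lightVec ![1, 0] + u • lightVec ![0, 1] =
    !![(s : ℂ), 0; 0, (u : ℂ)] := by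
  rw [lightVec_pair, lightVec_pair]
  ext i j
  fin_cases i <;> fin_cases j <;> simp

theorem conj_apply (P : HyperbolicSpace) (i j : Fin 2) : star (P.1 j i) = P.1 i j :=
  P.2.1.isHermitian.apply i j

theorem ofReal_re_diag (P : HyperbolicSpace) (i : Fin 2) : ((P.1 i i).re : ℂ) = P.1 i i :=
  Complex.conj_eq_iff_re.1 (conj_apply P i i)

theorem fst_ne_zero {r : ℂ} : ![1, r] ≠ 0 := fun h => one_ne_zero (congrFun h 0)

theorem snd_ne_zero {r : ℂ} : ![r, 1] ≠ 0 := fun h => one_ne_zero (congrFun h 1)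

/-- The free coefficients of the two light vectors at `0` and `∞` absorb the diagonal entries, so
membership only concerns the direction of the off-diagonal entry. -/
theorem mem_halfPlane_std {p r : ℂ} {h : ![p, r] ≠ 0} {P : HyperbolicSpace} :
    P ∈ halfPlane (mk ℂ ![1, 0] fst_ne_zero) (mk ℂ ![0, 1] snd_ne_zero) (mk ℂ ![p, r] h) ↔
      ∃ u : ℝ, 0 ≤ u ∧ P.1 0 1 = u * (p * star r) := by
  rw [mem_halfPlane_mk]
  simp only [lightVec_pair]
  constructor
  · rintro ⟨s, t, u, hu, h⟩
    exact ⟨u, hu, by rw [h]; simp⟩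
  · rintro ⟨u, hu, h⟩
    refine ⟨(P.1 0 0).re - u * Complex.normSq p, (P.1 1 1).re - u * Complex.normSq r, u, hu, ?_⟩
    have h' := congrArg star h
    rw [conj_apply] at h'
    ext i j
    fin_cases i <;> fin_cases j
    · simp [ofReal_re_diag, Complex.mul_conj]
    · simpa using h
    · simp [h', mul_comm]
    · simp [ofReal_re_diag, Complex.mul_conj]

theorem halfPlane_std_eq_iff {p r : ℂ} {h : ![p, r] ≠ 0} (hpr : p * star r ≠ 0) :
    halfPlane (mk ℂ ![1, 0] fst_ne_zero) (mk ℂ ![0, 1] snd_ne_zero) (mk ℂ ![p, r] h) =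
      halfPlane (mk ℂ ![1, 0] fst_ne_zero) (mk ℂ ![0, 1] snd_ne_zero)
        (mk ℂ ![1, 1] fst_ne_zero) ↔ ∃ c : ℝ, 0 < c ∧ p * star r = c := by
  constructor
  · intro heq
    -- The image of the origin by this unipotent matrix has off-diagonal entry `p * star r`: it is a
    -- point of the first half-plane off the boundary geodesic, which tests the equality.
    let g : SL(2, ℂ) := ⟨!![1, p * star r; 0, 1], by simp [Matrix.det_fin_two]⟩
    have hg : (g • origin).1 0 1 = p * star r := by
      rw [coe_smul_origin]
      simp [g, Matrix.mul_apply]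
    have h1 : g • origin ∈ halfPlane (mk ℂ ![1, 0] fst_ne_zero) (mk ℂ ![0, 1] snd_ne_zero)
        (mk ℂ ![p, r] h) := mem_halfPlane_std.2 ⟨1, zero_le_one, by rw [hg]; simp⟩
    rw [heq, mem_halfPlane_std, hg] at h1
    obtain ⟨u, hu, h1⟩ := h1
    rw [star_one, mul_one, mul_one] at h1
    refine ⟨u, lt_of_le_of_ne hu fun h0 => hpr ?_, h1⟩
    rw [h1, ← h0, Complex.ofReal_zero]
  · rintro ⟨c, hc, h⟩
    ext P
    rw [mem_halfPlane_std, mem_halfPlane_std, h]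
    simp only [star_one, mul_one]
    constructor
    · rintro ⟨u, hu, h'⟩
      exact ⟨u * c, by positivity, by rw [h']; push_cast; ring⟩
    · rintro ⟨u, hu, h'⟩
      refine ⟨u / c, by positivity, ?_⟩
      have : (c : ℂ) ≠ 0 := Complex.ofReal_ne_zero.2 hc.ne'
      rw [h']; push_cast; field_simp

theorem minkowski_std (s u : ℝ) (r : ℂ) :
    minkowski (u • lightVec ![0, 1] - s • lightVec ![1, 0]) (lightVec ![1, r]) =
      (u - s * Complex.normSq r) / 2 := by
  have : u • lightVec ![0, 1] - s • lightVec ![1, 0] = !![((-s : ℝ) : ℂ), 0; 0, (u : ℂ)] := by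
    rw [← add_lightVec_std, neg_smul]; abel
  rw [this, lightVec_pair, minkowski]
  simp only [Matrix.trace_fin_two, Matrix.mul_apply, Fin.sum_univ_two, Matrix.of_apply,
    Matrix.cons_val', Matrix.cons_val_zero, Matrix.cons_val_one]
  have h : r * starRingEnd ℂ r = (Complex.normSq r : ℂ) := Complex.mul_conj r
  rw [← Complex.ofReal_re ((u - s * Complex.normSq r) / 2)]
  congr 1
  simp
  linear_combination (-(s : ℂ)) * h

theorem IsProjection.std {r : ℂ} {w : HyperbolicSpace}
    (hw : IsProjection (mk ℂ ![1, 0] fst_ne_zero) (mk ℂ ![0, 1] snd_ne_zero)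
      (mk ℂ ![1, r] fst_ne_zero) w) : ∃ s : ℝ, 0 < s ∧ s * ‖r‖ = 1 ∧ w.1 = !![(s : ℂ), 0; 0, (‖r‖ : ℂ)] := by
  obtain ⟨s, u, hs, hu, h1, h2⟩ := isProjection_mk.1 hw
  rw [minkowski_std, Complex.normSq_eq_norm_sq] at h2
  rw [add_lightVec_std] at h1
  have h3 := w.2.2
  rw [h1, Matrix.det_fin_two] at h3
  have h4 : s * u = 1 := by
    have : ((s * u : ℝ) : ℂ) = 1 := by simpa using h3
    exact_mod_cast this
  -- The determinant gives `s * u = 1`, and orthogonality gives `u = s * ‖r‖ ^ 2`.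
  have h5 : s * ‖r‖ = 1 := by
    have h6 : (s * ‖r‖) ^ 2 = 1 := by nlinarith
    exact (pow_eq_one_iff_of_nonneg (by positivity) two_ne_zero).1 h6
  have h6 : u = ‖r‖ := mul_left_cancel₀ hs.ne' (h4.trans h5.symm)
  exact ⟨s, hs, h5, by rw [h1, h6]⟩

theorem exists_isProjection_std {r : ℂ} (hr : r ≠ 0) : ∃ w : HyperbolicSpace,
    w.1 = !![((‖r‖⁻¹ : ℝ) : ℂ), 0; 0, (‖r‖ : ℂ)] ∧
    IsProjection (mk ℂ ![1, 0] fst_ne_zero) (mk ℂ ![0, 1] snd_ne_zero)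
      (mk ℂ ![1, r] fst_ne_zero) w := by
  have hn : 0 < ‖r‖ := norm_pos_iff.2 hr
  have hsq : ((√‖r‖ : ℝ) : ℂ) * (√‖r‖ : ℝ) = (‖r‖ : ℂ) := by
    rw [← Complex.ofReal_mul, Real.mul_self_sqrt hn.le]
  have hs : ((√‖r‖ : ℝ) : ℂ) ≠ 0 := Complex.ofReal_ne_zero.2 (Real.sqrt_pos.2 hn).ne'
  let g : SL(2, ℂ) := ⟨!![((√‖r‖ : ℝ) : ℂ)⁻¹, 0; 0, ((√‖r‖ : ℝ) : ℂ)], by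
    simp [Matrix.det_fin_two, hs]⟩
  have h1 : (g • origin).1 = !![((‖r‖⁻¹ : ℝ) : ℂ), 0; 0, (‖r‖ : ℂ)] := by
    rw [coe_smul_origin]
    ext i j
    fin_cases i <;> fin_cases j <;> simp [g, Matrix.mul_apply, hsq, ← mul_inv]
  refine ⟨g • origin, h1, isProjection_mk.2 ⟨‖r‖⁻¹, ‖r‖, by positivity, hn, ?_, ?_⟩⟩
  · rw [h1, add_lightVec_std]
  · rw [minkowski_std, Complex.normSq_eq_norm_sq]
    field_simp
    ring

/-- The projections of `1` and `-y` to the geodesic from `0` to `∞` are the diagonal matrices with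
entries `1`, `1` and `‖y‖⁻¹`, `‖y‖`, so `exp t = ‖y‖`. The rotation by `π - θ` must send the
direction of `-y` to that of `1`, which means `y * exp (-i θ) > 0`. Together these give `exp (t + i
θ) = y`. -/
theorem isShearBend_std {y : ℂ} (hy : y ≠ 0) {x : ℂ} :
    IsShearBend (mk ℂ ![1, 0] fst_ne_zero) (mk ℂ ![0, 1] snd_ne_zero) (mk ℂ ![1, 1] fst_ne_zero)
      (mk ℂ ![1, -y] fst_ne_zero) x ↔ x = y := by
  have hn : 0 < ‖y‖ := norm_pos_iff.2 hy
  have hrot : ∀ (g : SL(2, ℂ)) (θ : ℝ),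
      IsRotation (mk ℂ ![1, 0] fst_ne_zero) (mk ℂ ![0, 1] snd_ne_zero) (Real.pi - θ) g →
      ((fun P => g • P) '' halfPlane (mk ℂ ![1, 0] fst_ne_zero) (mk ℂ ![0, 1] snd_ne_zero)
        (mk ℂ ![1, -y] fst_ne_zero) = halfPlane (mk ℂ ![1, 0] fst_ne_zero)
        (mk ℂ ![0, 1] snd_ne_zero) (mk ℂ ![1, 1] fst_ne_zero) ↔
        ‖y‖ * Complex.exp (θ * Complex.I) = y) := by
    intro g θ hg
    rw [isRotation_mk] at hg
    set ε := Complex.exp (((Real.pi - θ : ℝ) : ℂ) * Complex.I / 2) with hε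
    set ε' := Complex.exp (-(((Real.pi - θ : ℝ) : ℂ) * Complex.I) / 2) with hε'
    have hεε : star ε = ε' := by
      rw [hε, hε', Complex.star_def, ← Complex.exp_conj]
      congr 1
      rw [map_div₀, map_mul, Complex.conj_I, Complex.conj_ofReal, map_ofNat]
      ring
    have hsq : ε' * ε' = -Complex.exp (θ * Complex.I) := by
      rw [hε', ← Complex.exp_add, show -(((Real.pi - θ : ℝ) : ℂ) * Complex.I) / 2 +
        -(((Real.pi - θ : ℝ) : ℂ) * Complex.I) / 2 = -(Real.pi * Complex.I) + θ * Complex.I by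
          push_cast; ring, Complex.exp_add, Complex.exp_neg, Complex.exp_pi_mul_I]
      norm_num
    have h1 : g.1 *ᵥ ![1, -y] = ![ε', -y * ε] := by
      have : (![1, -y] : Fin 2 → ℂ) = ![1, 0] + (-y) • ![0, 1] := by
        ext i; fin_cases i <;> simp
      rw [this, Matrix.mulVec_add, Matrix.mulVec_smul, hg.1, hg.2]
      ext i; fin_cases i <;> simp
    have h2 : g • (mk ℂ ![1, 0] fst_ne_zero : SphereAtInfinity) = mk ℂ ![1, 0] fst_ne_zero := by
      rw [smul_mk]
      exact (mk_eq_mk_iff' ℂ _ _ _ _).2 ⟨_, hg.1.symm⟩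
    have h3 : g • (mk ℂ ![0, 1] snd_ne_zero : SphereAtInfinity) = mk ℂ ![0, 1] snd_ne_zero := by
      rw [smul_mk]
      exact (mk_eq_mk_iff' ℂ _ _ _ _).2 ⟨_, hg.2.symm⟩
    rw [image_halfPlane, h2, h3, smul_mk]
    simp only [h1]
    have h4 : ε' * star (-y * ε) = star y * Complex.exp (θ * Complex.I) := by
      rw [star_mul', star_neg, hεε]
      linear_combination (-star y) * hsq
    have h5 : y * star y = (‖y‖ : ℂ) ^ 2 := by
      rw [Complex.star_def, Complex.mul_conj, Complex.normSq_eq_norm_sq]; push_cast; rfl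
    rw [halfPlane_std_eq_iff (by
      rw [h4]; exact mul_ne_zero (star_ne_zero.2 hy) (Complex.exp_ne_zero _)), h4]
    constructor
    · rintro ⟨c, hc, h⟩
      have h6 : c = ‖y‖ := by
        have := congrArg norm h
        rw [norm_mul, norm_star, Complex.norm_exp_ofReal_mul_I, mul_one, Complex.norm_real,
          Real.norm_of_nonneg hc.le] at this
        exact this.symm
      rw [h6] at h
      have h7 : (‖y‖ : ℂ) ≠ 0 := Complex.ofReal_ne_zero.2 hn.ne'
      refine mul_left_cancel₀ h7 ?_
      linear_combination y * h - Complex.exp (θ * Complex.I) * h5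
    · intro h
      refine ⟨‖y‖, hn, ?_⟩
      have h7 : (‖y‖ : ℂ) ≠ 0 := Complex.ofReal_ne_zero.2 hn.ne'
      refine mul_left_cancel₀ h7 ?_
      linear_combination star y * h + h5
  constructor
  · rintro ⟨t, θ, ⟨w, w', h1, h2, h3⟩, ⟨g, hg, hg'⟩, rfl⟩
    obtain ⟨s, hs, h4, h5⟩ := h1.std
    obtain ⟨s', hs', h6, h7⟩ := h2.std
    obtain ⟨a, b, -, -, h8, h9⟩ := isOrientedDist_mk.1 h3
    rw [add_lightVec_std, h5] at h8
    rw [add_lightVec_std, h7] at h9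
    have h10 : (‖(1 : ℂ)‖ : ℂ) = b := by simpa using congrFun (congrFun h8 1) 1
    have h11 : (‖-y‖ : ℂ) = Real.exp t * b := by simpa using congrFun (congrFun h9 1) 1
    rw [← h10, norm_one, norm_neg] at h11
    rw [← (hrot g θ hg).1 hg', h11, Complex.exp_add]
    push_cast; ring
  · rintro rfl
    obtain ⟨w, hw, hp⟩ := exists_isProjection_std (one_ne_zero (α := ℂ))
    obtain ⟨w', hw', hp'⟩ := exists_isProjection_std (neg_ne_zero.2 hy)
    refine ⟨Real.log ‖x‖, x.arg, ⟨w, w', hp, hp', isOrientedDist_mk.2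
      ⟨1, 1, one_pos, one_pos, ?_, ?_⟩⟩, ?_, ?_⟩
    · rw [hw, add_lightVec_std]; simp
    · rw [hw', add_lightVec_std, Real.exp_neg, Real.exp_log hn]; simp
    · let φ : ℂ := ((Real.pi - x.arg : ℝ) : ℂ)
      let g : SL(2, ℂ) := ⟨!![Complex.exp (-(φ * Complex.I) / 2), 0;
        0, Complex.exp (φ * Complex.I / 2)], by
          rw [Matrix.det_fin_two]
          simp [← Complex.exp_add, neg_div]⟩
      have hg : IsRotation (mk ℂ ![1, 0] fst_ne_zero) (mk ℂ ![0, 1] snd_ne_zero)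
          (Real.pi - x.arg) g := by
        rw [isRotation_mk]
        constructor <;> ext i <;> fin_cases i <;> simp [g, φ, Matrix.mulVec, dotProduct]
      exact ⟨g, hg, (hrot g _ hg).2 (Complex.norm_mul_exp_arg_mul_I x)⟩
    · rw [Complex.exp_add, ← Complex.ofReal_exp, Real.exp_log hn, Complex.norm_mul_exp_arg_mul_I]

end HyperbolicSpace

/-! ### Frames of the sphere at infinity and the shear-bend parameter -/

open Projectivization

/-- The determinant of two vectors of `ℂ²`. -/
noncomputable def wedge (a b : Fin 2 → ℂ) : ℂ := a 0 * b 1 - a 1 * b 0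

theorem wedge_smul_left (c : ℂ) (a b : Fin 2 → ℂ) : wedge (c • a) b = c * wedge a b := by
  simp only [wedge, Pi.smul_apply, smul_eq_mul]; ring

theorem wedge_smul_right (c : ℂ) (a b : Fin 2 → ℂ) : wedge a (c • b) = c * wedge a b := by
  simp only [wedge, Pi.smul_apply, smul_eq_mul]; ring

/-- Cramer's rule in dimension 2. -/
theorem wedge_smul_eq (a b w : Fin 2 → ℂ) : wedge a b • w = wedge w b • a + wedge a w • b := by
  ext i
  fin_cases i <;> simp [wedge] <;> ring

theorem left_ne_zero_of_wedge {a b : Fin 2 → ℂ} (h : wedge a b ≠ 0) : a ≠ 0 := by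
  rintro rfl; simp [wedge] at h

theorem mk_eq_mk_of_smul {a b : Fin 2 → ℂ} (ha : a ≠ 0) (hb : b ≠ 0) (c : ℂ) (h : a = c • b) :
    (mk ℂ a ha : SphereAtInfinity) = mk ℂ b hb := (mk_eq_mk_iff' ℂ _ _ ha hb).2 ⟨c, h.symm⟩

theorem mk_eq_mk_iff_wedge {a b : Fin 2 → ℂ} (ha : a ≠ 0) (hb : b ≠ 0) :
    (mk ℂ a ha : SphereAtInfinity) = mk ℂ b hb ↔ wedge a b = 0 := by
  rw [mk_eq_mk_iff']
  constructor
  · rintro ⟨c, rfl⟩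
    simp only [wedge, Pi.smul_apply, smul_eq_mul]; ring
  · intro h
    unfold wedge at h
    by_cases h0 : b 0 = 0
    · have h1 : b 1 ≠ 0 := fun h1 => hb (by ext i; fin_cases i <;> simp [h0, h1])
      refine ⟨a 1 / b 1, ?_⟩
      ext i; fin_cases i
      · have : a 0 = 0 := by simpa [h0, h1] using h
        simp [h0, this]
      · simp [h1]
    · refine ⟨a 0 / b 0, ?_⟩
      ext i; fin_cases i
      · simp [h0]
      · simp only [Fin.mk_one, Pi.smul_apply, smul_eq_mul]
        field_simp
        linear_combination h

/-- Two independent vectors of `ℂ²` are, up to a factor, the columns of an element of `SL₂(ℂ)`. -/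
theorem exists_frame {a b : Fin 2 → ℂ} (h : wedge a b ≠ 0) :
    ∃ (g : SL(2, ℂ)) (d : ℂ), d ≠ 0 ∧ ∀ s t : ℂ, g.1 *ᵥ ![s, t] = d • (s • a + t • b) := by
  -- Dividing both columns by a square root of their determinant gives determinant 1.
  obtain ⟨d, hd⟩ := IsAlgClosed.exists_pow_nat_eq (wedge a b) two_pos
  have hd0 : d ≠ 0 := by rintro rfl; exact h (by rw [← hd]; simp)
  refine ⟨⟨!![d⁻¹ * a 0, d⁻¹ * b 0; d⁻¹ * a 1, d⁻¹ * b 1], ?_⟩, d⁻¹, inv_ne_zero hd0, ?_⟩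
  · rw [Matrix.det_fin_two]
    simp only [Matrix.of_apply, Matrix.cons_val', Matrix.cons_val_zero, Matrix.cons_val_one]
    unfold wedge at hd
    field_simp
    linear_combination -hd
  · intro s t
    ext i
    fin_cases i <;> simp [Matrix.mulVec, dotProduct] <;> ring

namespace HyperbolicSpace

/-- The normal form of a quadruple: once vectors over the end points are scaled so that `a + b` lies
over the third point, the fourth point is that of `a - y • b`, and `y` is minus a cross-ratio. A
frame moves this to the standard position. -/
theorem isShearBend_iff {a b : Fin 2 → ℂ} (h : wedge a b ≠ 0) {y : ℂ} (hy : y ≠ 0)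
    (ha : a ≠ 0) (hb : b ≠ 0) (hz : a + b ≠ 0) (hz' : a - y • b ≠ 0) {x : ℂ} :
    IsShearBend (mk ℂ a ha) (mk ℂ b hb) (mk ℂ (a + b) hz) (mk ℂ (a - y • b) hz') x ↔ x = y := by
  obtain ⟨g, d, hd, hg⟩ := exists_frame h
  have key : ∀ (s t : ℂ) (w : Fin 2 → ℂ) (hw : w ≠ 0) (hst : ![s, t] ≠ 0), w = s • a + t • b →
      (mk ℂ w hw : SphereAtInfinity) = g • mk ℂ ![s, t] hst := fun s t w hw hst h => by
    rw [HyperbolicSpace.smul_mk]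
    exact (mk_eq_mk_of_smul _ hw d (by rw [hg, h])).symm
  rw [key 1 0 a ha fst_ne_zero (by simp), key 0 1 b hb snd_ne_zero (by simp),
    key 1 1 _ hz fst_ne_zero (by simp), key 1 (-y) _ hz' fst_ne_zero (by simp [sub_eq_add_neg]),
    isShearBend_smul, isShearBend_std hy]

end HyperbolicSpace

/-- The points `0`, `∞`, `1` of the sphere at infinity, in coordinates with cyclic symmetry. -/
noncomputable def stdVec : Fin 3 → Fin 2 → ℂ := ![![1, 0], ![0, 1], ![-1, -1]]

theorem wedge_stdVec (k : Fin 3) : wedge (stdVec (k + 1)) (stdVec (k + 2)) = 1 := by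
  fin_cases k <;> simp [wedge, stdVec]

theorem wedge_stdVec' (k : Fin 3) : wedge (stdVec (k + 2)) (stdVec (k + 1)) = -1 := by
  rw [← wedge_stdVec k]; unfold wedge; ring

/-- The three vectors have sum zero, which makes all formulas invariant under cyclic permutation of
the sides. -/
theorem stdVec_eq (k : Fin 3) : stdVec k = (-1 : ℂ) • (stdVec (k + 2) + stdVec (k + 1)) := by
  fin_cases k <;> ext i <;> fin_cases i <;> simp [stdVec]

theorem stdVec_ne_zero (k : Fin 3) : stdVec k ≠ 0 := by
  have h := wedge_stdVec (k + 2)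
  rw [(by decide : ∀ k : Fin 3, k + 2 + 1 = k)] at h
  exact left_ne_zero_of_wedge (by rw [h]; exact one_ne_zero)

/-- The vertices of the standard ideal triangle. -/
noncomputable def stdVertex (k : Fin 3) : SphereAtInfinity := mk ℂ (stdVec k) (stdVec_ne_zero k)

theorem stdVertex_injective : Function.Injective stdVertex := by
  have h : ∀ k, stdVertex (k + 1) ≠ stdVertex (k + 2) := fun k h => by
    rw [stdVertex, stdVertex, mk_eq_mk_iff_wedge, wedge_stdVec] at h
    exact one_ne_zero h
  intro j k hjk
  by_contra hne
  have h1 : ∀ j : Fin 3, j + 1 + 1 = j + 2 ∧ j + 1 + 2 = j ∧ j + 2 + 1 = j ∧ j + 2 + 2 = j + 1 := by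
    decide
  obtain rfl | rfl := (by decide : ∀ j k : Fin 3, j ≠ k → k = j + 1 ∨ k = j + 2) j k hne
  · exact h (j + 2) (by rw [(h1 j).2.2.1, (h1 j).2.2.2, hjk])
  · exact h (j + 1) (by rw [(h1 j).1, (h1 j).2.1, hjk])

theorem flipVec_ne_zero (y : ℂ) (k : Fin 3) : stdVec (k + 2) - y • stdVec (k + 1) ≠ 0 := by
  intro h
  have := wedge_stdVec' k
  rw [sub_eq_zero.1 h] at this
  simp only [wedge, Pi.smul_apply, smul_eq_mul] at this
  ring_nf at this
  norm_num at this

/-- The vertex of the ideal triangle adjacent to the standard one along the side `k`, with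
shear-bend parameter `y`. -/
noncomputable def flipVertex (y : ℂ) (k : Fin 3) : SphereAtInfinity :=
  mk ℂ (stdVec (k + 2) - y • stdVec (k + 1)) (flipVec_ne_zero y k)

namespace HyperbolicSpace

theorem isShearBend_flipVertex {y : ℂ} (hy : y ≠ 0) (k : Fin 3) {x : ℂ} :
    IsShearBend (stdVertex (k + 2)) (stdVertex (k + 1)) (stdVertex k) (flipVertex y k) x ↔
      x = y := by
  have hz : stdVec (k + 2) + stdVec (k + 1) ≠ 0 := fun h =>
    stdVec_ne_zero k (by rw [stdVec_eq, h, smul_zero])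
  rw [← isShearBend_iff (a := stdVec (k + 2)) (b := stdVec (k + 1))
    (by rw [wedge_stdVec']; simp) hy (stdVec_ne_zero _) (stdVec_ne_zero _) hz (flipVec_ne_zero y k),
    ← mk_eq_mk_of_smul (stdVec_ne_zero k) hz (-1) (stdVec_eq k)]
  rfl

theorem isShearBend_flipVertex_symm {y : ℂ} (hy : y ≠ 0) (k : Fin 3) {x : ℂ} :
    IsShearBend (stdVertex (k + 1)) (stdVertex (k + 2)) (flipVertex y k) (stdVertex k) x ↔
      x = y := by
  -- Seen from the other triangle, the normal form uses `a = (-y) • stdVec (k + 1)` and `b = stdVec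
  -- (k + 2)`: then `a + b` is the flipped vertex and `a - y • b = y • stdVec k`, with the same
  -- parameter `y`.
  have h1 : (-y) • stdVec (k + 1) ≠ 0 := smul_ne_zero (neg_ne_zero.2 hy) (stdVec_ne_zero _)
  have h2 : (-y) • stdVec (k + 1) + stdVec (k + 2) ≠ 0 := by
    rw [neg_smul, neg_add_eq_sub]; exact flipVec_ne_zero y k
  have h3 : (-y) • stdVec (k + 1) - y • stdVec (k + 2) = y • stdVec k := by
    rw [stdVec_eq k]; module
  have h4 : (-y) • stdVec (k + 1) - y • stdVec (k + 2) ≠ 0 := by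
    rw [h3]; exact smul_ne_zero hy (stdVec_ne_zero _)
  rw [← isShearBend_iff (a := (-y) • stdVec (k + 1)) (b := stdVec (k + 2))
    (by rw [wedge_smul_left, wedge_stdVec]; simpa using hy) hy h1 (stdVec_ne_zero _) h2 h4,
    mk_eq_mk_of_smul h1 (stdVec_ne_zero _) (-y) rfl, mk_eq_mk_of_smul h4 (stdVec_ne_zero _) y h3,
    mk_eq_mk_of_smul h2 (flipVec_ne_zero y k) 1 (by module)]
  rfl

end HyperbolicSpace

theorem exists_eq_flipVertex {k : Fin 3} {z : SphereAtInfinity} (h1 : z ≠ stdVertex (k + 1))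
    (h2 : z ≠ stdVertex (k + 2)) : ∃ y : ℂˣ, z = flipVertex y k := by
  induction z using Projectivization.ind with | h w hw
  rw [Ne, stdVertex, mk_eq_mk_iff_wedge] at h1 h2
  have h := wedge_smul_eq (stdVec (k + 2)) (stdVec (k + 1)) w
  rw [wedge_stdVec'] at h
  have h3 : wedge (stdVec (k + 2)) w = -wedge w (stdVec (k + 2)) := by unfold wedge; ring
  rw [h3] at h
  have h4 : w = -wedge w (stdVec (k + 1)) • stdVec (k + 2) +
      wedge w (stdVec (k + 2)) • stdVec (k + 1) := by
    rw [neg_smul, one_smul, neg_smul] at h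
    rw [← neg_inj, h]
    module
  refine ⟨Units.mk0 (wedge w (stdVec (k + 2)) / wedge w (stdVec (k + 1))) (div_ne_zero h2 h1),
    mk_eq_mk_of_smul _ _ (-wedge w (stdVec (k + 1))) ?_⟩
  have h5 : wedge w (stdVec (k + 1)) * (wedge w (stdVec (k + 2)) / wedge w (stdVec (k + 1))) =
      wedge w (stdVec (k + 2)) := mul_div_cancel₀ _ h1
  refine h4.trans ?_
  rw [Units.val_mk0, smul_sub, smul_smul, neg_mul, h5]
  module

/-- Cramer's rule rescales the vectors over the first two points so that their sum lies over the
third one; `exists_frame` then applies. -/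
theorem exists_smul_stdVertex {p : Fin 3 → SphereAtInfinity} (hp : Function.Injective p) :
    ∃ g : PSL(2, ℂ), ∀ k, g • stdVertex k = p k := by
  obtain ⟨w, hw, rfl⟩ : ∃ (w : Fin 3 → Fin 2 → ℂ) (hw : ∀ k, w k ≠ 0),
      p = fun k => mk ℂ (w k) (hw k) :=
    ⟨fun k => (p k).rep, fun k => (p k).rep_nonzero, funext fun k => (mk_rep _).symm⟩
  have h : ∀ j k, j ≠ k → wedge (w j) (w k) ≠ 0 := fun j k hjk h0 =>
    hjk (hp ((mk_eq_mk_iff_wedge (hw j) (hw k)).2 h0))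
  have h01 := h 0 1 (by decide)
  have h21 := h 2 1 (by decide)
  have h02 := h 0 2 (by decide)
  have hsum := wedge_smul_eq (w 0) (w 1) (w 2)
  obtain ⟨g, d, hd, hg⟩ := exists_frame (a := wedge (w 2) (w 1) • w 0)
    (b := wedge (w 0) (w 2) • w 1) (by
      rw [wedge_smul_left, wedge_smul_right]
      exact mul_ne_zero h21 (mul_ne_zero h02 h01))
  refine ⟨QuotientGroup.mk g, fun k => ?_⟩
  change g • stdVertex k = _
  rw [stdVertex, HyperbolicSpace.smul_mk]
  fin_cases k
  · exact mk_eq_mk_of_smul _ _ (d * wedge (w 2) (w 1)) (by simp [stdVec, hg, smul_smul])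
  · exact mk_eq_mk_of_smul _ _ (d * wedge (w 0) (w 2)) (by simp [stdVec, hg, smul_smul])
  · refine mk_eq_mk_of_smul _ _ (-d * wedge (w 0) (w 1)) ?_
    change g.1 *ᵥ stdVec 2 = (-d * wedge (w 0) (w 1)) • w 2
    rw [← smul_smul, hsum]
    simp [stdVec, hg]

/-- The three vectors are eigenvectors. The first two make the matrix diagonal, and the third one
makes it scalar, hence central. -/
theorem eq_one_of_smul_stdVertex {g : PSL(2, ℂ)} (h : ∀ k, g • stdVertex k = stdVertex k) :
    g = 1 := by
  induction g using QuotientGroup.induction_on with | H g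
  have hc : ∀ k, ∃ c : ℂ, c • stdVec k = g.1 *ᵥ stdVec k := fun k => by
    have hk : g • stdVertex k = stdVertex k := h k
    rw [stdVertex, HyperbolicSpace.smul_mk] at hk
    exact (mk_eq_mk_iff' ℂ _ _ _ _).1 hk
  choose c hc using hc
  have e00 : c 0 = g.1 0 0 := by simpa [stdVec, Matrix.mulVec, dotProduct] using congrFun (hc 0) 0
  have e10 : g.1 1 0 = 0 := by
    simpa [stdVec, Matrix.mulVec, dotProduct] using (congrFun (hc 0) 1).symm
  have e01 : g.1 0 1 = 0 := by
    simpa [stdVec, Matrix.mulVec, dotProduct] using (congrFun (hc 1) 0).symm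
  have e11 : c 1 = g.1 1 1 := by simpa [stdVec, Matrix.mulVec, dotProduct] using congrFun (hc 1) 1
  have e2 : c 2 = g.1 0 0 := by
    simpa [stdVec, Matrix.mulVec, dotProduct, e01] using congrFun (hc 2) 0
  have e2' : c 2 = g.1 1 1 := by
    simpa [stdVec, Matrix.mulVec, dotProduct, e10] using congrFun (hc 2) 1
  have hdet := g.2
  rw [Matrix.det_fin_two, e10, mul_zero, sub_zero, ← e2, ← e2'] at hdet
  refine (QuotientGroup.eq_one_iff g).2 (Matrix.SpecialLinearGroup.mem_center_iff.2
    ⟨c 2, by rw [Fintype.card_fin, pow_two, hdet], ?_⟩)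
  ext i j
  fin_cases i <;> fin_cases j <;> simp [e01, e10, ← e2, ← e2']

/-! ### Existence of the shear-bend parameter and gluing of adjacent ideal triangles -/

open Projectivization

namespace HyperbolicSpace

theorem isShearBend_smul' (g : PSL(2, ℂ)) {a b z z' : SphereAtInfinity} {x : ℂ} :
    IsShearBend (g • a) (g • b) (g • z) (g • z') x ↔ IsShearBend a b z z' x := by
  induction g using QuotientGroup.induction_on with | H g
  exact isShearBend_smul g

theorem smul_mem_geodesic' (g : PSL(2, ℂ)) {a b : SphereAtInfinity} {P : HyperbolicSpace} :
    g • P ∈ geodesic (g • a) (g • b) ↔ P ∈ geodesic a b := by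
  induction g using QuotientGroup.induction_on with | H g
  exact smul_mem_geodesic g

theorem smul_mem_idealTriangle' (g : PSL(2, ℂ)) {a : Fin 3 → SphereAtInfinity}
    {P : HyperbolicSpace} : g • P ∈ idealTriangle (fun k => g • a k) ↔ P ∈ idealTriangle a := by
  induction g using QuotientGroup.induction_on with | H g
  exact smul_mem_idealTriangle g

/-- The shear-bend parameter exists, is unique, is symmetric in the two ideal triangles, and
determines the fourth vertex. -/
theorem exists_isShearBend {p : Fin 3 → SphereAtInfinity} (hp : Function.Injective p) {k : Fin 3}
    {z : SphereAtInfinity} (h1 : z ≠ p (k + 1)) (h2 : z ≠ p (k + 2)) : ∃ y : ℂˣ,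
      (∀ x, IsShearBend (p (k + 2)) (p (k + 1)) (p k) z x ↔ x = y) ∧
      (∀ x, IsShearBend (p (k + 1)) (p (k + 2)) z (p k) x ↔ x = y) ∧
      ∀ g : PSL(2, ℂ), (∀ j, g • stdVertex j = p j) → z = g • flipVertex y k := by
  obtain ⟨g, hg⟩ := exists_smul_stdVertex hp
  obtain ⟨y, hy⟩ := exists_eq_flipVertex (k := k) (z := g⁻¹ • z)
    (fun h => h1 (by rw [← hg, ← h, smul_inv_smul]))
    (fun h => h2 (by rw [← hg, ← h, smul_inv_smul]))
  rw [inv_smul_eq_iff] at hy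
  refine ⟨y, fun x => ?_, fun x => ?_, fun g' hg' => ?_⟩
  · rw [← hg, ← hg, ← hg, hy, isShearBend_smul', isShearBend_flipVertex y.ne_zero]
  · rw [← hg, ← hg, ← hg, hy, isShearBend_smul', isShearBend_flipVertex_symm y.ne_zero]
  · have : g⁻¹ * g' = 1 := eq_one_of_smul_stdVertex fun j => by
      rw [mul_smul, hg', ← hg, inv_smul_smul]
    rw [hy, inv_mul_eq_one.1 this]

end HyperbolicSpace

theorem flipVertex_ne_add_one (y : ℂ) (k : Fin 3) : flipVertex y k ≠ stdVertex (k + 1) := by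
  rw [flipVertex, stdVertex, Ne, mk_eq_mk_iff_wedge]
  have : wedge (stdVec (k + 2) - y • stdVec (k + 1)) (stdVec (k + 1)) =
      wedge (stdVec (k + 2)) (stdVec (k + 1)) := by
    simp only [wedge, Pi.sub_apply, Pi.smul_apply, smul_eq_mul]; ring
  rw [this, wedge_stdVec']
  simp

theorem flipVertex_ne_add_two {y : ℂ} (hy : y ≠ 0) (k : Fin 3) :
    flipVertex y k ≠ stdVertex (k + 2) := by
  rw [flipVertex, stdVertex, Ne, mk_eq_mk_iff_wedge]
  have : wedge (stdVec (k + 2) - y • stdVec (k + 1)) (stdVec (k + 2)) =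
      -y * wedge (stdVec (k + 1)) (stdVec (k + 2)) := by
    simp only [wedge, Pi.sub_apply, Pi.smul_apply, smul_eq_mul]; ring
  rw [this, wedge_stdVec]
  simpa using hy

theorem exists_gluing (y : ℂˣ) (k k' : Fin 3) : ∃ g : PSL(2, ℂ), g • stdVertex k' = flipVertex y k ∧
    g • stdVertex (k' + 1) = stdVertex (k + 2) ∧ g • stdVertex (k' + 2) = stdVertex (k + 1) := by
  have h12 : stdVertex (k + 1) ≠ stdVertex (k + 2) := fun h =>
    absurd (stdVertex_injective h) ((by decide : ∀ k : Fin 3, k + 1 ≠ k + 2) k)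
  have hp : Function.Injective ![flipVertex y k, stdVertex (k + 2), stdVertex (k + 1)] := by
    intro i j hij
    fin_cases i <;> fin_cases j <;>
      simp [flipVertex_ne_add_one, flipVertex_ne_add_two, (flipVertex_ne_add_one _ _).symm,
        (flipVertex_ne_add_two y.ne_zero _).symm, h12, h12.symm] at hij ⊢
  obtain ⟨g, hg⟩ := exists_smul_stdVertex (p := fun j =>
    ![flipVertex y k, stdVertex (k + 2), stdVertex (k + 1)] (j - k'))
    (fun i j hij => sub_left_injective (hp hij))
  refine ⟨g, ?_, ?_, ?_⟩
  · simp [hg]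
  · simp [hg]
  · simp [hg]

/-- The isometry sending the standard ideal triangle to the triangle adjacent to it along its side
`k`, with shear-bend parameter `y`, in such a way that the side `k'` is sent to the side `k`. -/
noncomputable def gluing (y : ℂˣ) (k k' : Fin 3) : PSL(2, ℂ) := (exists_gluing y k k').choose

section gluing

variable (y : ℂˣ) (k k' : Fin 3)

theorem gluing_smul : gluing y k k' • stdVertex k' = flipVertex y k :=
  (exists_gluing y k k').choose_spec.1

theorem gluing_smul_add_one : gluing y k k' • stdVertex (k' + 1) = stdVertex (k + 2) :=
  (exists_gluing y k k').choose_spec.2.1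

theorem gluing_smul_add_two : gluing y k k' • stdVertex (k' + 2) = stdVertex (k + 1) :=
  (exists_gluing y k k').choose_spec.2.2

theorem eq_or_eq_add (j k : Fin 3) : j = k ∨ j = k + 1 ∨ j = k + 2 := by
  revert j k; decide

/-- The symmetry of the shear-bend parameter in the two triangles is what makes crossing a side back
and forth trivial, so that the monodromy is defined on the free group. -/
theorem gluing_inv : gluing y k' k = (gluing y k k')⁻¹ := by
  refine eq_inv_of_mul_eq_one_right (eq_one_of_smul_stdVertex fun j => ?_)
  rw [mul_smul]
  obtain rfl | rfl | rfl := eq_or_eq_add j k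
  -- Only the vertex off the common side requires an argument: `stdVertex j` is adjacent, with
  -- parameter `y`, to the image of the standard triangle, and this determines it.
  · obtain ⟨x, h2, -, h3⟩ := HyperbolicSpace.exists_isShearBend
      (p := fun i => gluing y j k' • stdVertex i)
      (fun a b h => stdVertex_injective (smul_left_cancel _ h)) (k := k') (z := stdVertex j)
      (by rw [gluing_smul_add_one]
          exact fun h => absurd (stdVertex_injective h) ((by decide : ∀ k : Fin 3, k ≠ k + 2) j))
      (by rw [gluing_smul_add_two]
          exact fun h => absurd (stdVertex_injective h) ((by decide : ∀ k : Fin 3, k ≠ k + 1) j))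
    have hx : (y : ℂ) = x := by
      refine (h2 y).1 ?_
      rw [gluing_smul, gluing_smul_add_one, gluing_smul_add_two]
      exact (HyperbolicSpace.isShearBend_flipVertex_symm y.ne_zero j).2 rfl
    rw [gluing_smul, hx, ← h3 _ fun _ => rfl]
  · rw [gluing_smul_add_one, gluing_smul_add_two]
  · rw [gluing_smul_add_two, gluing_smul_add_one]

end gluing

/-! ### The enhanced homomorphism developed from edge weights -/

namespace IdealTriangulation

variable {m n : ℕ} (T : IdealTriangulation m n) {o : Fin m}

/-- The monodromy of the developing map with given shear-bend parameters. -/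
noncomputable def monodromy (x : Fin n → ℂˣ) : FreeGroup (Fin n) →* PSL(2, ℂ) :=
  FreeGroup.lift fun i => gluing (x i) (T.side (i, true)).2 (T.side (i, false)).2

/-- The monodromy is prescribed for crossings out of the side `(i, true)`; `gluing_inv` makes the
same formula valid in the other direction. -/
theorem monodromy_letter (x : Fin n → ℂˣ) (s : Fin m × Fin 3) :
    T.monodromy x (T.letter s) = gluing (x (T.edge s)) s.2 (T.opp s).2 := by
  obtain ⟨⟨i, b⟩, rfl⟩ := T.side.surjective s
  cases b
  · simp [monodromy, letter, edge, opp, gluing_inv (x i) (T.side (i, true)).2]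
  · simp [monodromy, letter, edge, opp]

/-- The vertices of the image of a face of the universal cover by the developing map. -/
noncomputable def devVertex (x : Fin n → ℂˣ) (F : T.LiftedFace o) (k : Fin 3) : SphereAtInfinity :=
  T.monodromy x F.word • stdVertex k

variable (x : Fin n → ℂˣ) (F : T.LiftedFace o) (k : Fin 3)

theorem monodromy_neighbor : T.monodromy x (F.neighbor k).word =
    T.monodromy x F.word * gluing (x (T.edge (F.face, k))) k (T.opp (F.face, k)).2 := by
  rw [← monodromy_letter T x (F.face, k), ← map_mul]; rfl

theorem devVertex_neighbor : T.devVertex x (F.neighbor k) (T.opp (F.face, k)).2 =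
    T.monodromy x F.word • flipVertex (x (T.edge (F.face, k))) k := by
  rw [devVertex, monodromy_neighbor, mul_smul, gluing_smul]

theorem devVertex_neighbor_add_one :
    T.devVertex x (F.neighbor k) ((T.opp (F.face, k)).2 + 1) = T.devVertex x F (k + 2) := by
  rw [devVertex, monodromy_neighbor, mul_smul, gluing_smul_add_one]; rfl

theorem devVertex_neighbor_add_two :
    T.devVertex x (F.neighbor k) ((T.opp (F.face, k)).2 + 2) = T.devVertex x F (k + 1) := by
  rw [devVertex, monodromy_neighbor, mul_smul, gluing_smul_add_two]; rfl

theorem devVertex_deck (γ : T.piOne o) :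
    T.devVertex x (F.deck γ) k = T.monodromy x γ.1 • T.devVertex x F k := by
  rw [devVertex, devVertex, ← mul_smul, ← map_mul]; rfl

theorem peripheral_eq_zpowers : F.peripheral k =
    Subgroup.zpowers (⟨_, F.isPath_loop k⟩ : T.piOne o) := by
  rw [LiftedFace.peripheral]
  apply Subgroup.map_injective (T.piOne o).subtype_injective
  rw [MonoidHom.map_zpowers, Subgroup.subgroupOf_map_subtype]
  exact inf_eq_left.2 (Subgroup.zpowers_le.2 (F.isPath_loop k))

theorem peripheral_deck (γ : T.piOne o) :
    (F.deck γ).peripheral k = (F.peripheral k).map (MulAut.conj γ).toMonoidHom := by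
  rw [peripheral_eq_zpowers, peripheral_eq_zpowers, MonoidHom.map_zpowers]
  congr 1
  apply Subtype.ext
  change γ.1 * F.word * _ * (γ.1 * F.word)⁻¹ = γ.1 * _ * γ.1⁻¹
  rw [mul_inv_rev]
  simp only [mul_assoc]
  rfl

/-- The point of the sphere at infinity corresponding to a peripheral subgroup. -/
noncomputable def devPoint (π : T.Peripheral o) : SphereAtInfinity :=
  T.devVertex x π.2.choose π.2.choose_spec.choose

/-- `devPoint` chooses a face and a vertex. The choice is immaterial because the developed vertices
match across sides and a peripheral subgroup determines its vertex. -/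
theorem devPoint_vertexGroup : T.devPoint x (F.vertexGroup k) = T.devVertex x F k :=
  eq_of_peripheral_eq (fun F k => T.devVertex_neighbor_add_two x F k)
    (F.vertexGroup k).2.choose_spec.choose_spec.symm

theorem devPoint_conj (γ : T.piOne o) (π π' : T.Peripheral o)
    (h : π'.1 = π.1.map (MulAut.conj γ).toMonoidHom) :
    T.devPoint x π' = T.monodromy x γ.1 • T.devPoint x π := by
  obtain ⟨H, F, k, rfl⟩ := π
  rw [show (⟨F.peripheral k, F, k, rfl⟩ : T.Peripheral o) = F.vertexGroup k from rfl,
    devPoint_vertexGroup, ← devVertex_deck, ← devPoint_vertexGroup]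
  congr 1
  exact Subtype.ext (h.trans (peripheral_deck T F k γ).symm)

/-- The enhanced homomorphism with given shear-bend parameters. -/
noncomputable def developed : T.EnhancedHom o where
  r := (T.monodromy x).comp (T.piOne o).subtype
  ξ := T.devPoint x
  -- A subgroup is preserved by conjugation by its own elements, so this is a case of equivariance.
  fixed π γ hγ := (T.devPoint_conj x γ π π (Subgroup.conj_smul_eq_self_of_mem hγ).symm).symm
  equivariant := T.devPoint_conj x

end IdealTriangulation

/-! ### Edge weights of an enhanced homomorphism, and rigidity -/

namespace IdealTriangulation

variable {m n : ℕ} {T : IdealTriangulation m n} {o : Fin m}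

/-- The base face of the universal cover. -/
def baseFace (T : IdealTriangulation m n) (o : Fin m) : T.LiftedFace o := ⟨(o, 1), IsPath.refl⟩

theorem exists_liftedFace (T : IdealTriangulation m n) (o j : Fin m) :
    ∃ F : T.LiftedFace o, F.face = j := by
  have h : ∃ w, T.IsPath o j w := by
    induction T.connected o j with
    | refl => exact ⟨1, IsPath.refl⟩
    | tail _ h ih =>
      obtain ⟨i, b, rfl, rfl⟩ := h
      obtain ⟨w, hw⟩ := ih
      have := IsPath.cross (T.side (i, b)) w hw
      rw [opp, Equiv.symm_apply_apply] at this
      exact ⟨_, this⟩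
  obtain ⟨w, hw⟩ := h
  exact ⟨⟨(j, w), hw⟩, rfl⟩

theorem exists_deck_eq {F F' : T.LiftedFace o} (h : F.face = F'.face) :
    ∃ γ : T.piOne o, F' = F.deck γ := by
  have hp : T.IsPath o o (F'.word * F.word⁻¹) :=
    F'.2.trans (IsPath.symm (h ▸ F.2 : T.IsPath o F'.face F.word))
  exact ⟨⟨_, hp⟩, LiftedFace.ext h.symm (inv_mul_cancel_right _ _).symm⟩

theorem LiftedFace.neighbor_deck (F : T.LiftedFace o) (γ : T.piOne o) (k : Fin 3) :
    (F.deck γ).neighbor k = (F.neighbor k).deck γ :=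
  LiftedFace.ext rfl (mul_assoc _ _ _)

/-- The common side of two adjacent faces corresponds to the same edge in both. -/
theorem edge_neighbor (F : T.LiftedFace o) (k : Fin 3) :
    T.edge ((F.neighbor k).face, (T.opp (F.face, k)).2) = T.edge (F.face, k) := by
  change T.edge (T.opp (F.face, k)) = _
  simp [edge, opp]

namespace EnhancedHom

variable {E : T.EnhancedHom o} {f : T.PleatedSurface o E.r}

theorem IsAssociated.vertex_neighbor_add_one (hf : E.IsAssociated f) (F : T.LiftedFace o)
    (k : Fin 3) : f.vertex (F.neighbor k) ((T.opp (F.face, k)).2 + 1) = f.vertex F (k + 2) := by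
  rw [hf, hf, vertexGroup_neighbor_add_one]

theorem IsAssociated.vertex_neighbor_add_two (hf : E.IsAssociated f) (F : T.LiftedFace o)
    (k : Fin 3) : f.vertex (F.neighbor k) ((T.opp (F.face, k)).2 + 2) = f.vertex F (k + 1) := by
  rw [hf, hf, vertexGroup_neighbor_add_two]

theorem IsAssociated.vertex_deck (hf : E.IsAssociated f) (γ : T.piOne o) (F : T.LiftedFace o)
    (k : Fin 3) : f.vertex (F.deck γ) k = E.r γ • f.vertex F k := by
  rw [hf, hf]
  exact E.equivariant γ _ _ (peripheral_deck T F k γ)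

theorem IsAssociated.exists_isShearBend (hf : E.IsAssociated f) (F : T.LiftedFace o) (k : Fin 3) :
    ∃ y : ℂˣ,
      (∀ x, HyperbolicSpace.IsShearBend (f.vertex F (k + 2)) (f.vertex F (k + 1)) (f.vertex F k)
        (f.vertex (F.neighbor k) (T.opp (F.face, k)).2) x ↔ x = y) ∧
      (∀ x, HyperbolicSpace.IsShearBend (f.vertex F (k + 1)) (f.vertex F (k + 2))
        (f.vertex (F.neighbor k) (T.opp (F.face, k)).2) (f.vertex F k) x ↔ x = y) ∧
      ∀ g : PSL(2, ℂ), (∀ j, g • stdVertex j = f.vertex F j) →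
        f.vertex (F.neighbor k) (T.opp (F.face, k)).2 = g • flipVertex y k := by
  refine HyperbolicSpace.exists_isShearBend (f.vertex_injective F) ?_ ?_
  · rw [← hf.vertex_neighbor_add_two]
    exact fun h => absurd (f.vertex_injective _ h) ((by decide : ∀ k : Fin 3, k ≠ k + 2) _)
  · rw [← hf.vertex_neighbor_add_one]
    exact fun h => absurd (f.vertex_injective _ h) ((by decide : ∀ k : Fin 3, k ≠ k + 1) _)

/-- The parameter is read at one lift of the first side of each edge. Equivariance transports it to
all lifts, and symmetry gives it on the second side. -/
theorem exists_hasWeights (hE : E.Realizes) : ∃ x, E.HasWeights x := by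
  obtain ⟨f, hf⟩ := hE
  have h : ∀ i, ∃ y : ℂˣ, ∀ (F : T.LiftedFace o) (k : Fin 3), (F.face, k) = T.side (i, false) →
      (∀ x, HyperbolicSpace.IsShearBend (f.vertex F (k + 2)) (f.vertex F (k + 1)) (f.vertex F k)
        (f.vertex (F.neighbor k) (T.opp (F.face, k)).2) x ↔ x = y) ∧
      (∀ x, HyperbolicSpace.IsShearBend (f.vertex F (k + 1)) (f.vertex F (k + 2))
        (f.vertex (F.neighbor k) (T.opp (F.face, k)).2) (f.vertex F k) x ↔ x = y) := by
    intro i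
    obtain ⟨F₀, hF₀⟩ := exists_liftedFace T o (T.side (i, false)).1
    obtain ⟨y, h1, h2, -⟩ := hf.exists_isShearBend F₀ (T.side (i, false)).2
    refine ⟨y, fun F k hFk => ?_⟩
    obtain ⟨hF, rfl⟩ := Prod.ext_iff.1 hFk
    obtain ⟨γ, rfl⟩ := exists_deck_eq (hF₀.trans hF.symm)
    rw [LiftedFace.neighbor_deck]
    simp only [hf.vertex_deck, HyperbolicSpace.isShearBend_smul']
    exact ⟨h1, h2⟩
  choose x hx using h
  refine ⟨x, f, hf, fun F k => ?_⟩
  obtain ⟨⟨i, b⟩, hib⟩ := T.side.surjective (F.face, k)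
  have hi : T.edge (F.face, k) = i := by rw [← hib, edge, Equiv.symm_apply_apply]
  rw [hi]
  cases b
  · exact ((hx i F k hib.symm).1 _).2 rfl
  · have hopp : T.opp (F.face, k) = T.side (i, false) := by
      rw [← hib, opp, Equiv.symm_apply_apply]; rfl
    have h1 := ((hx i (F.neighbor k) (T.opp (F.face, k)).2 hopp).2 _).2 rfl
    have h2 : T.opp ((F.neighbor k).face, (T.opp (F.face, k)).2) = (F.face, k) :=
      opp_opp (F.face, k)
    rw [LiftedFace.neighbor_neighbor, h2, hf.vertex_neighbor_add_one,
      hf.vertex_neighbor_add_two] at h1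
    exact h1

/-- All pleated surfaces associated to `E` have the same ideal vertices, given by `ξ`, and the
shear-bend parameters depend on these alone. -/
theorem HasWeights.unique {x x' : Fin n → ℂˣ} (h : E.HasWeights x) (h' : E.HasWeights x') :
    x = x' := by
  obtain ⟨f, hf, hx⟩ := h
  obtain ⟨f', hf', hx'⟩ := h'
  have hv : f'.vertex = f.vertex := by
    funext F k
    rw [hf, hf']
  funext i
  obtain ⟨F, hF⟩ := exists_liftedFace T o (T.side (i, false)).1
  obtain ⟨y, h1, -, -⟩ := hf.exists_isShearBend F (T.side (i, false)).2
  have h2 := hx F (T.side (i, false)).2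
  have h3 := hx' F (T.side (i, false)).2
  rw [hv] at h3
  have h4 := Units.ext (((h1 _).1 h2).trans ((h1 _).1 h3).symm)
  have hi : T.edge (F.face, (T.side (i, false)).2) = i := by
    rw [hF, edge, Equiv.symm_apply_apply]
  rwa [hi] at h4

/-- The isometry `A` matches the standard triangle with the base face. Along a path of faces, two
vertices of each new triangle are already known and the parameter determines the third, so `A`
carries the whole developed picture to that of `f`. -/
theorem HasWeights.isConj_developed {x : Fin n → ℂˣ} (h : E.HasWeights x) :
    (T.developed x).IsConj E := by
  obtain ⟨f, hf, hx⟩ := h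
  obtain ⟨A, hA⟩ := exists_smul_stdVertex (f.vertex_injective (T.baseFace o))
  have key : ∀ (j : Fin m) (w : FreeGroup (Fin n)) (hw : T.IsPath o j w) (k : Fin 3),
      f.vertex ⟨(j, w), hw⟩ k = A • T.devVertex x (⟨(j, w), hw⟩ : T.LiftedFace o) k := by
    intro j w hw
    induction hw with
    | refl =>
      intro k
      have : T.devVertex x (T.baseFace o) k = stdVertex k := by
        rw [devVertex, show (T.baseFace o).word = 1 from rfl, map_one, one_smul]
      exact (hA k).symm.trans (congrArg (A • ·) this.symm)
    | cross s w hw ih =>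
      intro k
      set F : T.LiftedFace o := ⟨(s.1, w), hw⟩
      change f.vertex (F.neighbor s.2) k = A • T.devVertex x (F.neighbor s.2) k
      obtain rfl | rfl | rfl := eq_or_eq_add k (T.opp (F.face, s.2)).2
      · obtain ⟨y, h1, -, h3⟩ := hf.exists_isShearBend F s.2
        rw [h3 (A * T.monodromy x F.word) (fun j => by rw [mul_smul]; exact (ih j).symm),
          devVertex_neighbor, (h1 _).1 (hx F s.2), mul_smul]
      · rw [hf.vertex_neighbor_add_one, devVertex_neighbor_add_one, ih]
      · rw [hf.vertex_neighbor_add_two, devVertex_neighbor_add_two, ih]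
  refine ⟨A, fun γ => ?_, fun π => ?_⟩
  -- Both `A * T.monodromy x γ` and `E.r γ * A` send the standard triangle to the translate by `γ`
  -- of the base face.
  · have h1 : (A * T.monodromy x γ.1)⁻¹ * (E.r γ * A) = 1 := eq_one_of_smul_stdVertex fun k => by
      rw [mul_smul, inv_smul_eq_iff, mul_smul, mul_smul, hA, ← hf.vertex_deck]
      refine (key _ _ ((T.baseFace o).deck γ).2 k).trans ?_
      change A • (T.monodromy x (γ.1 * 1) • _) = _
      rw [mul_one]
    rw [inv_mul_eq_one] at h1
    exact (mul_inv_eq_iff_eq_mul.2 h1).symm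
  · obtain ⟨H, F, k, rfl⟩ := π
    exact (hf F k).symm.trans ((key _ _ F.2 k).trans
      (congrArg (A • ·) (T.devPoint_vertexGroup x F k).symm))

end EnhancedHom

end IdealTriangulation

/-! ### The standard ideal triangle -/

namespace IdealSimplex

variable (p : IdealSimplex) (k : Fin 3)

theorem sum_eq : p.1 k + p.1 (k + 1) + p.1 (k + 2) = 1 := by
  have h := p.2.2.1
  rw [Fin.sum_univ_three] at h
  fin_cases k
  · exact h
  · change p.1 1 + p.1 2 + p.1 0 = 1
    linarith
  · change p.1 2 + p.1 0 + p.1 1 = 1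
    linarith

theorem nonneg : 0 ≤ p.1 k := p.2.1 k

theorem lt_one : p.1 k < 1 := by
  refine lt_of_le_of_ne ?_ (p.2.2.2 k)
  linarith [sum_eq p k, nonneg p (k + 1), nonneg p (k + 2)]

theorem pos_of_eq_zero (h : p.1 k = 0) : 0 < p.1 (k + 1) ∧ 0 < p.1 (k + 2) := by
  have := sum_eq p k
  have := lt_one p (k + 1)
  have := lt_one p (k + 2)
  constructor <;> linarith

/-- The sum of the products of two barycentric coordinates. -/
def symm2 (c : Fin 3 → ℝ) : ℝ := c 0 * c 1 + c 1 * c 2 + c 2 * c 0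

theorem symm2_pos : 0 < symm2 p.1 := by
  have h := p.2.2.1
  rw [Fin.sum_univ_three] at h
  have h0 := nonneg p 0
  have h1 := nonneg p 1
  have h2 := nonneg p 2
  have k0 := lt_one p 0
  have k1 := lt_one p 1
  have k2 := lt_one p 2
  unfold symm2
  rcases h0.eq_or_lt with e | e
  · have : 0 < p.1 1 * p.1 2 := mul_pos (by linarith) (by linarith)
    nlinarith
  · have : 0 < p.1 0 * (p.1 1 + p.1 2) := mul_pos e (by linarith)
    nlinarith [mul_nonneg h1 h2]

/-- A triple of nonnegative numbers, at least two of which do not vanish, in barycentric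
coordinates. -/
theorem exists_eq_smul {c : Fin 3 → ℝ} (hc : ∀ k, 0 ≤ c k) (h : 0 < symm2 c) :
    ∃ (p : IdealSimplex) (s : ℝ), 0 < s ∧ c = s • p.1 := by
  have hs : 0 < ∑ k, c k := by
    refine lt_of_le_of_ne (Finset.sum_nonneg fun k _ => hc k) fun h0 => ?_
    have h1 := (Finset.sum_eq_zero_iff_of_nonneg fun k _ => hc k).1 h0.symm
    simp [symm2, h1] at h
  refine ⟨⟨fun k => c k / ∑ k, c k, fun k => div_nonneg (hc k) hs.le, ?_, fun k hk => ?_⟩,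
    ∑ k, c k, hs, ?_⟩
  · rw [← Finset.sum_div, div_self hs.ne']
  · rw [div_eq_one_iff_eq hs.ne', Fin.sum_univ_three] at hk
    have h0 := hc 0
    have h1 := hc 1
    have h2 := hc 2
    unfold symm2 at h
    have hk' : ∀ j, j ≠ k → c j = 0 := by
      intro j hj
      fin_cases k <;> fin_cases j <;> simp at hk hj ⊢ <;> linarith
    fin_cases k <;> simp [hk'] at h
  · funext k
    simp only [Pi.smul_apply, smul_eq_mul]
    field_simp

theorem continuous_coord : Continuous fun p : IdealSimplex => p.1 k :=
  (continuous_apply k).comp continuous_subtype_val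

theorem sum_eq_rotate (f : Fin 3 → ℝ) : ∑ j, f j = f k + f (k + 1) + f (k + 2) := by
  rw [Fin.sum_univ_three]
  fin_cases k
  · rfl
  · change _ = f 1 + f 2 + f 0
    ring
  · change _ = f 2 + f 0 + f 1
    ring

theorem denom_pos {l : ℝ} (hl : 0 < l) : 0 < p.1 (k + 1) + l * p.1 (k + 2) := by
  have h := sum_eq p k
  have h1 := lt_one p k
  rcases (nonneg p (k + 1)).eq_or_lt with e | e
  · have : 0 < l * p.1 (k + 2) := mul_pos hl (by linarith)
    linarith
  · have := mul_nonneg hl.le (nonneg p (k + 2))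
    linarith

/-- The transformation of barycentric coordinates that multiplies by `l` the ratio of the
coordinates `k + 2` and `k + 1`, without changing the coordinate `k`. -/
noncomputable def stretchFun (l : ℝ) (k : Fin 3) (c : Fin 3 → ℝ) (j : Fin 3) : ℝ :=
  if j = k then c k else
    (1 - c k) * (if j = k + 1 then c (k + 1) else l * c (k + 2)) / (c (k + 1) + l * c (k + 2))

theorem stretchFun_self (l : ℝ) (c : Fin 3 → ℝ) : stretchFun l k c k = c k := if_pos rfl

theorem stretchFun_add_one (l : ℝ) (c : Fin 3 → ℝ) : stretchFun l k c (k + 1) =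
    (1 - c k) * c (k + 1) / (c (k + 1) + l * c (k + 2)) := by
  rw [stretchFun, if_neg ((by decide : ∀ k : Fin 3, k + 1 ≠ k) k), if_pos rfl]

theorem stretchFun_add_two (l : ℝ) (c : Fin 3 → ℝ) : stretchFun l k c (k + 2) =
    (1 - c k) * (l * c (k + 2)) / (c (k + 1) + l * c (k + 2)) := by
  rw [stretchFun, if_neg ((by decide : ∀ k : Fin 3, k + 2 ≠ k) k),
    if_neg ((by decide : ∀ k : Fin 3, k + 2 ≠ k + 1) k)]

theorem forall_rotate {P : Fin 3 → Prop} (h0 : P k) (h1 : P (k + 1)) (h2 : P (k + 2)) (j : Fin 3) :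
    P j := by
  obtain rfl | rfl | rfl := eq_or_eq_add j k
  exacts [h0, h1, h2]

theorem stretchFun_eq_zero_iff {l : ℝ} (hl : 0 < l) (j : Fin 3) :
    stretchFun l k p.1 j = 0 ↔ p.1 j = 0 := by
  have hD := (denom_pos p k hl).ne'
  have h1 : 1 - p.1 k ≠ 0 := (sub_pos.2 (lt_one p k)).ne'
  revert j
  refine forall_rotate k ?_ ?_ ?_
  · rw [stretchFun_self]
  · rw [stretchFun_add_one]; simp [hD, h1]
  · rw [stretchFun_add_two]; simp [hD, h1, hl.ne']

theorem stretchFun_sum {l : ℝ} (hl : 0 < l) : ∑ j, stretchFun l k p.1 j = 1 := by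
  have hD := (denom_pos p k hl).ne'
  rw [sum_eq_rotate k, stretchFun_self, stretchFun_add_one, stretchFun_add_two]
  field_simp
  ring

theorem stretchFun_nonneg {l : ℝ} (hl : 0 < l) (j : Fin 3) : 0 ≤ stretchFun l k p.1 j := by
  have hD := denom_pos p k hl
  have h1 := sub_pos.2 (lt_one p k)
  have h2 := nonneg p (k + 1)
  have h3 := nonneg p (k + 2)
  revert j
  refine forall_rotate k ?_ ?_ ?_
  · rw [stretchFun_self]; exact nonneg p k
  · rw [stretchFun_add_one]; positivity
  · rw [stretchFun_add_two]; positivity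

/-- `stretchFun`, as a transformation of the triangle. -/
noncomputable def stretchMap {l : ℝ} (hl : 0 < l) (k : Fin 3) (p : IdealSimplex) : IdealSimplex :=
  ⟨stretchFun l k p.1, stretchFun_nonneg p k hl, stretchFun_sum p k hl, fun j hj => by
    have h := stretchFun_sum p k hl
    rw [sum_eq_rotate j, hj] at h
    have h1 := stretchFun_nonneg p k hl (j + 1)
    have h2 := stretchFun_nonneg p k hl (j + 2)
    have e1 := (stretchFun_eq_zero_iff p k hl (j + 1)).1 (by linarith)
    have e2 := (stretchFun_eq_zero_iff p k hl (j + 2)).1 (by linarith)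
    have := sum_eq p j
    have := lt_one p j
    linarith⟩

theorem stretchMap_inv {l : ℝ} (hl : 0 < l) :
    stretchMap (inv_pos.2 hl) k (stretchMap hl k p) = p := by
  have hD := (denom_pos p k hl).ne'
  have h1 : 1 - p.1 k ≠ 0 := (sub_pos.2 (lt_one p k)).ne'
  have h2 : p.1 (k + 2) = 1 - p.1 k - p.1 (k + 1) := by linarith [sum_eq p k]
  have h3 : (1 - p.1 k) * p.1 (k + 1) / (p.1 (k + 1) + l * p.1 (k + 2)) +
      l⁻¹ * ((1 - p.1 k) * (l * p.1 (k + 2)) / (p.1 (k + 1) + l * p.1 (k + 2))) =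
      (1 - p.1 k) * (1 - p.1 k) / (p.1 (k + 1) + l * p.1 (k + 2)) := by
    field_simp
    rw [h2]; ring
  refine Subtype.ext (funext (forall_rotate k ?_ ?_ ?_))
  · change stretchFun l⁻¹ k (stretchFun l k p.1) k = _
    rw [stretchFun_self, stretchFun_self]
  · change stretchFun l⁻¹ k (stretchFun l k p.1) (k + 1) = _
    rw [stretchFun_add_one, stretchFun_self, stretchFun_add_one, stretchFun_add_two, h3]
    field_simp
  · change stretchFun l⁻¹ k (stretchFun l k p.1) (k + 2) = _
    rw [stretchFun_add_two, stretchFun_self, stretchFun_add_one, stretchFun_add_two, h3]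
    field_simp

theorem continuous_stretchMap {l : ℝ} (hl : 0 < l) : Continuous (stretchMap hl k) := by
  have hc := continuous_coord
  refine Continuous.subtype_mk (continuous_pi (forall_rotate k ?_ ?_ ?_)) _
  · simp only [stretchFun_self]
    exact hc k
  · simp only [stretchFun_add_one]
    exact ((continuous_const.sub (hc k)).mul (hc _)).div ((hc _).add (continuous_const.mul (hc _)))
      fun p => (denom_pos p k hl).ne'
  · simp only [stretchFun_add_two]
    exact ((continuous_const.sub (hc k)).mul (continuous_const.mul (hc _))).div
      ((hc _).add (continuous_const.mul (hc _))) fun p => (denom_pos p k hl).ne'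

/-- The homeomorphism of the triangle that multiplies by `l` the ratio of the coordinates `k + 2`
and `k + 1`, without changing the coordinate `k`. -/
noncomputable def stretch {l : ℝ} (hl : 0 < l) (k : Fin 3) : IdealSimplex ≃ₜ IdealSimplex where
  toFun := stretchMap hl k
  invFun := stretchMap (inv_pos.2 hl) k
  left_inv p := stretchMap_inv p k hl
  right_inv p := by
    have h := stretchMap_inv p k (inv_pos.2 hl)
    simp only [inv_inv] at h
    exact h
  continuous_toFun := continuous_stretchMap k hl
  continuous_invFun := continuous_stretchMap k (inv_pos.2 hl)

theorem stretch_eq_zero_iff {l : ℝ} (hl : 0 < l) (j : Fin 3) :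
    (stretch hl k p).1 j = 0 ↔ p.1 j = 0 := stretchFun_eq_zero_iff p k hl j

/-- A stretch adjusted to one side is the identity on the other two, so the stretches of the three
sides can be composed without interfering on the boundary. -/
theorem stretch_of_eq_zero {l : ℝ} (hl : 0 < l) {j : Fin 3} (hj : j ≠ k) (h : p.1 j = 0) :
    stretch hl k p = p := by
  have hD := (denom_pos p k hl).ne'
  have h1 := sum_eq p k
  refine Subtype.ext (funext (forall_rotate k ?_ ?_ ?_))
  · exact stretchFun_self k l p.1
  · refine (stretchFun_add_one k l p.1).trans ?_
    obtain rfl | rfl := (eq_or_eq_add j k).resolve_left hj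
    · rw [h, mul_zero, zero_div]
    · rw [h] at hD h1 ⊢
      rw [mul_zero, add_zero] at hD ⊢
      rw [mul_div_cancel_right₀ _ hD]
      linarith
  · refine (stretchFun_add_two k l p.1).trans ?_
    obtain rfl | rfl := (eq_or_eq_add j k).resolve_left hj
    · rw [h] at hD h1 ⊢
      rw [zero_add] at hD ⊢
      rw [mul_div_cancel_right₀ _ hD]
      linarith
    · rw [h, mul_zero, mul_zero, zero_div]

theorem stretch_ratio {l : ℝ} (hl : 0 < l) :
    (stretch hl k p).1 (k + 1) * (l * p.1 (k + 2)) = (stretch hl k p).1 (k + 2) * p.1 (k + 1) := by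
  change stretchFun l k p.1 (k + 1) * _ = stretchFun l k p.1 (k + 2) * _
  rw [stretchFun_add_one, stretchFun_add_two]
  ring

/-- The homeomorphism of the triangle that multiplies by `l k` the ratio of the coordinates `k + 2`
and `k + 1` on the side `k`, for every `k`. -/
noncomputable def stretchSides {l : Fin 3 → ℝ} (hl : ∀ k, 0 < l k) : IdealSimplex ≃ₜ IdealSimplex :=
  (stretch (hl 2) 2).trans ((stretch (hl 1) 1).trans (stretch (hl 0) 0))

theorem stretchSides_eq_zero_iff {l : Fin 3 → ℝ} (hl : ∀ k, 0 < l k) :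
    (stretchSides hl p).1 k = 0 ↔ p.1 k = 0 := by
  change (stretch (hl 0) 0 (stretch (hl 1) 1 (stretch (hl 2) 2 p))).1 k = 0 ↔ _
  rw [stretch_eq_zero_iff, stretch_eq_zero_iff, stretch_eq_zero_iff]

theorem stretchSides_of_eq_zero {l : Fin 3 → ℝ} (hl : ∀ k, 0 < l k) (h : p.1 k = 0) :
    stretchSides hl p = stretch (hl k) k p := by
  change stretch (hl 0) 0 (stretch (hl 1) 1 (stretch (hl 2) 2 p)) = _
  fin_cases k
  · rw [stretch_of_eq_zero p 2 (hl 2) (j := 0) (by decide) h,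
      stretch_of_eq_zero p 1 (hl 1) (j := 0) (by decide) h]
    rfl
  · rw [stretch_of_eq_zero p 2 (hl 2) (j := 1) (by decide) h,
      stretch_of_eq_zero _ 0 (hl 0) (j := 1) (by decide) ((stretch_eq_zero_iff p 1 (hl 1) 1).2 h)]
    rfl
  · rw [stretch_of_eq_zero _ 1 (hl 1) (j := 2) (by decide) ((stretch_eq_zero_iff p 2 (hl 2) 2).2 h),
      stretch_of_eq_zero _ 0 (hl 0) (j := 2) (by decide) ((stretch_eq_zero_iff p 2 (hl 2) 2).2 h)]
    rfl

theorem stretchSides_ratio {l : Fin 3 → ℝ} (hl : ∀ k, 0 < l k) (h : p.1 k = 0) :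
    (stretchSides hl p).1 (k + 1) * (l k * p.1 (k + 2)) =
      (stretchSides hl p).1 (k + 2) * p.1 (k + 1) := by
  rw [stretchSides_of_eq_zero p k hl h, stretch_ratio]

end IdealSimplex

/-! ### Barycentric parametrization of the standard ideal triangle -/

namespace HyperbolicSpace

open IdealSimplex

theorem sum_smul_lightVec (c : Fin 3 → ℝ) : ∑ k, c k • lightVec (stdVec k) =
    !![((c 0 + c 2 : ℝ) : ℂ), c 2; c 2, (c 1 + c 2 : ℝ)] := by
  have h2 : stdVec 2 = ![-1, -1] := rfl
  have h1 : stdVec 1 = ![0, 1] := rfl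
  have h0 : stdVec 0 = ![1, 0] := rfl
  rw [Fin.sum_univ_three, h0, h1, h2, lightVec_pair, lightVec_pair, lightVec_pair]
  ext i j
  fin_cases i <;> fin_cases j <;> simp

/-- Dividing by the square root of `symm2` is therefore what brings a combination of light vectors
to the hyperboloid. -/
theorem det_sum_smul_lightVec (c : Fin 3 → ℝ) :
    (∑ k, c k • lightVec (stdVec k)).det = symm2 c := by
  rw [sum_smul_lightVec, Matrix.det_fin_two]
  simp [symm2]
  ring

theorem posSemidef_lightVec (w : Fin 2 → ℂ) : (lightVec w).PosSemidef :=
  Matrix.posSemidef_vecMulVec_self_star w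

theorem posDef_sum_smul_lightVec {c : Fin 3 → ℝ} (hc : ∀ k, 0 ≤ c k) (h : 0 < symm2 c) :
    (∑ k, c k • lightVec (stdVec k)).PosDef := by
  have h1 : (∑ k, c k • lightVec (stdVec k)).PosSemidef :=
    Matrix.posSemidef_sum _ fun k _ => (posSemidef_lightVec _).smul (hc k)
  refine h1.posDef_iff_isUnit.2 ((Matrix.isUnit_iff_isUnit_det _).2 ?_)
  rw [det_sum_smul_lightVec, isUnit_iff_ne_zero]
  exact Complex.ofReal_ne_zero.2 h.ne'

/-- The parametrization of the standard ideal triangle. -/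
noncomputable def stdTriangle (p : IdealSimplex) : HyperbolicSpace :=
  ⟨(√(symm2 p.1))⁻¹ • ∑ k, p.1 k • lightVec (stdVec k),
    (posDef_sum_smul_lightVec p.2.1 (symm2_pos p)).smul (inv_pos.2 (Real.sqrt_pos.2 (symm2_pos p))),
    by
      have h : (√(symm2 p.1))⁻¹ ^ 2 * symm2 p.1 = 1 := by
        rw [inv_pow, Real.sq_sqrt (symm2_pos p).le, inv_mul_cancel₀ (symm2_pos p).ne']
      rw [← Complex.coe_smul, Matrix.det_smul, det_sum_smul_lightVec, Fintype.card_fin]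
      exact_mod_cast h⟩

theorem eq_of_smul_eq {P Q : HyperbolicSpace} {c : ℝ} (hc : 0 < c) (h : P.1 = c • Q.1) : P = Q := by
  have h1 := congrArg Matrix.det h
  rw [← Complex.coe_smul, Matrix.det_smul, Fintype.card_fin, P.2.2, Q.2.2, mul_one] at h1
  have h2 : c ^ 2 = 1 := by exact_mod_cast h1.symm
  rw [(pow_eq_one_iff_of_nonneg hc.le two_ne_zero).1 h2, one_smul] at h
  exact Subtype.ext h

theorem exists_stdTriangle_eq {P : HyperbolicSpace} {c : Fin 3 → ℝ} (hc : ∀ k, 0 ≤ c k)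
    (h : P.1 = ∑ k, c k • lightVec (stdVec k)) :
    ∃ p, stdTriangle p = P ∧ ∀ k, p.1 k = 0 ↔ c k = 0 := by
  have h1 := P.2.2
  rw [h, det_sum_smul_lightVec] at h1
  have h2 : symm2 c = 1 := by exact_mod_cast h1
  obtain ⟨p, s, hs, rfl⟩ := exists_eq_smul hc (by rw [h2]; exact one_pos)
  refine ⟨p, eq_of_smul_eq (c := (√(symm2 p.1))⁻¹ * s⁻¹)
    (mul_pos (inv_pos.2 (Real.sqrt_pos.2 (symm2_pos p))) (inv_pos.2 hs)) ?_, fun k => ?_⟩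
  · rw [h]
    simp only [stdTriangle, Pi.smul_apply, smul_eq_mul, mul_smul, ← Finset.smul_sum]
    rw [inv_smul_smul₀ hs.ne']
  · simp [hs.ne']

theorem range_stdTriangle : Set.range stdTriangle = idealTriangle stdVertex := by
  ext P
  rw [show stdVertex = fun k => Projectivization.mk ℂ (stdVec k) (stdVec_ne_zero k) from rfl,
    mem_idealTriangle_mk]
  constructor
  · rintro ⟨p, rfl⟩
    refine ⟨fun k => (√(symm2 p.1))⁻¹ * p.1 k, fun k => mul_nonneg (by positivity) (p.2.1 k), ?_⟩
    simp only [mul_smul, ← Finset.smul_sum]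
    rfl
  · rintro ⟨c, hc, h⟩
    obtain ⟨p, hp, -⟩ := exists_stdTriangle_eq hc h
    exact ⟨p, hp⟩

theorem sum_eq_add {M : Type*} [AddCommMonoid M] (f : Fin 3 → M) (k : Fin 3) (h : f k = 0) :
    ∑ j, f j = f (k + 1) + f (k + 2) := by
  rw [Fin.sum_univ_three]
  fin_cases k
  · change f 0 = 0 at h
    rw [h, zero_add]; rfl
  · change f 1 = 0 at h
    rw [h, add_zero, add_comm]; rfl
  · change f 2 = 0 at h
    rw [h, add_zero]; rfl

theorem image_stdTriangle (k : Fin 3) : stdTriangle '' {p | p.1 k = 0} =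
    geodesic (stdVertex (k + 1)) (stdVertex (k + 2)) := by
  ext P
  rw [stdVertex, stdVertex, mem_geodesic_mk]
  constructor
  · rintro ⟨p, hp, rfl⟩
    replace hp : p.1 k = 0 := hp
    refine ⟨(√(symm2 p.1))⁻¹ * p.1 (k + 1), (√(symm2 p.1))⁻¹ * p.1 (k + 2),
      mul_nonneg (by positivity) (p.2.1 _), mul_nonneg (by positivity) (p.2.1 _), ?_⟩
    rw [mul_smul, mul_smul, ← smul_add, ← sum_eq_add (fun j => p.1 j • lightVec (stdVec j)) k]
    · rfl
    · rw [hp, zero_smul]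
  · rintro ⟨s, t, hs, ht, h⟩
    have hc : ∀ j, 0 ≤ Function.update (Function.update (0 : Fin 3 → ℝ) (k + 1) s) (k + 2) t j := by
      intro j
      unfold Function.update
      split_ifs <;> simp [*]
    have hk : Function.update (Function.update (0 : Fin 3 → ℝ) (k + 1) s) (k + 2) t k = 0 := by
      rw [Function.update_of_ne ((by decide : ∀ k : Fin 3, k ≠ k + 2) k),
        Function.update_of_ne ((by decide : ∀ k : Fin 3, k ≠ k + 1) k)]
      rfl
    obtain ⟨p, hp, hp'⟩ := exists_stdTriangle_eq (P := P) hc (by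
      rw [sum_eq_add _ k (by rw [hk, zero_smul]), Function.update_self,
        Function.update_of_ne ((by decide : ∀ k : Fin 3, k + 1 ≠ k + 2) k), Function.update_self, h])
    exact ⟨p, (hp' k).2 hk, hp⟩

theorem continuous_stdTriangle : Continuous stdTriangle := by
  have hc := continuous_coord
  refine Continuous.subtype_mk ?_ _
  refine Continuous.smul (Continuous.inv₀ ?_ fun p => (Real.sqrt_pos.2 (symm2_pos p)).ne') ?_
  · exact Real.continuous_sqrt.comp
      ((((hc 0).mul (hc 1)).add ((hc 1).mul (hc 2))).add ((hc 2).mul (hc 0)))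
  · exact continuous_finsetSum _ fun k _ => (hc k).smul continuous_const

/-- Twice this number is the value of the positive form `P` at `(1, -1)` plus its positive trace. On
the standard triangle it is the sum of the coefficients of the three light vectors, by which
`stdCoord` divides. -/
theorem trace_sub_pos (P : HyperbolicSpace) : 0 < (P.1 0 0).re + (P.1 1 1).re - (P.1 0 1).re := by
  have h1 := P.2.1.re_dotProduct_pos (x := ![1, -1]) fst_ne_zero
  have h2 : (P.1 1 0).re = (P.1 0 1).re := by
    rw [← conj_apply P 0 1]
    simp
  have h3 := (Complex.lt_def.1 (P.2.1.diag_pos (i := 0))).1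
  have h4 := (Complex.lt_def.1 (P.2.1.diag_pos (i := 1))).1
  simp [Matrix.mulVec, dotProduct, Fin.sum_univ_two, h2] at h1 h3 h4
  linarith

/-- The barycentric coordinates of the projection of a point of hyperbolic space to the plane
containing the standard ideal triangle. -/
noncomputable def stdCoord (P : HyperbolicSpace) : Fin 3 → ℝ :=
  ((P.1 0 0).re + (P.1 1 1).re - (P.1 0 1).re)⁻¹ •
    ![(P.1 0 0).re - (P.1 0 1).re, (P.1 1 1).re - (P.1 0 1).re, (P.1 0 1).re]

theorem continuous_stdCoord : Continuous stdCoord := by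
  have hc : ∀ i j, Continuous fun P : HyperbolicSpace => (P.1 i j).re := fun i j =>
    Complex.continuous_re.comp ((continuous_apply j).comp
      ((continuous_apply i).comp continuous_subtype_val))
  refine Continuous.smul ((((hc 0 0).add (hc 1 1)).sub (hc 0 1)).inv₀
    fun P => (trace_sub_pos P).ne') (continuous_pi fun k => ?_)
  fin_cases k
  · exact (hc 0 0).sub (hc 0 1)
  · exact (hc 1 1).sub (hc 0 1)
  · exact hc 0 1

theorem stdCoord_stdTriangle (p : IdealSimplex) : stdCoord (stdTriangle p) = p.1 := by
  have hs := (Real.sqrt_pos.2 (symm2_pos p)).ne'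
  have h := p.2.2.1
  rw [Fin.sum_univ_three] at h
  have e : (stdTriangle p).1 = (√(symm2 p.1))⁻¹ • _ := rfl
  rw [sum_smul_lightVec] at e
  have e00 : ((stdTriangle p).1 0 0).re = (√(symm2 p.1))⁻¹ * (p.1 0 + p.1 2) := by
    rw [e]; simp [mul_add]
  have e01 : ((stdTriangle p).1 0 1).re = (√(symm2 p.1))⁻¹ * p.1 2 := by
    rw [e]; simp
  have e11 : ((stdTriangle p).1 1 1).re = (√(symm2 p.1))⁻¹ * (p.1 1 + p.1 2) := by
    rw [e]; simp [mul_add]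
  have e1 : (√(symm2 p.1))⁻¹ * (p.1 0 + p.1 2) + (√(symm2 p.1))⁻¹ * (p.1 1 + p.1 2) -
      (√(symm2 p.1))⁻¹ * p.1 2 = (√(symm2 p.1))⁻¹ := by
    linear_combination (√(symm2 p.1))⁻¹ * h
  rw [stdCoord, e00, e01, e11, e1, inv_inv]
  funext k
  fin_cases k
  · simp; field_simp; ring
  · simp; field_simp; ring
  · simp; field_simp

/-- `stdCoord` is a continuous left inverse, up to the inclusion of the triangle in the space of
coordinates. -/
theorem isEmbedding_stdTriangle : Topology.IsEmbedding stdTriangle := by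
  refine Topology.IsEmbedding.of_comp continuous_stdTriangle continuous_stdCoord ?_
  rw [show stdCoord ∘ stdTriangle = Subtype.val from funext stdCoord_stdTriangle]
  exact Topology.IsEmbedding.subtypeVal

end HyperbolicSpace

/-! ### The pleated surface with given shear-bend parameters -/

open Projectivization HyperbolicSpace IdealSimplex

theorem exists_mulVec_eq_of_smul_mk {g : SL(2, ℂ)} {a b : Fin 2 → ℂ} {ha : a ≠ 0} {hb : b ≠ 0}
    (h : g • (mk ℂ a ha : SphereAtInfinity) = mk ℂ b hb) : ∃ c : ℂ, g.1 *ᵥ a = c • b := by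
  rw [HyperbolicSpace.smul_mk] at h
  obtain ⟨c, hc⟩ := (mk_eq_mk_iff' ℂ _ _ _ _).1 h
  exact ⟨c, hc.symm⟩

theorem wedge_mulVec (g : SL(2, ℂ)) (a b : Fin 2 → ℂ) :
    wedge (g.1 *ᵥ a) (g.1 *ᵥ b) = wedge a b := by
  have h := g.2
  rw [Matrix.det_fin_two] at h
  simp only [wedge, Matrix.mulVec, dotProduct, Fin.sum_univ_two]
  linear_combination (a 0 * b 1 - a 1 * b 0) * h

theorem wedge_self (a : Fin 2 → ℂ) : wedge a a = 0 := by unfold wedge; ring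

theorem wedge_add_left (a b c : Fin 2 → ℂ) : wedge (a + b) c = wedge a c + wedge b c := by
  simp only [wedge, Pi.add_apply]; ring

theorem wedge_sub_left (a b c : Fin 2 → ℂ) : wedge (a - b) c = wedge a c - wedge b c := by
  simp only [wedge, Pi.sub_apply]; ring

/-- A lift of the gluing multiplies the two vectors over the common side by factors `α` and `β`. The
position of the third vertex gives `β = -α * y`, and the determinant gives `α ^ 2 * y = 1`; hence
`‖α‖ ^ 2 = ‖y‖⁻¹` and `‖β‖ ^ 2 = ‖y‖`. -/
theorem exists_gluing_eq (y : ℂˣ) (k k' : Fin 3) : ∃ g : SL(2, ℂ),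
    (QuotientGroup.mk g : PSL(2, ℂ)) = gluing y k k' ∧
    isometry g (lightVec (stdVec (k' + 1))) = ‖(y : ℂ)‖⁻¹ • lightVec (stdVec (k + 2)) ∧
    isometry g (lightVec (stdVec (k' + 2))) = ‖(y : ℂ)‖ • lightVec (stdVec (k + 1)) := by
  obtain ⟨g, hg⟩ := QuotientGroup.mk_surjective (gluing y k k')
  have h0 := gluing_smul y k k'
  have h1 := gluing_smul_add_one y k k'
  have h2 := gluing_smul_add_two y k k'
  rw [← hg] at h0 h1 h2
  obtain ⟨γ, h0⟩ := exists_mulVec_eq_of_smul_mk (g := g) h0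
  obtain ⟨α, h1⟩ := exists_mulVec_eq_of_smul_mk (g := g) h1
  obtain ⟨β, h2⟩ := exists_mulVec_eq_of_smul_mk (g := g) h2
  have hdet := wedge_mulVec g (stdVec (k' + 1)) (stdVec (k' + 2))
  rw [h1, h2, wedge_smul_left, wedge_smul_right, wedge_stdVec', wedge_stdVec] at hdet
  rw [stdVec_eq k', Matrix.mulVec_smul, Matrix.mulVec_add, h1, h2] at h0
  have ha : -α = γ := by
    have h := congrArg (fun v => wedge v (stdVec (k + 1))) h0
    simp only [wedge_smul_left, wedge_add_left, wedge_sub_left, wedge_self, wedge_stdVec'] at h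
    linear_combination -h
  have hb : β = γ * y := by
    have h := congrArg (fun v => wedge v (stdVec (k + 2))) h0
    simp only [wedge_smul_left, wedge_add_left, wedge_sub_left, wedge_self, wedge_stdVec] at h
    linear_combination -h
  have hα : α * α * y = 1 := by
    rw [hb, ← ha] at hdet
    linear_combination hdet
  have hy : ‖(y : ℂ)‖ ≠ 0 := norm_ne_zero_iff.2 y.ne_zero
  have hn : ‖α‖ * ‖α‖ * ‖(y : ℂ)‖ = 1 := by
    rw [← norm_mul, ← norm_mul, hα, norm_one]
  have hn' : ‖α‖ ^ 2 = ‖(y : ℂ)‖⁻¹ := by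
    rw [← one_div, eq_div_iff hy, ← hn]; ring
  refine ⟨g, hg, ?_, ?_⟩
  · rw [← lightVec_smul_vec, h1, lightVec_smul, Complex.normSq_eq_norm_sq, hn']
  · rw [← lightVec_smul_vec, h2, lightVec_smul, Complex.normSq_eq_norm_sq, hb, ← ha, norm_mul,
      norm_neg, mul_pow, hn']
    congr 1
    field_simp

theorem coe_stdTriangle_of_eq_zero {p : IdealSimplex} {k : Fin 3} (h : p.1 k = 0) :
    (stdTriangle p).1 = (√(symm2 p.1))⁻¹ •
      (p.1 (k + 1) • lightVec (stdVec (k + 1)) + p.1 (k + 2) • lightVec (stdVec (k + 2))) := by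
  rw [← sum_eq_add (fun j => p.1 j • lightVec (stdVec j)) k (by rw [h, zero_smul])]
  rfl

/-- The gluing of the standard ideal triangle and of the adjacent one along a side. -/
theorem stdTriangle_eq_gluing_smul {y : ℂˣ} {k k' : Fin 3} {p q : IdealSimplex} (hp : p.1 k = 0)
    (hq : q.1 k' = 0) (h : q.1 (k' + 1) * ‖(y : ℂ)‖⁻¹ * p.1 (k + 1) =
      q.1 (k' + 2) * ‖(y : ℂ)‖ * p.1 (k + 2)) :
    stdTriangle p = gluing y k k' • stdTriangle q := by
  obtain ⟨g, hg, h1, h2⟩ := exists_gluing_eq y k k'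
  rw [← hg]
  change _ = g • stdTriangle q
  have hy : 0 < ‖(y : ℂ)‖ := norm_pos_iff.2 y.ne_zero
  obtain ⟨-, hp2⟩ := pos_of_eq_zero p k hp
  obtain ⟨hq1, -⟩ := pos_of_eq_zero q k' hq
  have sp := Real.sqrt_pos.2 (symm2_pos p)
  have sq := Real.sqrt_pos.2 (symm2_pos q)
  -- Proportional points of the hyperboloid coincide. The factor is read off at the vertex `k + 2`,
  -- and the hypothesis `h` is the agreement at `k + 1`.
  refine (eq_of_smul_eq (c := √(symm2 p.1) * (√(symm2 q.1))⁻¹ *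
    (q.1 (k' + 1) * ‖(y : ℂ)‖⁻¹ / p.1 (k + 2))) (by positivity) ?_).symm
  rw [coe_smul_eq, coe_stdTriangle_of_eq_zero hp, coe_stdTriangle_of_eq_zero hq, map_smul, map_add,
    map_smul, map_smul, h1, h2]
  simp only [smul_add, smul_smul]
  rw [add_comm]
  congr 2
  · field_simp
    field_simp at h
    linarith
  · field_simp

namespace HyperbolicSpace

theorem continuous_smul' (g : PSL(2, ℂ)) : Continuous fun P : HyperbolicSpace => g • P := by
  induction g using QuotientGroup.induction_on with | H g
  refine Continuous.subtype_mk ?_ _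
  exact (continuous_const.matrix_mul continuous_subtype_val).matrix_mul continuous_const

/-- The homeomorphism defined by an isometry. -/
noncomputable def smulHomeomorph (g : PSL(2, ℂ)) : HyperbolicSpace ≃ₜ HyperbolicSpace where
  toEquiv := MulAction.toPerm g
  continuous_toFun := continuous_smul' g
  continuous_invFun := continuous_smul' g⁻¹

end HyperbolicSpace

namespace IdealTriangulation

variable {m n : ℕ} (T : IdealTriangulation m n) {o : Fin m} (x : Fin n → ℂˣ)

theorem norm_inv_pos (j : Fin m) (k : Fin 3) : 0 < ‖(x (T.edge (j, k)) : ℂ)‖⁻¹ :=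
  inv_pos.2 (norm_pos_iff.2 (Units.ne_zero _))

/-- The developing map on a face of the universal cover. -/
noncomputable def devFace (F : T.LiftedFace o) (p : IdealSimplex) : HyperbolicSpace :=
  T.monodromy x F.word • stdTriangle (stretchSides (T.norm_inv_pos x F.face) p)

/-- The gluing isometry shifts the ratio of the two coordinates on the common side by `‖x‖ ^ 2`. The
stretches compensate for half of this on each of the two faces, whence the factor `‖x‖⁻¹`, which
depends only on the edge. -/
theorem devFace_eq_of_coverGlue {P Q : Σ _ : T.LiftedFace o, IdealSimplex}
    (h : T.CoverGlue o P Q) : T.devFace x P.1 P.2 = T.devFace x Q.1 Q.2 := by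
  obtain ⟨F, p⟩ := P
  obtain ⟨F', q⟩ := Q
  obtain ⟨k, k', rfl, rfl, hp, hq, h1, h2⟩ := h
  simp only at hp hq h1 h2
  set k' := (T.opp (F.face, k)).2 with hk'
  rw [devFace, devFace, monodromy_neighbor, mul_smul]
  congr 1
  refine stdTriangle_eq_gluing_smul ((stretchSides_eq_zero_iff p k _).2 hp)
    ((stretchSides_eq_zero_iff q k' _).2 hq) ?_
  have r1 := stretchSides_ratio p k (T.norm_inv_pos x F.face) hp
  have r2 := stretchSides_ratio q k' (T.norm_inv_pos x (F.neighbor k).face) hq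
  rw [edge_neighbor F k, h1, h2] at r2
  obtain ⟨ha, hb⟩ := pos_of_eq_zero p k hp
  have hy : ‖(x (T.edge (F.face, k)) : ℂ)‖ ≠ 0 := norm_ne_zero_iff.2 (Units.ne_zero _)
  refine mul_right_cancel₀ (mul_pos ha hb).ne' ?_
  rw [← hk']
  generalize ‖(x (T.edge (F.face, k)) : ℂ)‖ = c at *
  have hc : c⁻¹ * c = 1 := inv_mul_cancel₀ hy
  generalize c⁻¹ = d at *
  generalize (stretchSides (T.norm_inv_pos x F.face) p).1 (k + 1) = P₁ at *
  generalize (stretchSides (T.norm_inv_pos x F.face) p).1 (k + 2) = P₂ at *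
  generalize (stretchSides (T.norm_inv_pos x (F.neighbor k).face) q).1 (k' + 1) = Q₁ at *
  generalize (stretchSides (T.norm_inv_pos x (F.neighbor k).face) q).1 (k' + 2) = Q₂ at *
  linear_combination c * Q₂ * p.1 (k + 2) * r1 + c * P₁ * d * p.1 (k + 2) * r2 -
    d * Q₁ * P₁ * p.1 (k + 1) * p.1 (k + 2) * hc

/-- The developing map, with values in hyperbolic space. -/
noncomputable def devMap : T.UniversalCover o → HyperbolicSpace :=
  Quot.lift (fun P => T.devFace x P.1 P.2) fun _ _ h => T.devFace_eq_of_coverGlue x h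

theorem devMap_incl (F : T.LiftedFace o) (p : IdealSimplex) :
    T.devMap x (F.incl p) = T.devFace x F p := rfl

theorem isEmbedding_devFace (F : T.LiftedFace o) : Topology.IsEmbedding (T.devFace x F) :=
  (smulHomeomorph _).isEmbedding.comp (isEmbedding_stdTriangle.comp (Homeomorph.isEmbedding _))

theorem continuous_devMap : Continuous (T.devMap x (o := o)) := by
  refine continuous_quot_lift _ ?_
  exact continuous_sigma fun F => (T.isEmbedding_devFace x F).continuous

theorem devFace_deck (γ : T.piOne o) (F : T.LiftedFace o) (p : IdealSimplex) :
    T.devFace x (F.deck γ) p = T.monodromy x γ.1 • T.devFace x F p := by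
  rw [devFace, devFace, ← mul_smul, ← map_mul]; rfl

variable {T x}

/-- The pleated surface obtained from the developing map, for an enhanced homomorphism conjugate to
the one that has the shear-bend parameters `x`. -/
theorem EnhancedHom.hasWeights_of_isConj {E : T.EnhancedHom o} (h : (T.developed x).IsConj E) :
    E.HasWeights x := by
  obtain ⟨A, hr, hξ⟩ := h
  have himg : ∀ (g : PSL(2, ℂ)) (a : Fin 3 → SphereAtInfinity), (g • ·) '' idealTriangle a =
      idealTriangle (fun k => g • a k) := by
    intro g a
    ext P
    refine ⟨?_, fun hP => ⟨g⁻¹ • P, (smul_mem_idealTriangle' g).1 ?_, smul_inv_smul g P⟩⟩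
    · rintro ⟨Q, hQ, rfl⟩
      exact (smul_mem_idealTriangle' g).2 hQ
    · rwa [smul_inv_smul]
  have himg' : ∀ (g : PSL(2, ℂ)) (a b : SphereAtInfinity), (g • ·) '' geodesic a b =
      geodesic (g • a) (g • b) := by
    intro g a b
    ext P
    refine ⟨?_, fun hP => ⟨g⁻¹ • P, (smul_mem_geodesic' g).1 ?_, smul_inv_smul g P⟩⟩
    · rintro ⟨Q, hQ, rfl⟩
      exact (smul_mem_geodesic' g).2 hQ
    · rwa [smul_inv_smul]
  let f : T.PleatedSurface o E.r :=
    { toFun := fun u => A • T.devMap x u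
      continuous_toFun := (continuous_smul' A).comp (T.continuous_devMap x)
      vertex := fun F k => (A * T.monodromy x F.word) • stdVertex k
      vertex_injective := fun F => (MulAction.injective _).comp stdVertex_injective
      isEmbedding := fun F => (smulHomeomorph A).isEmbedding.comp (T.isEmbedding_devFace x F)
      range_face := fun F => by
        rw [← himg, ← range_stdTriangle, ← (stretchSides
          (T.norm_inv_pos x F.face)).surjective.range_comp stdTriangle, ← Set.range_comp]
        congr 1
        funext p
        exact (mul_smul _ _ _).symm
      image_side := fun F k => by
        rw [← himg', ← image_stdTriangle]
        -- The stretched parametrization maps each side onto itself.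
        have : {p : IdealSimplex | p.1 k = 0} =
            stretchSides (T.norm_inv_pos x F.face) '' {p | p.1 k = 0} := by
          rw [Homeomorph.image_eq_preimage_symm]
          ext p
          obtain ⟨q, rfl⟩ := (stretchSides (T.norm_inv_pos x F.face)).surjective p
          rw [Set.mem_preimage, Homeomorph.symm_apply_apply]
          exact stretchSides_eq_zero_iff q k _
        conv_rhs => rw [this, Set.image_image, Set.image_image]
        refine Set.image_congr fun p _ => ?_
        exact (mul_smul _ _ _).symm
      equivariant := fun γ F p => by
        rw [devMap_incl, devMap_incl, devFace_deck, hr, mul_smul, mul_smul, inv_smul_smul]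
        rfl }
  refine ⟨f, fun F k => ?_, fun F k => ?_⟩
  · rw [hξ]
    exact (mul_smul _ _ _).trans (congrArg (A • ·) (T.devPoint_vertexGroup x F k).symm)
  · change IsShearBend ((A * T.monodromy x F.word) • stdVertex (k + 2)) _
      ((A * T.monodromy x F.word) • stdVertex k)
      ((A * T.monodromy x (F.neighbor k).word) • stdVertex (T.opp (F.face, k)).2) _
    rw [monodromy_neighbor, ← mul_assoc, mul_smul (A * T.monodromy x F.word), gluing_smul]
    exact (isShearBend_smul' _).2 ((isShearBend_flipVertex (Units.ne_zero _) k).2 rfl)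

end IdealTriangulation

/-! ### Conjugacy of enhanced homomorphisms and the main theorem -/

namespace IdealTriangulation.EnhancedHom

variable {m n : ℕ} {T : IdealTriangulation m n} {o : Fin m} {E E' E'' : T.EnhancedHom o}

theorem IsConj.symm (h : E.IsConj E') : E'.IsConj E := by
  obtain ⟨A, hr, hξ⟩ := h
  refine ⟨A⁻¹, fun γ => ?_, fun π => ?_⟩
  · rw [hr]; group
  · rw [hξ, inv_smul_smul]

theorem IsConj.trans (h : E.IsConj E') (h' : E'.IsConj E'') : E.IsConj E'' := by
  obtain ⟨A, hr, hξ⟩ := h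
  obtain ⟨B, hr', hξ'⟩ := h'
  refine ⟨B * A, fun γ => ?_, fun π => ?_⟩
  · rw [hr', hr]; group
  · rw [hξ', hξ, mul_smul]

theorem IsConj.refl (E : T.EnhancedHom o) : E.IsConj E :=
  ⟨1, fun γ => by group, fun π => (one_smul _ _).symm⟩

theorem HasWeights.realizes {x : Fin n → ℂˣ} (h : E.HasWeights x) : E.Realizes :=
  h.imp fun _ hf => hf.1

end IdealTriangulation.EnhancedHom

/-- The association splits into a geometric and an algebraic condition that share only the weights
`x`, so the two classifications can be applied separately. -/
theorem LocalRep.isClassifiedBy_iff {m n N : ℕ} {T : IdealTriangulation m n} {o : Fin m} {q : ℂˣ}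
    {V : Fin m → Type u} [∀ j, AddCommGroup (V j)] [∀ j, Module ℂ (V j)] {ρ : LocalRep q V T}
    {E : T.EnhancedHom o} {h : ℂˣ} :
    ρ.IsClassifiedBy N E h ↔ ∃ x, E.HasWeights x ∧ LocalRep.HasScalars N ρ x h :=
  ⟨fun ⟨⟨x, hx, h1⟩, h2⟩ => ⟨x, hx, h1, h2⟩, fun ⟨x, hx, h1, h2⟩ => ⟨⟨x, hx, h1⟩, h2⟩⟩

theorem mainTheorem9 {m n N : ℕ} (T : IdealTriangulation m n) (o : Fin m) (q : ℂˣ)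
    (hq : IsLeast {M : ℕ | 0 < M ∧ (q : ℂ) ^ M = (-1) ^ (M + 1)} N) :
    -- the edge weights of an enhanced homomorphism realizing the triangulation are well defined,
    -- and so is its total peripheral load
    (∀ E : T.EnhancedHom o, E.Realizes → (∃! x : Fin n → ℂˣ, E.HasWeights x) ∧
      ∃! c : ℂˣ, E.HasLoad c) ∧
    -- every local representation is associated to some pair `(E, h)`
    (∀ (V : Fin m → Type u) [∀ j, AddCommGroup (V j)] [∀ j, Module ℂ (V j)]
      (ρ : LocalRep q V T), ∃ (E : T.EnhancedHom o) (h : ℂˣ), ρ.IsClassifiedBy N E h) ∧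
    -- in such a pair, `E` realizes the triangulation and `h` is an `N`-th root of its load
    (∀ (V : Fin m → Type u) [∀ j, AddCommGroup (V j)] [∀ j, Module ℂ (V j)]
      (ρ : LocalRep q V T) (E : T.EnhancedHom o) (h : ℂˣ), ρ.IsClassifiedBy N E h →
        E.Realizes ∧ E.HasLoad (h ^ N)) ∧
    -- the pairs associated to a local representation form a single class
    (∀ (V : Fin m → Type u) [∀ j, AddCommGroup (V j)] [∀ j, Module ℂ (V j)]
      (ρ : LocalRep q V T) (E E' : T.EnhancedHom o) (h h' : ℂˣ), ρ.IsClassifiedBy N E h →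
        (ρ.IsClassifiedBy N E' h' ↔ E.IsConj E' ∧ h = h')) ∧
    -- the local representations associated to a pair form a single isomorphism class
    (∀ (V V' : Fin m → Type u) [∀ j, AddCommGroup (V j)] [∀ j, Module ℂ (V j)]
      [∀ j, AddCommGroup (V' j)] [∀ j, Module ℂ (V' j)]
      (ρ : LocalRep q V T) (ρ' : LocalRep q V' T) (E : T.EnhancedHom o) (h : ℂˣ),
        ρ.IsClassifiedBy N E h → (ρ'.IsClassifiedBy N E h ↔ ρ.IsIso ρ')) ∧
    -- every pair consisting of an enhanced homomorphism realizing the triangulation and of an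
    -- `N`-th root of its load occurs
    (∀ (E : T.EnhancedHom o) (h : ℂˣ), E.Realizes → E.HasLoad (h ^ N) →
      ∃ (V : Fin m → Type u) (_ : ∀ j, AddCommGroup (V j)) (_ : ∀ j, Module ℂ (V j))
        (ρ : LocalRep q V T), ρ.IsClassifiedBy N E h) := by
  have hprim := isPrimitiveRoot_sq_of_isLeast hq
  have hqN := pow_mul_self_of_isLeast hq
  have : NeZero N := ⟨hq.1.1.ne'⟩
  simp only [LocalRep.isClassifiedBy_iff]
  refine ⟨fun E hE => ?_, fun V _ _ ρ => ?_, fun V _ _ ρ E h => ?_, fun V _ _ ρ E E' h h' => ?_,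
    fun V V' _ _ _ _ ρ ρ' E h => ?_, fun E h _ hload => ?_⟩
  · obtain ⟨x, hx⟩ := IdealTriangulation.EnhancedHom.exists_hasWeights hE
    refine ⟨⟨x, hx, fun x' hx' => hx'.unique hx⟩, ∏ i, x i, ⟨x, hx, rfl⟩, ?_⟩
    rintro c ⟨x', hx', rfl⟩
    rw [hx'.unique hx]
  · obtain ⟨x, h, H⟩ := LocalRep.exists_hasScalars hprim hqN ρ
    exact ⟨T.developed x, h, x,
      IdealTriangulation.EnhancedHom.hasWeights_of_isConj (.refl _), H⟩
  · rintro ⟨x, hx, H⟩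
    exact ⟨hx.realizes, x, hx, H.pow_eq hqN⟩
  · rintro ⟨x, hx, H⟩
    constructor
    · rintro ⟨x', hx', H'⟩
      obtain ⟨rfl, rfl⟩ := H.unique H'
      exact ⟨hx.isConj_developed.symm.trans hx'.isConj_developed, rfl⟩
    · rintro ⟨hE, rfl⟩
      exact ⟨x, IdealTriangulation.EnhancedHom.hasWeights_of_isConj
        (hx.isConj_developed.trans hE), H⟩
  · rintro ⟨x, hx, H⟩
    constructor
    · rintro ⟨x', hx', H'⟩
      obtain rfl := hx.unique hx'
      exact H.isIso hprim hqN H'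
    · exact fun hiso => ⟨x, hx, H.of_isIso hprim hqN hiso⟩
  · obtain ⟨x, hx, hh⟩ := hload
    obtain ⟨ρ, H⟩ := LocalRep.exists_of_pow_eq hprim hqN o hh
    exact ⟨_, _, _, ρ, x, hx, H⟩
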